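/- **Theorem 4.2 (log-of-data-count parameter, one work tape).** *Families.* The convolution of two words $x,y$ is the word of length $\max(|x|,|y|)$ whose $i$-th letter is the pair of the $i$-th letters of $x$ and $y$, a padding symbol being used beyond the end of the shorter word. An automatic family $\{L_e : e\in I\}$ consists of a regular set $I$ of words over a finite alphabet (the indices) and of non-empty languages $L_e$ over a finite alphabet $\Sigma$ such that $\{\mathrm{conv}(e,x) : e\in I,\ x\in L_e\}$ is regular. *Learning.* A text for a language $L$ is an infinite sequence $w_0,w_1,\dots$ of words, repetitions allowed, whose set of terms is exactly $L$. A sequence of conjectures identifies $L_e$ if all conjectures belong to $I$ and the sequence is eventually constant with a final value $d$ such that $L_d=L_e$. The family is learnable if there is a learner (a map from finite sequences of words to words, computable or not) whose conjectures, on the initial segments of any text for any $L_e$, $e\in I$, identify $L_e$. *Linear-time learners with one work tape.* Such a learner is a deterministic Turing machine with a base tape and one additional work tape, both one-sided infinite with an unmodifiable left end marker. It operates in cycles $k=0,1,2,\dots$ Cycle $k$ starts in a fixed start state, with the base tape containing $\mathrm{conv}(w_k,m_k)$ followed by blanks and the base head on the left end marker, where $w_k\in\Sigma^*$ is the current datum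 and $m_k$ is the long term memory, a word over a finite alphabet; $m_0$ is fixed. The cycle ends when the machine halts in an accepting state; then the base tape has to contain, between the left end marker and the first blank, $\mathrm{conv}(m_{k+1},e_k)$, where $m_{k+1}$ is the new long term memory and $e_k$ is the conjecture. The work tape is initially blank with its head on the left end marker, and its content and head position are unchanged between cycles. *Claim.* For a data sequence $w_0,w_1,\dots$ let $$n_k=\lfloor\log_2(k+1)\rfloor+\max_{i\le k}|w_i|,$$ the logarithm of the number of data seen so far in cycle $k$ plus the length of the longest datum seen so far. For every learnable automatic family $\{L_e:e\in I\}$ there are such a learner and a constant $c$ such that, for every sequence $w_0,w_1,\ldots\in\Sigma^*$ and every $k$, * cycle $k$ ends, with an output of the required form, after at most $c\,(n_k+1)$ steps; * throughout cycle $k$ the head of the base tape stays within the left end marker and the first $n_k+c$ cells, and $|m_{k+1}|,|e_k|\le n_k+c$; and such that, whenever $w_0,w_1,\dots$ is a text for some $L_e$ with $e\in I$, the conjectures $e_0,e_1,\dots$ identify $L_e$. -/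

import Mathlib

namespace LinLearn

universe u v

/-- Convolution of two words: position `i` carries the pair of the `i`-th letters, where `none` is
the padding symbol used beyond the end of the shorter word. -/
def conv {A : Type u} {B : Type v} (x : List A) (y : List B) : List (Option A × Option B) :=
  (List.range (max x.length y.length)).map fun i => (x[i]?, y[i]?)

/-- An automatic family `{L_e : e ∈ I}` of non-empty languages over the alphabet `S`, with a set `I`
of indices that are words over the alphabet `G`. -/
structure AutomaticFamily (S : Type u) (G : Type v) where
  /-- the index set `I` -/
  index : Language G
  /-- the language `L_e` (only its values for `e ∈ I` matter) -/
  lang : List G → Language S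
  nonempty : ∀ e ∈ index, ∃ x, x ∈ lang e
  index_regular : index.IsRegular
  graph_regular :
    Language.IsRegular
      ({z | ∃ e ∈ index, ∃ x ∈ lang e, z = conv e x} : Language (Option G × Option S))

/-- The sequence `w` is a text for `L`: it lists exactly the elements of `L`, in any order and with
repetitions allowed. -/
def IsText {S : Type u} (w : ℕ → List S) (L : Language S) : Prop :=
  ∀ x, x ∈ L ↔ ∃ k, w k = x

/-- The sequence `h` of conjectures consists of indices of the family and is eventually constant,
with a final value that is an index of `L`. -/
def AutomaticFamily.Identifies {S : Type u} {G : Type v} (F : AutomaticFamily S G)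
    (h : ℕ → List G) (L : Language S) : Prop :=
  (∀ k, h k ∈ F.index) ∧ ∃ k, F.lang (h k) = L ∧ ∀ k' ≥ k, h k' = h k

/-- The family is learnable (in the limit, from text): some learner, which sees the finite sequence
of all data presented so far, identifies every language of the family from every text for it.
No computability is demanded of this learner, so recursive learners are covered. -/
def AutomaticFamily.Learnable {S : Type u} {G : Type v} (F : AutomaticFamily S G) : Prop :=
  ∃ N : List (List S) → List G, ∀ e ∈ F.index, ∀ w : ℕ → List S, IsText w (F.lang e) →
    F.Identifies (fun k => N ((List.range k).map w)) (F.lang e)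

/-- Head movements. -/
inductive Move where
  | left
  | stay
  | right

/-- A one-sided infinite tape over the alphabet `A` (which contains the blank symbol). Position `0`
carries the left end marker; `cell i` is the content of position `i + 1`. -/
structure Tape (A : Type u) where
  /-- position of the head; `0` is the left end marker -/
  head : ℕ
  cell : ℕ → A

/-- The symbol under the head; `none` stands for the left end marker. -/
def Tape.read {A : Type u} (T : Tape A) : Option A :=
  match T.head with
  | 0 => none
  | i + 1 => some (T.cell i)

/-- Overwrite the symbol under the head; the left end marker cannot be modified. -/
def Tape.write {A : Type u} (T : Tape A) (a : A) : Tape A :=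
  match T.head with
  | 0 => T
  | i + 1 => { T with cell := Function.update T.cell i a }

/-- Move the head; a left move on the left end marker has no effect. -/
def Tape.move {A : Type u} (T : Tape A) (d : Move) : Tape A :=
  match d with
  | Move.left => { T with head := T.head - 1 }
  | Move.stay => T
  | Move.right => { T with head := T.head + 1 }

/-- Symbols of the base tape, for data alphabet `S`, index alphabet `G`, memory alphabet `Mem` and
further symbols `Aux`: the blank, the letters of convolutions of a datum with a memory word, the
letters of convolutions of a memory word with a conjecture, and the further symbols. -/
inductive BaseSym (S : Type u) (G : Type v) (Mem Aux : Type) where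
  | blank
  | inp (a : Option S × Option Mem)
  | out (b : Option Mem × Option G)
  | aux (a : Aux)

/-- A deterministic Turing machine learner with a base tape and one additional work tape. The cells
of the work tape carry elements of `Option Work`, where `none` is the blank. -/
structure Learner (S : Type u) (G : Type v) where
  State : Type
  Mem : Type
  Aux : Type
  Work : Type
  finite_state : Finite State
  finite_mem : Finite Mem
  finite_aux : Finite Aux
  finite_work : Finite Work
  /-- the state in which every cycle starts -/
  start : State
  /-- the accepting states, in which the machine halts -/
  accept : State → Bool
  /-- the transition function: from the state and the two symbols read to the new state, the symbol
  written and the move on the base tape, the symbol written and the move on the work tape -/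
  trans : State → Option (BaseSym S G Mem Aux) → Option (Option Work) →
    State × (BaseSym S G Mem Aux × Move) × (Option Work × Move)
  /-- the initial long term memory -/
  initMem : List Mem

namespace Learner

variable {S : Type u} {G : Type v} (M : Learner S G)

/-- Configurations within a cycle. -/
structure Config where
  state : M.State
  base : Tape (BaseSym S G M.Mem M.Aux)
  work : Tape (Option M.Work)

/-- One computation step; a configuration with accepting state does not change any more. -/
def step (C : M.Config) : M.Config :=
  if M.accept C.state then C
  else
    let r := M.trans C.state C.base.read C.work.read
    { state := r.1
      base := (C.base.write r.2.1.1).move r.2.1.2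
      work := (C.work.write r.2.2.1).move r.2.2.2 }

/-- The configuration at the beginning of a cycle with datum `x`, long term memory `m` and work tape
`W`: the base tape holds the convolution of `x` and `m` followed by blanks, with its head on the left
end marker, while the content and the head position of the work tape are those left by the previous
cycle. -/
def cycleStart (x : List S) (m : List M.Mem) (W : Tape (Option M.Work)) : M.Config where
  state := M.start
  base :=
    { head := 0
      cell := fun i =>
        match (conv x m)[i]? with
        | some a => BaseSym.inp a
        | none => BaseSym.blank }
  work := W

/-- The configuration after `s` steps of such a cycle. -/
def configAt (x : List S) (m : List M.Mem) (W : Tape (Option M.Work)) (s : ℕ) : M.Config :=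
  M.step^[s] (M.cycleStart x m W)

/-- The base tape of `C` holds, from its first cell up to the first blank, the convolution of the
long term memory `m` and the conjecture `h`; what comes behind this blank is irrelevant. -/
def Config.Outputs {M : Learner S G} (C : M.Config) (m : List M.Mem) (h : List G) : Prop :=
  (∀ i (b : Option M.Mem × Option G),
    (conv m h)[i]? = some b → C.base.cell i = BaseSym.out b) ∧
  C.base.cell (conv m h).length = BaseSym.blank

/-- The run of the learner on the data sequence `w`: in cycle `k` the learner reads the datum `w k`,
starts with long term memory `mem k` and work tape `work k`, reaches an accepting state within
`time k` steps, conjectures `hyp k`, and leaves the memory `mem (k + 1)` and the work tape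
`work (k + 1)`. The work tape is blank in the beginning. The sequences `mem`, `work` and `hyp` are
determined by `w`. -/
structure IsRun (w : ℕ → List S) (mem : ℕ → List M.Mem) (work : ℕ → Tape (Option M.Work))
    (hyp : ℕ → List G) (time : ℕ → ℕ) : Prop where
  mem_zero : mem 0 = M.initMem
  work_zero : work 0 = { head := 0, cell := fun _ => none }
  accepts : ∀ k, M.accept (M.configAt (w k) (mem k) (work k) (time k)).state = true
  outputs : ∀ k, (M.configAt (w k) (mem k) (work k) (time k)).Outputs (mem (k + 1)) (hyp k)
  work_succ : ∀ k, work (k + 1) = (M.configAt (w k) (mem k) (work k) (time k)).work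

end Learner

/-- The parameter `n` in cycle `k`, in which the data seen so far are `w 0, …, w k`: the
(downrounded binary) logarithm of the number of data seen so far plus the length of the longest
datum seen so far. -/
def size {S : Type u} (w : ℕ → List S) (k : ℕ) : ℕ :=
  Nat.log 2 (k + 1) + (Finset.range (k + 1)).sup fun i => (w i).length

end LinLearn

namespace LinLearn

universe u v

/-! ### Convolutions of words -/

section Conv

variable {A : Type u} {B : Type v}

/-! There are two halves: an effective learner that tolerates any delay, and a machine that runs it
very slowly within the space bound.

Learning. A learner that converges on all texts for `L_e` has a stabilising (locking) sequence,
whose terms form a tell-tale: a finite subset of `L_e` that is contained in no language of the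
family properly included in `L_e`. How far beyond the length of `e` a tell-tale must reach depends
only on the behaviour of the automata for the family on words up to that length, and this behaviour
has finitely many types. So for one constant `c` the words of `L_e` of length at most `|e| + c` form
a tell-tale (`exists_uniform_telltaleBound`). The relation `Good`, saying that `e` is consistent
with the data and its tell-tale has been seen, is therefore primitive recursive. The learner tries
all words, each infinitely often, and keeps a guess as long as it is good (`Guesser.converges`).

Storage. The base tape is too short for the data, so they are queued on the work tape, whose head
moves only linearly far in a cycle and is not reset between cycles. The head travels back and forth
and writes every datum, followed by an end marker, on the cells that it passes, with separate tracks
for the two directions and for the present and the preceding trip. On arrival at the left marker the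
symbols of the preceding trip are copied to the long term memory. This loses nothing if the memory
has become as long as the preceding trip reached; the machine turns back only when this is the case.

Computation. The memory represents registers in unary, by marked cells, and carries a binary counter
of the cycles. An instruction of a register program is executed only in a cycle in which the counter
overflows; the memory then grows by one cell, so an increment always finds a free cell. The counter
has `log₂(k+1)` digits, so the memory stays within `n_k` plus a constant. Overflows occur infinitely
often, hence every terminating computation is finished eventually (`Traj.At.run`), and primitive
recursive functions have programs (`exists_adds`). Waiting for a long memory is achieved by
computing a bound for the head position into a register.

Each cycle is four sweeps over the base tape (`Sweeper`). `Machine.Rep.step` reduces the machine to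
an abstract state, `Traj.Right` and `Traj.Left` locate all data on the tapes, `Traj.Ready.iterate`
describes a round of the main loop, and `exists_le_of_queue` shows that every symbol is eventually
processed. -/

@[simp] theorem conv_length (x : List A) (y : List B) :
    (conv x y).length = max x.length y.length := by
  simp [conv]

theorem conv_getElem? (x : List A) (y : List B) (i : ℕ) :
    (conv x y)[i]? = if i < max x.length y.length then some (x[i]?, y[i]?) else none := by
  unfold conv
  by_cases h : i < max x.length y.length
  · rw [if_pos h, List.getElem?_map, List.getElem?_range h]; rfl
  · rw [if_neg h, List.getElem?_eq_none]; simpa using h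

/-- Each letter of the convolution records the letters of both words at its position, and both
entries are `none` beyond the end. This makes membership in the graph of the family equivalent to
membership in the language. -/
theorem conv_injective {x x' : List A} {y y' : List B} (h : conv x y = conv x' y') :
    x = x' ∧ y = y' := by
  have key : ∀ i : ℕ, x[i]? = x'[i]? ∧ y[i]? = y'[i]? := by
    intro i
    have hi := congrArg (fun l : List (Option A × Option B) => l[i]?) h
    have hl := congrArg List.length h
    simp only [conv_length] at hl
    simp only [conv_getElem?, ← hl] at hi
    by_cases hlt : i < max x.length y.length
    · rw [if_pos hlt, if_pos hlt] at hi
      simpa using hi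
    · have h' : ¬ i < max x'.length y'.length := hl ▸ hlt
      simp only [lt_max_iff, not_or, not_lt] at hlt h'
      constructor
      · rw [List.getElem?_eq_none hlt.1, List.getElem?_eq_none h'.1]
      · rw [List.getElem?_eq_none hlt.2, List.getElem?_eq_none h'.2]
  exact ⟨List.ext_getElem? fun i => (key i).1, List.ext_getElem? fun i => (key i).2⟩

/-- Serves to cut the run of an automaton on a convolution at position `n`. -/
theorem conv_take_append_conv_drop (n : ℕ) (x : List A) (y : List B) :
    conv (x.take n) (y.take n) ++ conv (x.drop n) (y.drop n) = conv x y := by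
  apply List.ext_getElem?
  intro i
  rw [List.getElem?_append]
  simp only [conv_getElem?, conv_length, List.length_take, List.length_drop, List.getElem?_take,
    List.getElem?_drop]
  by_cases h : i < max (min n x.length) (min n y.length)
  · have h1 : i < n := by omega
    have h2 : i < max x.length y.length := by omega
    simp only [h, h1, h2, if_true]
  · rw [if_neg h]
    by_cases h2 : i < max x.length y.length
    · have h3 : max (min n x.length) (min n y.length) = n := by omega
      rw [h3, if_pos (by omega), if_pos h2, show n + (i - n) = i by omega]
    · rw [if_neg h2, if_neg (by omega)]

theorem conv_cons_cons (a : A) (x : List A) (b : B) (y : List B) :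
    conv (a :: x) (b :: y) = (some a, some b) :: conv x y := by
  have := conv_take_append_conv_drop 1 (a :: x) (b :: y)
  rw [← this]; rfl

theorem conv_nil_cons (b : B) (y : List B) :
    conv ([] : List A) (b :: y) = (none, some b) :: conv [] y := by
  have := conv_take_append_conv_drop 1 ([] : List A) (b :: y)
  rw [← this]; rfl

end Conv

/-! ### Tell-tales and their uniform length bound -/

section Telltale

variable {S : Type u} {G : Type v}

theorem exists_isText [Finite S] {L : Language S} (hL : ∃ x, x ∈ L) :
    ∃ w : ℕ → List S, IsText w L := by
  have : Nonempty {x // x ∈ L} := ⟨⟨hL.choose, hL.choose_spec⟩⟩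
  have : Countable S := Finite.to_countable
  obtain ⟨f, hf⟩ := exists_surjective_nat {x // x ∈ L}
  refine ⟨fun k => (f k).1, fun x => ⟨fun hx => ?_, ?_⟩⟩
  · obtain ⟨k, hk⟩ := hf ⟨x, hx⟩
    exact ⟨k, by simp only [hk]⟩
  · rintro ⟨k, rfl⟩
    exact (f k).2

/-- The infinite sequence that starts with the finite sequence `τ` and goes on with `w`. -/
def prependSeq {X : Type u} (τ : List X) (w : ℕ → X) (k : ℕ) : X :=
  (τ[k]?).getD (w (k - τ.length))

theorem map_range_prependSeq {X : Type u} (τ : List X) (w : ℕ → X) (n : ℕ) :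
    (List.range (τ.length + n)).map (prependSeq τ w) = τ ++ (List.range n).map w := by
  apply List.ext_getElem?
  intro i
  rw [List.getElem?_map, List.getElem?_append]
  by_cases h : i < τ.length
  · rw [List.getElem?_range (by omega), if_pos h]
    simp [prependSeq, h]
  · rw [if_neg h, List.getElem?_map]
    by_cases h2 : i < τ.length + n
    · rw [List.getElem?_range h2, List.getElem?_range (by omega)]
      simp [prependSeq, List.getElem?_eq_none (not_lt.mp h)]
    · rw [List.getElem?_eq_none (by simpa using h2),
        List.getElem?_eq_none (by simp; omega)]
      rfl

theorem IsText.prependSeq {w : ℕ → List S} {L : Language S} (hw : IsText w L) {τ : List (List S)}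
    (hτ : ∀ x ∈ τ, x ∈ L) : IsText (prependSeq τ w) L := by
  intro x
  constructor
  · intro hx
    obtain ⟨k, hk⟩ := (hw x).1 hx
    refine ⟨τ.length + k, ?_⟩
    simp [LinLearn.prependSeq, hk]
  · rintro ⟨k, rfl⟩
    by_cases h : k < τ.length
    · have : LinLearn.prependSeq τ w k = τ[k] := by simp [LinLearn.prependSeq, h]
      rw [this]
      exact hτ _ (List.getElem_mem h)
    · have : LinLearn.prependSeq τ w k = w (k - τ.length) := by
        simp [LinLearn.prependSeq, List.getElem?_eq_none (not_lt.mp h)]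
      rw [this]
      exact (hw _).2 ⟨_, rfl⟩

/-- A learner that converges on all texts for `L` has a stabilising sequence for `L`. -/
theorem exists_stabilising [Finite S] {L : Language S} (hL : ∃ x, x ∈ L)
    {N : List (List S) → List G}
    (hN : ∀ w, IsText w L → ∃ k, ∀ k' ≥ k,
      N ((List.range k').map w) = N ((List.range k).map w)) :
    ∃ τ : List (List S), (∀ x ∈ τ, x ∈ L) ∧
      ∀ ρ : List (List S), (∀ x ∈ ρ, x ∈ L) → N (τ ++ ρ) = N τ := by
  by_contra hcon
  push Not at hcon
  obtain ⟨u, hu⟩ := exists_isText hL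
  let T := {τ : List (List S) // ∀ x ∈ τ, x ∈ L}
  have hext : ∀ τ : T, ∃ ρ : T, N (τ.1 ++ ρ.1) ≠ N τ.1 := fun τ => by
    obtain ⟨ρ, h1, h2⟩ := hcon τ.1 τ.2
    exact ⟨⟨ρ, h1⟩, h2⟩
  choose e he using hext
  -- Extensions on which `N` changes its conjecture alternate with the terms of a text `u` for `L`;
  -- the limit is a text for `L` on which `N` does not converge.
  let nxt : ℕ → T → T := fun i τ => ⟨τ.1 ++ (e τ).1 ++ [u i], by
    intro x hx
    simp only [List.mem_append, List.mem_singleton] at hx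
    rcases hx with (hx | hx) | rfl
    · exact τ.2 x hx
    · exact (e τ).2 x hx
    · exact (hu _).2 ⟨i, rfl⟩⟩
  let P : ℕ → T := fun n => Nat.rec ⟨[], by simp⟩ nxt n
  have hP : ∀ n, (P (n + 1)).1 = (P n).1 ++ (e (P n)).1 ++ [u n] := fun n => rfl
  have hlen : ∀ n, n ≤ (P n).1.length := by
    intro n
    induction n with
    | zero => simp
    | succ n ih => rw [hP]; simp; omega
  have hpre : ∀ m n, m ≤ n → (P m).1 <+: (P n).1 := by
    intro m n hmn
    induction n, hmn using Nat.le_induction with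
    | base => exact List.prefix_rfl
    | succ n _ ih =>
      rw [hP, List.append_assoc]
      exact ih.trans (List.prefix_append _ _)
  -- The default is never used, since `P (k + 1)` has more than `k` terms.
  let w : ℕ → List S := fun k => ((P (k + 1)).1[k]?).getD []
  have hw : ∀ n k, k < (P n).1.length → (P n).1[k]? = some (w k) := by
    intro n k hk
    have hk' : k < (P (k + 1)).1.length := hlen (k + 1)
    have h2 : (P n).1[k]? = (P (k + 1)).1[k]? := by
      rcases le_total n (k + 1) with h | h
      · exact (List.prefix_iff_getElem?.1 (hpre _ _ h) _ hk).symm ▸ List.getElem?_eq_getElem hk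
      · exact (List.prefix_iff_getElem?.1 (hpre _ _ h) _ hk').symm ▸ (List.getElem?_eq_getElem hk').symm
    rw [h2]
    simp [w, hk']
  have hwn : ∀ n (τ : List (List S)), τ <+: (P n).1 → (List.range τ.length).map w = τ := by
    intro n τ hτ
    apply List.ext_getElem?
    intro i
    by_cases h : i < τ.length
    · rw [List.getElem?_map, List.getElem?_range h]
      have h1 := List.prefix_iff_getElem?.1 hτ _ h
      rw [hw n i (lt_of_lt_of_le h hτ.length_le)] at h1
      rw [List.getElem?_eq_getElem h, ← h1]; rfl
    · rw [List.getElem?_eq_none (by simpa using h), List.getElem?_eq_none (by simpa using h)]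
  have htext : IsText w L := by
    intro x
    constructor
    · intro hx
      obtain ⟨i, rfl⟩ := (hu x).1 hx
      refine ⟨((P i).1 ++ (e (P i)).1).length, ?_⟩
      have := hw (i + 1) ((P i).1 ++ (e (P i)).1).length (by rw [hP]; simp)
      rw [hP, List.getElem?_append_right le_rfl] at this
      simpa using this.symm
    · rintro ⟨k, rfl⟩
      have := hw (k + 1) k (hlen (k + 1))
      exact (P (k + 1)).2 _ (List.mem_of_getElem? this)
  obtain ⟨k, hk⟩ := hN w htext
  have h1 := hk _ (hlen k)
  have h2 := hk ((P k).1 ++ (e (P k)).1).length (by have := hlen k; simp; omega)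
  rw [hwn k _ List.prefix_rfl] at h1
  rw [hwn (k + 1) _ (by rw [hP]; exact List.prefix_append _ _)] at h2
  exact he (P k) (h2.trans h1.symm)

/-- Every language of a learnable family has a finite tell-tale. -/
theorem AutomaticFamily.Learnable.exists_telltale [Finite S] {F : AutomaticFamily S G}
    (hF : F.Learnable) {e : List G} (he : e ∈ F.index) :
    ∃ D : List (List S), (∀ x ∈ D, x ∈ F.lang e) ∧
      ∀ d ∈ F.index, (∀ x ∈ D, x ∈ F.lang d) → F.lang d ≤ F.lang e → F.lang d = F.lang e := by
  obtain ⟨N, hN⟩ := hF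
  have hconv : ∀ d ∈ F.index, ∀ w, IsText w (F.lang d) → ∃ k,
      F.lang (N ((List.range k).map w)) = F.lang d ∧ ∀ k' ≥ k,
      N ((List.range k').map w) = N ((List.range k).map w) := fun d hd w hw => (hN d hd w hw).2
  obtain ⟨τ, hτ, hst⟩ := exists_stabilising (F.nonempty e he)
    (N := N) (fun w hw => (hconv e he w hw).imp fun _ h => h.2)
  have key : ∀ d ∈ F.index, (∀ x ∈ τ, x ∈ F.lang d) → F.lang d ≤ F.lang e →
      F.lang (N τ) = F.lang d := by
    intro d hd hτd hde
    obtain ⟨u, hu⟩ := exists_isText (F.nonempty d hd)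
    -- This text for `L_d` begins with `τ` and stays inside `L_e`, so along it the conjecture
    -- remains `N τ`; hence `N τ` is correct for `L_d`.
    obtain ⟨k, hk, hk'⟩ := hconv d hd _ (hu.prependSeq hτd)
    have h1 := hk' (τ.length + k) (by omega)
    rw [map_range_prependSeq, hst _ (by
      intro x hx
      simp only [List.mem_map] at hx
      obtain ⟨i, -, rfl⟩ := hx
      exact hde ((hu _).2 ⟨i, rfl⟩))] at h1
    rw [h1, hk]
  exact ⟨τ, hτ, fun d hd h1 h2 => (key d hd h1 h2).symm.trans (key e he hτ le_rfl)⟩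

/-- `F.lang e` is the only language of the family between its words of length at most `b` and
itself. -/
def AutomaticFamily.TelltaleBound (F : AutomaticFamily S G) (e : List G) (b : ℕ) : Prop :=
  ∀ d ∈ F.index, (∀ x ∈ F.lang e, x.length ≤ b → x ∈ F.lang d) → F.lang d ≤ F.lang e →
    F.lang d = F.lang e

/-- Here `j` still depends on `e`. The sum of the lengths is a crude bound for the length of each
element of the tell-tale. -/
theorem AutomaticFamily.Learnable.exists_telltaleBound [Finite S] {F : AutomaticFamily S G}
    (hF : F.Learnable) {e : List G} (he : e ∈ F.index) : ∃ j, F.TelltaleBound e (e.length + j) := by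
  obtain ⟨D, hD, h⟩ := hF.exists_telltale he
  refine ⟨(D.map List.length).sum, fun d hd h1 h2 => h d hd (fun x hx => h1 x (hD x hx) ?_) h2⟩
  have := List.single_le_sum (l := D.map List.length) (by simp) x.length
    (List.mem_map_of_mem hx)
  omega

section Types

variable {Q Q' : Type} (A : DFA (Option G × Option S) Q) (B : DFA G Q')

/-- The behaviour, on all words of length at most `n`, of the automaton `A` for the indices `e`
and `d`. -/
def pairType (n : ℕ) (e d : List G) : Set (Q × Q × Prop) :=
  {t | ∃ x : List S, x.length ≤ n ∧
    t = (A.eval (conv e x), A.eval (conv d x), x.length = n)}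

/-- The finite information on an index `e` that determines which tell-tale bounds relative to its
length it has. -/
def indexType (e : List G) : Set (Set (Q × Q × Prop) × Q' × Prop) :=
  {t | ∃ d : List G, d.length ≤ e.length ∧
    t = (pairType A e.length e d, B.eval d, d.length = e.length)}

end Types

theorem AutomaticFamily.mem_lang_iff {F : AutomaticFamily S G} {Q : Type}
    {A : DFA (Option G × Option S) Q}
    (hA : A.accepts = {z | ∃ e ∈ F.index, ∃ x ∈ F.lang e, z = conv e x})
    {e : List G} (he : e ∈ F.index) (x : List S) :
    x ∈ F.lang e ↔ A.eval (conv e x) ∈ A.accept := by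
  rw [← DFA.mem_accepts, hA]
  constructor
  · intro hx
    exact ⟨e, he, x, hx, rfl⟩
  · rintro ⟨e', _, x', hx', h⟩
    obtain ⟨rfl, rfl⟩ := conv_injective h
    exact hx'

/-- Beyond position `n` only the state reached there matters, so the initial parts may be replaced
by others leading to the same state, provided that the tails stay aligned. -/
theorem eval_conv_split {Q : Type} (A : DFA (Option G × Option S) Q) (n : ℕ) (d : List G)
    (x : List S) :
    A.eval (conv d x) =
      A.evalFrom (A.eval (conv (d.take n) (x.take n))) (conv (d.drop n) (x.drop n)) := by
  rw [← conv_take_append_conv_drop n d x, DFA.eval, DFA.evalFrom_of_append]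

/-- Words for `e` are matched by words for `e'` if the two indices have the same pair type. -/
theorem exists_matching_word {Q : Type} {A : DFA (Option G × Option S) Q} {e e' d d' f : List G}
    (hP : pairType A e.length e d = pairType A e'.length e' d') (hd : d.length ≤ e.length)
    (hd' : d'.length ≤ e'.length) (hf : d.length = e.length ↔ d'.length = e'.length)
    (hf' : f ≠ [] → d.length = e.length) (x : List S) :
    ∃ x' : List S, (∀ j, x.length ≤ e.length + j ↔ x'.length ≤ e'.length + j) ∧
      A.eval (conv e x) = A.eval (conv e' x') ∧
      A.eval (conv (d ++ f) x) = A.eval (conv (d' ++ f) x') := by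
  have hmem : (A.eval (conv e (x.take e.length)), A.eval (conv d (x.take e.length)),
      (x.take e.length).length = e.length) ∈ pairType A e'.length e' d' := by
    rw [← hP]
    exact ⟨x.take e.length, by simp, rfl⟩
  obtain ⟨y, hy, h⟩ := hmem
  simp only [Prod.mk.injEq, eq_iff_iff] at h
  obtain ⟨h1, h2, h3⟩ := h
  have hx : x.drop e.length ≠ [] → y.length = e'.length := by
    intro hne
    apply h3.1
    have : e.length < x.length := by
      by_contra hcon
      exact hne (List.drop_eq_nil_of_le (by omega))
    simp; omega
  have ty : (y ++ x.drop e.length).take e'.length = y ∧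
      (y ++ x.drop e.length).drop e'.length = x.drop e.length := by
    by_cases hne : x.drop e.length = []
    · rw [hne, List.append_nil]
      exact ⟨List.take_of_length_le hy, List.drop_eq_nil_of_le hy⟩
    · rw [← hx hne]; simp
  have td : ∀ {a b : List G}, b.length ≤ a.length → (f ≠ [] → b.length = a.length) →
      (b ++ f).take a.length = b ∧ (b ++ f).drop a.length = f := by
    intro a b hab hne
    by_cases h0 : f = []
    · subst h0
      rw [List.append_nil]
      exact ⟨List.take_of_length_le hab, List.drop_eq_nil_of_le hab⟩
    · rw [← hne h0]; simp
  -- The part of `x` up to the length of `e` is replaced by `y`, the rest is kept. If the rest is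
  -- non-empty, then `y` has exactly the length of `e'`, so the tails are read from the same states,
  -- and the excess over the length of the index is preserved.
  refine ⟨y ++ x.drop e.length, ?_, ?_, ?_⟩
  · intro j
    rcases Nat.lt_or_ge x.length e.length with h | h
    · have : ¬ y.length = e'.length := fun hh => by have := h3.2 hh; simp at this; omega
      simp; omega
    · have : y.length = e'.length := h3.1 (by simp; omega)
      simp; omega
  · rw [eval_conv_split A e.length e x, eval_conv_split A e'.length e' (y ++ x.drop e.length),
      ty.1, ty.2]
    simp [h1]
  · rw [eval_conv_split A e.length (d ++ f) x,
      eval_conv_split A e'.length (d' ++ f) (y ++ x.drop e.length), ty.1, ty.2,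
      (td hd hf').1, (td hd hf').2, (td hd' (fun h => hf.1 (hf' h))).1,
      (td hd' (fun h => hf.1 (hf' h))).2, h2]

/-- A competitor `c` of `e'` is turned into a competitor of `e`: its part up to the length of `e'`
is exchanged for a word `d` of the same type relative to `e`, its tail is kept. Words are matched in
both directions, so inclusion, agreement up to the bound and equality carry over between the two
pairs. -/
theorem telltaleBound_of_indexType_eq {F : AutomaticFamily S G} {Q Q' : Type}
    {A : DFA (Option G × Option S) Q}
    (hA : A.accepts = {z | ∃ e ∈ F.index, ∃ x ∈ F.lang e, z = conv e x})
    {B : DFA G Q'} (hB : B.accepts = F.index) {e e' : List G} (he : e ∈ F.index)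
    (he' : e' ∈ F.index) (ht : indexType A B e = indexType A B e') {j : ℕ}
    (h : F.TelltaleBound e (e.length + j)) : F.TelltaleBound e' (e'.length + j) := by
  intro c hc h1 h2
  have hmem : (pairType A e'.length e' (c.take e'.length), B.eval (c.take e'.length),
      (c.take e'.length).length = e'.length) ∈ indexType A B e := by
    rw [ht]
    exact ⟨c.take e'.length, by simp, rfl⟩
  obtain ⟨d, hd, hh⟩ := hmem
  simp only [Prod.mk.injEq, eq_iff_iff] at hh
  obtain ⟨hP, hI, hl⟩ := hh
  have hf' : c.drop e'.length ≠ [] → (c.take e'.length).length = e'.length := by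
    intro hne
    have : e'.length < c.length := by
      by_contra hcon
      exact hne (List.drop_eq_nil_of_le (by omega))
    simp; omega
  have hc' : c.take e'.length ++ c.drop e'.length = c := List.take_append_drop _ _
  have hdI : d ++ c.drop e'.length ∈ F.index := by
    have hc2 := hc
    rw [← hc', ← hB, DFA.mem_accepts, DFA.eval, DFA.evalFrom_of_append] at hc2
    rw [← hB, DFA.mem_accepts, DFA.eval, DFA.evalFrom_of_append]
    have : B.evalFrom B.start d = B.evalFrom B.start (c.take e'.length) := hI.symm
    rwa [this]
  have hto := exists_matching_word (A := A) hP (by simp) hd hl hf'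
  have hfrom := exists_matching_word (A := A) hP.symm hd (by simp) hl.symm
    (fun hne => hl.1 (hf' hne))
  rw [hc'] at hto hfrom
  have hdc := h _ hdI (by
    intro x hx hxl
    obtain ⟨x', hl', he1, hd1⟩ := hfrom x
    rw [F.mem_lang_iff hA hdI, hd1, ← F.mem_lang_iff hA hc]
    refine h1 x' ?_ ((hl' j).1 hxl)
    rwa [F.mem_lang_iff hA he', ← he1, ← F.mem_lang_iff hA he]) (by
    intro x hx
    obtain ⟨x', hl', he1, hd1⟩ := hfrom x
    change x ∈ F.lang e
    rw [F.mem_lang_iff hA he, he1, ← F.mem_lang_iff hA he']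
    apply h2
    change x' ∈ F.lang c
    rwa [F.mem_lang_iff hA hc, ← hd1, ← F.mem_lang_iff hA hdI])
  apply le_antisymm h2
  intro x hx
  obtain ⟨x', hl', he1, hd1⟩ := hto x
  change x ∈ F.lang c
  rw [F.mem_lang_iff hA hc, hd1, ← F.mem_lang_iff hA hdI, hdc, F.mem_lang_iff hA he, ← he1,
    ← F.mem_lang_iff hA he']
  exact hx

/-- In a learnable automatic family the tell-tale bounds exceed the length of the index only by a
constant. -/
theorem AutomaticFamily.Learnable.exists_uniform_telltaleBound [Finite S]
    {F : AutomaticFamily S G} (hF : F.Learnable) :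
    ∃ c, ∀ e ∈ F.index, F.TelltaleBound e (e.length + c) := by
  obtain ⟨Q, _, A, hA⟩ := F.graph_regular
  obtain ⟨Q', _, B, hB⟩ := F.index_regular
  let J : {e // e ∈ F.index} → ℕ := fun e => (hF.exists_telltaleBound e.2).choose
  have hJ : ∀ e, F.TelltaleBound e.1 (e.1.length + J e) :=
    fun e => (hF.exists_telltaleBound e.2).choose_spec
  let R : Set (Set (Set (Q × Q × Prop) × Q' × Prop)) :=
    Set.range fun e : {e // e ∈ F.index} => indexType A B e.1
  have hfin : Finite R := inferInstance
  -- One representative for each of the finitely many types; `c` bounds the excess lengths of all of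
  -- them.
  choose rep hrep using fun r : R => r.2
  obtain ⟨c, hc⟩ := (Set.finite_range fun r : R => J (rep r)).bddAbove
  refine ⟨c, fun e he d hd h1 h2 => ?_⟩
  let r : R := ⟨indexType A B e, ⟨e, he⟩, rfl⟩
  have h := telltaleBound_of_indexType_eq hA hB (rep r).2 he (hrep r) (hJ (rep r))
  exact h d hd (fun x hx hxl => h1 x hx (hxl.trans (by have := hc ⟨r, rfl⟩; simp at this; omega)))
    h2

end Telltale

end LinLearn


/-! ### A register machine that computes the primitive recursive functions -/

namespace LinLearn

/-- Symbols of the stream of data: the letters, and `none` as the end marker of a word. -/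
abbrev Sym (s : ℕ) := Option (Fin s)

/-- The positive code of a symbol. -/
def Sym.code {s : ℕ} : Sym s → Fin (s + 2)
  | none => ⟨1, by omega⟩
  | some a => ⟨a + 2, by omega⟩

/-- The store of the background register machine: registers, the symbols loaded and not yet fetched,
the part of the letter fetched last that is not yet unloaded, the letter being formed, the word being
built, the word published last; `eaten` records all symbols fetched so far. -/
structure Store (s g : ℕ) where
  reg : ℕ → ℕ
  load : List (Sym s)
  letter : Fin (s + 2)
  pend : Fin (g + 1)
  build : List (Fin g)
  pub : List (Fin g)
  eaten : List (Sym s)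

/-- The actions of the register machine. -/
inductive Act
  | nop | inc (r : ℕ) | unload (r : ℕ) | tick | push | publish | fill (r : ℕ) | fetch | turn
  deriving DecidableEq

namespace Store

variable {s g : ℕ}

/-- Replace the registers. -/
def setReg (σ : Store s g) (ρ : ℕ → ℕ) : Store s g := { σ with reg := ρ }

@[simp] theorem setReg_reg (σ : Store s g) (ρ : ℕ → ℕ) : (σ.setReg ρ).reg = ρ := rfl
@[simp] theorem setReg_self (σ : Store s g) : σ.setReg σ.reg = σ := rfl

/-- The effect of an action; `len` is the value written by `fill`. -/
def act (len : ℕ) (σ : Store s g) : Act → Store s g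
  | .nop => σ
  | .inc r => σ.setReg (Function.update σ.reg r (σ.reg r + 1))
  | .unload r =>
    if σ.letter = 0 then σ
    else { σ with letter := σ.letter - 1, reg := Function.update σ.reg r (σ.reg r + 1) }
  | .tick => { σ with pend := if h : σ.pend + 1 < g + 1 then ⟨σ.pend + 1, h⟩ else σ.pend }
  | .push => if h : σ.pend = 0 then σ else { σ with pend := 0, build := σ.build ++ [σ.pend.pred h] }
  | .publish => { σ with pub := σ.build, build := [] }
  | .fill r => σ.setReg (Function.update σ.reg r len)
  | .fetch =>
    match σ.load with
    | [] => { σ with letter := 0 }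
    | x :: l => { σ with load := l, letter := x.code, eaten := σ.eaten ++ [x] }
  | .turn => σ

end Store

/-- Actions that do not depend on or interact with the environment. -/
def Act.Pure : Act → Prop
  | .nop | .inc _ | .unload _ | .tick | .push => True
  | _ => False

/-- Structured programs; `loop r p` decrements `r` and executes `p` as long as `r` is positive. -/
inductive Prog
  | act (a : Act)
  | seq (p q : Prog)
  | loop (r : ℕ) (p : Prog)

/-- The instructions at control locations. -/
inductive Instr
  | act (a : Act)
  | test (r : ℕ)
  deriving DecidableEq

/-- The effect of an instruction and the outcome of the test. -/
def Instr.exec {s g : ℕ} (len : ℕ) (σ : Store s g) : Instr → Store s g × Bool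
  | .act a => (σ.act len a, true)
  | .test r =>
    if σ.reg r = 0 then (σ, false) else (σ.setReg (Function.update σ.reg r (σ.reg r - 1)), true)

namespace Prog

/-- The control locations of a program. -/
def Loc : Prog → Type
  | act _ => Unit
  | seq p q => Loc p ⊕ Loc q
  | loop _ p => Option (Loc p)

theorem finite_loc : ∀ p : Prog, Finite p.Loc
  | act _ => inferInstanceAs (Finite Unit)
  | seq p q =>
    have := finite_loc p
    have := finite_loc q
    inferInstanceAs (Finite (p.Loc ⊕ q.Loc))
  | loop _ p =>
    have := finite_loc p
    inferInstanceAs (Finite (Option p.Loc))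

/-- The first location. -/
def entry : (p : Prog) → p.Loc
  | act _ => ()
  | seq p _ => Sum.inl (entry p)
  | loop _ _ => none

/-- The instruction at a location. -/
def instr : (p : Prog) → p.Loc → Instr
  | act a, _ => .act a
  | seq p _, .inl l => instr p l
  | seq _ q, .inr l => instr q l
  | loop r _, none => .test r
  | loop _ p, some l => instr p l

/-- The next location, depending on the outcome of the test, or `none` at the end. -/
def next : (p : Prog) → p.Loc → Bool → Option p.Loc
  | act _, _, _ => none
  | seq p q, .inl l, b => some ((next p l b).elim (.inr (entry q)) .inl)
  | seq _ q, .inr l, b => (next q l b).map .inr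
  | loop _ p, none, b => if b then some (some (entry p)) else none
  | loop _ p, some l, b => some (next p l b)

/-- All register numbers of a program are below this bound. -/
def bound : Prog → ℕ
  | act (.inc r) | act (.unload r) | act (.fill r) => r + 1
  | act _ => 0
  | seq p q => max (bound p) (bound q)
  | loop r p => max (r + 1) (bound p)

end Prog

/-- The register used by an instruction is below `n`. -/
def Instr.Below (n : ℕ) : Instr → Prop
  | .act (.inc r) | .act (.unload r) | .act (.fill r) | .test r => r < n
  | _ => True

theorem Instr.Below.mono {m n : ℕ} (h : m ≤ n) {i : Instr} (hi : i.Below m) : i.Below n := by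
  unfold Instr.Below at *
  split at hi <;> first | exact lt_of_lt_of_le hi h | trivial

/-- A memory cell has marks only for the registers below the bound of the program. -/
theorem Prog.instr_below : ∀ (p : Prog) (l : p.Loc), (p.instr l).Below p.bound
  | act a, _ => by cases a <;> simp [instr, bound, Instr.Below]
  | seq p q, .inl l => (instr_below p l).mono (le_max_left _ _)
  | seq p q, .inr l => (instr_below q l).mono (le_max_right _ _)
  | loop r p, none => by
    show r < max (r + 1) p.bound
    omega
  | loop r p, some l => (instr_below p l).mono (le_max_right _ _)

/-- Terminating executions of programs with pure actions. -/
inductive Exec {s g : ℕ} : Prog → Store s g → Store s g → Prop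
  | act {a : Act} {σ : Store s g} (ha : a.Pure) : Exec (.act a) σ (σ.act 0 a)
  | seq {p q : Prog} {σ σ' σ'' : Store s g} :
      Exec p σ σ' → Exec q σ' σ'' → Exec (.seq p q) σ σ''
  | done {r : ℕ} {p : Prog} {σ : Store s g} (h : σ.reg r = 0) : Exec (.loop r p) σ σ
  | next {r : ℕ} {p : Prog} {σ σ' σ'' : Store s g} (h : σ.reg r ≠ 0) :
      Exec p (σ.setReg (Function.update σ.reg r (σ.reg r - 1))) σ' → Exec (.loop r p) σ' σ'' →
      Exec (.loop r p) σ σ''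

/-- A loop invariant indexed by the number `k` of rounds still to be made, which is also the content
of `r`. The test decrements `r` before the loop body runs, whence the update in `hp`. -/
theorem Exec.loop_of {s g : ℕ} {p : Prog} {r : ℕ} (F : ℕ → Store s g) (n : ℕ)
    (hr : ∀ k ≤ n, (F k).reg r = k)
    (hp : ∀ k < n, Exec p ((F (k + 1)).setReg (Function.update (F (k + 1)).reg r k)) (F k)) :
    Exec (.loop r p) (F n) (F 0) := by
  induction n with
  | zero => exact Exec.done (hr 0 le_rfl)
  | succ n ih =>
    refine Exec.next (by rw [hr _ le_rfl]; omega) ?_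
      (ih (fun k hk => hr k (by omega)) fun k hk => hp k (by omega))
    rw [hr _ le_rfl]
    exact hp n (by omega)

theorem Exec.loop_reg {s g : ℕ} (σ : Store s g) {p : Prog} {r : ℕ} (F : ℕ → ℕ → ℕ) (n : ℕ)
    (hr : ∀ k ≤ n, F k r = k)
    (hp : ∀ k < n, Exec p (σ.setReg (Function.update (F (k + 1)) r k)) (σ.setReg (F k))) :
    Exec (.loop r p) (σ.setReg (F n)) (σ.setReg (F 0)) :=
  Exec.loop_of (fun k => σ.setReg (F k)) n hr hp

/-- The registers with `v` added to register `r`. -/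
def addReg (ρ : ℕ → ℕ) (r v : ℕ) : ℕ → ℕ := Function.update ρ r (ρ r + v)

namespace Prog

/-- Set register `r` to zero. -/
def clear (r : ℕ) : Prog := loop r (act .nop)

/-- Move the content of register `a` to register `b`. -/
def move (a b : ℕ) : Prog := loop a (act (.inc b))

/-- Add the content of register `a` to register `b`, with `t` as auxiliary register. -/
def copy (a b t : ℕ) : Prog :=
  seq (loop a (act (.inc t))) (loop t (seq (act (.inc a)) (act (.inc b))))

/-- Execute programs one after the other. -/
def seqFin : (m : ℕ) → (Fin m → Prog) → Prog
  | 0, _ => act .nop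
  | m + 1, P => seq (P 0) (seqFin m fun i => P i.succ)

end Prog

section Exec

variable {s g : ℕ} (σ : Store s g)

theorem Exec.inc (ρ : ℕ → ℕ) (r : ℕ) :
    Exec (.act (.inc r)) (σ.setReg ρ) (σ.setReg (addReg ρ r 1)) :=
  Exec.act (a := .inc r) (σ := σ.setReg ρ) trivial

theorem Exec.clear (ρ : ℕ → ℕ) (r : ℕ) :
    Exec (Prog.clear r) (σ.setReg ρ) (σ.setReg (Function.update ρ r 0)) := by
  have := Exec.loop_reg σ (p := .act .nop) (r := r)
    (fun k => Function.update ρ r k) (ρ r) (by simp) (fun k _ => by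
      have := Exec.act (s := s) (g := g) (a := .nop) (σ := σ.setReg (Function.update ρ r k)) trivial
      simpa [Store.act] using this)
  simpa [Prog.clear] using this

theorem Exec.move (ρ : ℕ → ℕ) {a b : ℕ} (hab : a ≠ b) :
    Exec (Prog.move a b) (σ.setReg ρ)
      (σ.setReg (addReg (Function.update ρ a 0) b (ρ a))) := by
  have := Exec.loop_reg σ (p := .act (.inc b)) (r := a)
    (fun k => addReg (Function.update ρ a k) b (ρ a - k)) (ρ a)
    (fun k _ => by simp [addReg, hab]) (fun k hk => by
      have := Exec.inc σ (addReg (Function.update ρ a k) b (ρ a - (k + 1))) b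
      convert this using 2
      · funext x
        simp only [addReg, Function.update_apply]
        split_ifs <;> omega
      · funext x
        simp only [addReg, Function.update_apply]
        split_ifs <;> omega)
  simpa [addReg, Prog.move] using this

theorem Exec.copy (ρ : ℕ → ℕ) {a b t : ℕ} (hab : a ≠ b) (hat : a ≠ t) (hbt : b ≠ t)
    (ht : ρ t = 0) : Exec (Prog.copy a b t) (σ.setReg ρ) (σ.setReg (addReg ρ b (ρ a))) := by
  refine Exec.seq (Exec.move σ ρ hat) ?_
  have := Exec.loop_reg σ (p := .seq (.act (.inc a)) (.act (.inc b))) (r := t)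
    (fun k => addReg (Function.update (Function.update ρ t k) a (ρ a - k)) b (ρ a - k)) (ρ a)
    (fun k _ => by simp [addReg, hat.symm, hbt.symm]) (fun k hk => by
      have h1 := Exec.inc σ (addReg (Function.update (Function.update ρ t k) a (ρ a - (k + 1))) b
        (ρ a - (k + 1))) a
      have h2 := Exec.inc σ (addReg (addReg (Function.update (Function.update ρ t k) a
        (ρ a - (k + 1))) b (ρ a - (k + 1))) a 1) b
      convert Exec.seq h1 h2 using 2
      · funext x
        simp only [addReg, Function.update_apply]
        split_ifs <;> omega
      · funext x
        simp only [addReg, Function.update_apply]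
        split_ifs <;> omega)
  convert this using 2
  · funext x
    simp only [addReg, Function.update_apply]
    split_ifs <;> simp_all
  · funext x
    simp only [addReg, Function.update_apply]
    split_ifs <;> simp_all

theorem Exec.seqFin {m : ℕ} (P : Fin m → Prog) (F : ℕ → Store s g)
    (h : ∀ i : Fin m, Exec (P i) (F i) (F (i + 1))) : Exec (Prog.seqFin m P) (F 0) (F m) := by
  induction m generalizing F with
  | zero => exact Exec.act (a := .nop) trivial
  | succ m ih =>
    exact Exec.seq (h 0) (ih (fun i => P i.succ) (fun k => F (k + 1)) fun i => h i.succ)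

end Exec

/-- The program `p` adds `f` of the registers `inp` to the register `out`, provided that the
registers from `base` on are zero. -/
def Adds (s g : ℕ) {n : ℕ} (p : Prog) (f : List.Vector ℕ n → ℕ) (inp : Fin n → ℕ)
    (out base : ℕ) : Prop :=
  ∀ (σ : Store s g) (ρ : ℕ → ℕ), (∀ r ≥ base, ρ r = 0) →
    Exec p (σ.setReg ρ) (σ.setReg (addReg ρ out (f (List.Vector.ofFn fun i => ρ (inp i)))))

/-- Primitive recursive functions are computed by programs. -/
theorem exists_adds (s g : ℕ) {n : ℕ} {f : List.Vector ℕ n → ℕ} (hf : Nat.Primrec' f) :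
    ∀ (inp : Fin n → ℕ) (out base : ℕ), (∀ i, inp i < base) → out < base → (∀ i, inp i ≠ out) →
      ∃ p, Adds s g p f inp out base := by
  induction hf with
  | zero =>
    intro inp out base _ _ _
    exact ⟨.act .nop, fun σ ρ _ => by
      have := Exec.act (a := .nop) (σ := σ.setReg ρ) trivial
      simpa [addReg, Store.act] using this⟩
  | succ =>
    intro inp out base hi ho hio
    refine ⟨.seq (.copy (inp 0) out base) (.act (.inc out)), fun σ ρ hρ => ?_⟩
    have h := Exec.seq (Exec.copy σ ρ (hio 0) (hi 0).ne ho.ne (hρ base le_rfl)) (Exec.inc σ _ out)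
    convert h using 2
    simp [addReg, List.Vector.ofFn, add_assoc]
  | get i =>
    intro inp out base hi ho hio
    refine ⟨.copy (inp i) out base, fun σ ρ hρ => ?_⟩
    simpa using Exec.copy σ ρ (hio i) (hi i).ne ho.ne (hρ base le_rfl)
  | @comp n m f g' hf hg ihf ihg =>
    intro inp out base hi ho hio
    -- The inner values occupy the registers from `base` to `base + m - 1`, the subprograms work
    -- from `base + m` on, and the inner values are cleared at the end, so that the scratch area is
    -- zero again.
    choose pg hpg using fun i : Fin m => ihg i inp (base + i) (base + m)
      (fun j => by have := hi j; omega) (by omega) (fun j => by have := hi j; omega)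
    obtain ⟨pf, hpf⟩ := ihf (fun i => base + i) out (base + m) (fun i => by omega) (by omega)
      (fun i => by omega)
    refine ⟨.seq (.seqFin m pg) (.seq pf (.seqFin m fun i => .clear (base + i))), fun σ ρ hρ => ?_⟩
    let v : ℕ → ℕ := fun j => if h : j < m then g' ⟨j, h⟩ (List.Vector.ofFn fun i => ρ (inp i)) else 0
    have hv : ∀ i : Fin m, v i = g' i (List.Vector.ofFn fun i => ρ (inp i)) := fun i => by simp [v]
    let R : ℕ → ℕ → ℕ := fun k r => if base ≤ r ∧ r < base + k then v (r - base) else ρ r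
    have hR0 : R 0 = ρ := by
      funext r
      simp only [R]
      rw [if_neg (by omega)]
    have h1 : Exec (.seqFin m pg) (σ.setReg (R 0)) (σ.setReg (R m)) := by
      refine Exec.seqFin pg (fun k => σ.setReg (R k)) fun i => ?_
      convert hpg i σ (R i) (fun r hr => ?_) using 2
      · funext r
        simp only [addReg, Function.update_apply]
        have hin : ∀ j, R i (inp j) = ρ (inp j) := fun j => by
          have := hi j
          simp only [R]
          rw [if_neg (by omega)]
        simp only [hin]
        rw [← hv i]
        simp only [R]
        by_cases hr : r = base + i
        · subst hr
          rw [if_pos (by omega), if_pos rfl, if_neg (by omega), hρ _ (by omega)]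
          simp
        · rw [if_neg hr]
          by_cases hr' : base ≤ r ∧ r < base + i
          · rw [if_pos (by omega), if_pos hr']
          · rw [if_neg (by omega), if_neg hr']
      · simp only [R]
        rw [if_neg (by omega), hρ r (by omega)]
    have h2 := hpf σ (R m) (fun r hr => by
      simp only [R]
      rw [if_neg (by omega), hρ r (by omega)])
    have hin : (List.Vector.ofFn fun i : Fin m => R m (base + i)) =
        List.Vector.ofFn fun i => g' i (List.Vector.ofFn fun i => ρ (inp i)) := by
      congr 1
      funext i
      rw [← hv]
      simp only [R]
      rw [if_pos (by omega)]
      simp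
    rw [hin] at h2
    set val := f (List.Vector.ofFn fun i => g' i (List.Vector.ofFn fun i => ρ (inp i))) with hval
    let C : ℕ → ℕ → ℕ := fun k r =>
      if base ≤ r ∧ r < base + k then 0 else addReg (R m) out val r
    have h3 : Exec (.seqFin m fun i => .clear (base + i)) (σ.setReg (C 0)) (σ.setReg (C m)) := by
      refine Exec.seqFin (fun i : Fin m => .clear (base + i)) (fun k => σ.setReg (C k)) fun i => ?_
      convert Exec.clear σ (C i) (base + i) using 2
      funext r
      simp only [C, Function.update_apply]
      split_ifs <;> omega
    have hC0 : C 0 = addReg (R m) out val := by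
      funext r
      simp only [C]
      rw [if_neg (by omega)]
    have hCm : C m = addReg ρ out val := by
      funext r
      simp only [C, addReg, Function.update_apply, R]
      by_cases h : base ≤ r ∧ r < base + m
      · rw [if_pos h, if_neg (by omega), hρ r h.1]
      · rw [if_neg (show ¬ (base ≤ out ∧ out < base + m) by omega)]
        simp only [if_neg h]
    rw [hR0] at h1
    rw [hC0, hCm] at h3
    exact h1.seq (h2.seq h3)
  | @prec n f g' hf hg ihf ihg =>
    intro inp out base hi ho hio
    -- Register `base` counts the remaining rounds, `base + 1` holds the recursion variable, `base +
    -- 2` the current value and `base + 3` the next one.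
    obtain ⟨pf, hpf⟩ := ihf (fun i => inp i.succ) (base + 2) (base + 4)
      (fun i => by have := hi i.succ; omega) (by omega) (fun i => by have := hi i.succ; omega)
    obtain ⟨pg, hpg⟩ := ihg (Fin.cons (base + 1) (Fin.cons (base + 2) fun i => inp i.succ))
      (base + 3) (base + 4)
      (fun i => by
        refine Fin.cases ?_ (fun i => ?_) i
        · simp
        · refine Fin.cases ?_ (fun i => ?_) i
          · simp
          · have := hi i.succ
            simp; omega) (by omega)
      (fun i => by
        refine Fin.cases ?_ (fun i => ?_) i
        · simp
        · refine Fin.cases ?_ (fun i => ?_) i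
          · simp
          · have := hi i.succ
            simp; omega)
    refine ⟨.seq (.copy (inp 0) base (base + 3)) (.seq pf (.seq (.loop base
      (.seq pg (.seq (.clear (base + 2)) (.seq (.move (base + 3) (base + 2))
        (.act (.inc (base + 1))))))) (.seq (.move (base + 2) out) (.clear (base + 1))))),
      fun σ ρ hρ => ?_⟩
    have hi0 := hi 0
    have hio0 := hio 0
    have his : ∀ i : Fin n, inp i.succ < base := fun i => hi i.succ
    set N := ρ (inp 0) with hN
    set w : List.Vector ℕ n := List.Vector.ofFn fun i => ρ (inp i.succ) with hw
    let val : ℕ → ℕ := fun k => Nat.rec (f w) (fun y IH => g' (y ::ᵥ IH ::ᵥ w)) k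
    let R : ℕ → ℕ → ℕ → ℕ → ℕ := fun c y a r =>
      if r = base then c else if r = base + 1 then y else if r = base + 2 then a else ρ r
    have hz : ∀ c y a r, r ≥ base + 3 → R c y a r = 0 := fun c y a r hr => by
      simp only [R]
      rw [if_neg (by omega), if_neg (by omega), if_neg (by omega), hρ r (by omega)]
    have hin : ∀ c y a i, R c y a (inp (Fin.succ i)) = ρ (inp i.succ) := fun c y a i => by
      have := his i
      simp only [R]
      rw [if_neg (by omega), if_neg (by omega), if_neg (by omega)]
    have h1 : Exec (.copy (inp 0) base (base + 3)) (σ.setReg ρ) (σ.setReg (R N 0 0)) := by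
      convert Exec.copy σ ρ (a := inp 0) (b := base) (t := base + 3) (by omega) (by omega)
        (by omega) (hρ _ (by omega)) using 2
      funext r
      simp only [R, addReg, Function.update_apply]
      split_ifs with e1 e2 e3
      · rw [hρ base le_rfl, zero_add]
      · rw [e2, hρ _ (by omega)]
      · rw [e3, hρ _ (by omega)]
      · rfl
    have h2 : Exec pf (σ.setReg (R N 0 0)) (σ.setReg (R N 0 (val 0))) := by
      convert hpf σ (R N 0 0) (fun r hr => hz _ _ _ r (by omega)) using 2
      simp only [hin]
      funext r
      simp only [R, addReg, Function.update_apply]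
      split_ifs <;> first | omega | simp [val, hw]
    have h3 : Exec (.loop base (.seq pg (.seq (.clear (base + 2)) (.seq (.move (base + 3) (base + 2))
        (.act (.inc (base + 1))))))) (σ.setReg (R N 0 (val 0))) (σ.setReg (R 0 N (val N))) := by
      have := Exec.loop_reg σ (p := .seq pg (.seq (.clear (base + 2)) (.seq (.move (base + 3) (base + 2))
        (.act (.inc (base + 1)))))) (r := base)
        (fun k => R k (N - k) (val (N - k))) N (fun k _ => by simp [R]) (fun k hk => by
          obtain ⟨y, hy⟩ : ∃ y, N - (k + 1) = y := ⟨_, rfl⟩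
          have hy' : N - k = y + 1 := by omega
          rw [hy, hy']
          have e0 : Function.update (R (k + 1) y (val y)) base k = R k y (val y) := by
            funext r
            simp only [R, Function.update_apply]
            split_ifs <;> rfl
          rw [e0]
          have a1 := hpg σ (R k y (val y)) (fun r hr => hz _ _ _ r (by omega))
          have ev : (List.Vector.ofFn fun i => R k y (val y)
              ((Fin.cons (base + 1) (Fin.cons (base + 2) fun i => inp i.succ) : Fin (n + 2) → ℕ) i)) =
              y ::ᵥ val y ::ᵥ w := by
            simp only [List.Vector.ofFn, Fin.cons_zero, Fin.cons_succ, hin]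
            simp [R, hw]
          rw [ev] at a1
          have a2 := Exec.clear σ (addReg (R k y (val y)) (base + 3) (val (y + 1))) (base + 2)
          have a3 := Exec.move σ (Function.update (addReg (R k y (val y)) (base + 3) (val (y + 1)))
            (base + 2) 0) (a := base + 3) (b := base + 2) (by omega)
          have a4 := Exec.inc σ (addReg (Function.update (Function.update
            (addReg (R k y (val y)) (base + 3) (val (y + 1))) (base + 2) 0) (base + 3) 0) (base + 2)
            ((Function.update (addReg (R k y (val y)) (base + 3) (val (y + 1))) (base + 2) 0)
              (base + 3))) (base + 1)
          convert a1.seq (a2.seq (a3.seq a4)) using 2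
          have h3z := hz k y (val y) (base + 3) (by omega)
          have r3 := hρ (base + 3) (by omega)
          funext r
          simp only [addReg, Function.update_apply, h3z]
          simp only [R]
          split_ifs <;> first | omega | simp_all)
      simpa using this
    have h4 : Exec (.move (base + 2) out) (σ.setReg (R 0 N (val N)))
        (σ.setReg (addReg (R 0 N 0) out (val N))) := by
      convert Exec.move σ (R 0 N (val N)) (a := base + 2) (b := out) (by omega) using 2
      funext r
      simp only [R, addReg, Function.update_apply]
      split_ifs <;> omega
    have h5 : Exec (.clear (base + 1)) (σ.setReg (addReg (R 0 N 0) out (val N)))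
        (σ.setReg (addReg ρ out (val N))) := by
      convert Exec.clear σ (addReg (R 0 N 0) out (val N)) (base + 1) using 2
      have r0 := hρ base (by omega)
      have r1 := hρ (base + 1) (by omega)
      have r2 := hρ (base + 2) (by omega)
      funext r
      simp only [R, addReg, Function.update_apply]
      split_ifs <;> first | omega | simp_all
    have hval : val N = Nat.rec (f (List.Vector.ofFn fun i => ρ (inp i)).tail)
        (fun y IH => g' (y ::ᵥ IH ::ᵥ (List.Vector.ofFn fun i => ρ (inp i)).tail))
        (List.Vector.ofFn fun i => ρ (inp i)).head := by
      simp [val, hw, hN, List.Vector.ofFn]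
    beta_reduce
    rw [← hval]
    exact h1.seq (h2.seq (h3.seq (h4.seq h5)))

end LinLearn


/-! ### The data stream and the effective learner -/

namespace LinLearn

section Parse

variable {s : ℕ}

/-- Parsing of the stream: the completed words and the beginning of the next one. -/
def parseStep (p : List (List (Fin s)) × List (Fin s)) : Sym s → List (List (Fin s)) × List (Fin s)
  | none => (p.1 ++ [p.2], [])
  | some a => (p.1, p.2 ++ [a])

/-- The completed words and the beginning of the next one in a part of the stream. -/
def parse (l : List (Sym s)) : List (List (Fin s)) × List (Fin s) := l.foldl parseStep ([], [])

/-- The stream of the first `k` data. -/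
def stream (w : ℕ → List (Fin s)) (k : ℕ) : List (Sym s) :=
  (List.range k).flatMap fun i => (w i).map some ++ [none]

theorem stream_succ (w : ℕ → List (Fin s)) (k : ℕ) :
    stream w (k + 1) = stream w k ++ ((w k).map some ++ [none]) := by
  simp [stream, List.range_succ]

theorem le_length_stream (w : ℕ → List (Fin s)) (k : ℕ) : k ≤ (stream w k).length := by
  induction k with
  | zero => simp
  | succ k ih => rw [stream_succ]; simp; omega

theorem stream_prefix (w : ℕ → List (Fin s)) {j k : ℕ} (h : j ≤ k) : stream w j <+: stream w k := by
  induction k, h using Nat.le_induction with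
  | base => exact List.prefix_rfl
  | succ k _ ih =>
    rw [stream_succ]
    exact ih.trans (List.prefix_append _ _)

theorem foldl_parseStep_prefix (l : List (Sym s)) (p : List (List (Fin s)) × List (Fin s)) :
    p.1 <+: (l.foldl parseStep p).1 := by
  induction l generalizing p with
  | nil => exact List.prefix_rfl
  | cons a l ih =>
    refine List.IsPrefix.trans ?_ (ih (parseStep p a))
    cases a
    · exact List.prefix_append _ _
    · exact List.prefix_rfl

theorem parse_prefix {l l' : List (Sym s)} (h : l <+: l') : (parse l).1 <+: (parse l').1 := by
  obtain ⟨r, rfl⟩ := h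
  rw [parse, parse, List.foldl_append]
  exact foldl_parseStep_prefix r _

theorem foldl_parseStep_map (x : List (Fin s)) (p : List (List (Fin s)) × List (Fin s)) :
    (x.map some).foldl parseStep p = (p.1, p.2 ++ x) := by
  induction x generalizing p with
  | nil => simp
  | cons a x ih => simp [parseStep, ih]

theorem parse_stream (w : ℕ → List (Fin s)) (k : ℕ) :
    parse (stream w k) = ((List.range k).map w, []) := by
  induction k with
  | zero => rfl
  | succ k ih =>
    rw [parse] at ih ⊢
    rw [stream_succ, List.foldl_append, ih, List.foldl_append, foldl_parseStep_map]
    simp [parseStep, List.range_succ]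

end Parse

section Words

/-- All words of length at most `b`. -/
def wordsUpTo (s : ℕ) (b : ℕ) : List (List (Fin s)) :=
  Nat.rec [[]] (fun _ l => [] :: l.flatMap fun x => (List.finRange s).map (· :: x)) b

theorem mem_wordsUpTo {s b : ℕ} {x : List (Fin s)} : x ∈ wordsUpTo s b ↔ x.length ≤ b := by
  induction b generalizing x with
  | zero => simp [wordsUpTo]
  | succ b ih =>
    have : wordsUpTo s (b + 1) =
        [] :: (wordsUpTo s b).flatMap fun x => (List.finRange s).map (· :: x) := rfl
    rw [this]
    cases x with
    | nil => simp
    | cons a x => simp [ih]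

theorem primrec_wordsUpTo (s : ℕ) : Primrec (wordsUpTo s) := by
  refine Primrec.nat_rec₁ _ ?_
  refine Primrec.list_cons.comp (Primrec.const []) ?_
  refine Primrec.list_flatMap Primrec.snd ?_
  refine Primrec.list_map (Primrec.const _) ?_
  exact Primrec.list_cons.comp Primrec.snd (Primrec.snd.comp Primrec.fst)

theorem primrec_conv {α β : Type} [Primcodable α] [Primcodable β] :
    Primrec₂ (conv : List α → List β → List (Option α × Option β)) := by
  refine Primrec.list_map (Primrec.list_range.comp (Primrec.nat_max.comp
    (Primrec.list_length.comp Primrec.fst) (Primrec.list_length.comp Primrec.snd))) ?_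
  exact Primrec.pair
    (Primrec.list_getElem?.comp (Primrec.fst.comp Primrec.fst) Primrec.snd)
    (Primrec.list_getElem?.comp (Primrec.snd.comp Primrec.fst) Primrec.snd)

theorem primrec_eval {α : Type} [Primcodable α] [Finite α] {n : ℕ} (A : DFA α (Fin n)) :
    Primrec A.eval := by
  refine (Primrec.list_foldl (h := fun _ (p : Fin n × α) => A.step p.1 p.2) Primrec.id
    (Primrec.const A.start) ?_).of_eq fun l => rfl
  exact (Primrec.dom_finite fun p : Fin n × α => A.step p.1 p.2).comp Primrec.snd

end Words

open Classical in
theorem primrecPred_mem {n : ℕ} (P : Set (Fin n)) : PrimrecPred fun q => q ∈ P :=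
  Primrec.primrecPred (Primrec.dom_finite _)

/-- The data of an effective learner: automata for the family and its index set, the constant in the
tell-tale bound, and a default conjecture. -/
structure Guesser (s g : ℕ) where
  nA : ℕ
  nB : ℕ
  A : DFA (Option (Fin g) × Option (Fin s)) (Fin nA)
  B : DFA (Fin g) (Fin nB)
  c : ℕ
  default : List (Fin g)

namespace Guesser

variable {s g : ℕ} (P : Guesser s g)

/-- The word `x` belongs to the language with index `e`. -/
def Mem (x : List (Fin s)) (e : List (Fin g)) : Prop := P.A.eval (conv e x) ∈ P.A.accept

/-- The word `e` is an index. -/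
def Index (e : List (Fin g)) : Prop := P.B.eval e ∈ P.B.accept

/-- The index `e` is consistent with the data `d`, which include its tell-tale. -/
def Good (e : List (Fin g)) (d : List (List (Fin s))) : Prop :=
  P.Index e ∧ (∀ x ∈ d, P.Mem x e) ∧
    ∀ x ∈ wordsUpTo s (e.length + P.c), P.Mem x e → x ∈ d

theorem primrec_mem : PrimrecRel P.Mem :=
  (primrecPred_mem P.A.accept).comp
    ((primrec_eval P.A).comp (primrec_conv.comp Primrec.snd Primrec.fst))

theorem primrec_index : PrimrecPred P.Index :=
  (primrecPred_mem P.B.accept).comp (primrec_eval P.B)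

/-- The quantifiers range over explicit finite lists, because the tell-tale is bounded in terms of
the length of the guess; without a computable bound the relation need not be decidable. -/
theorem primrec_good : PrimrecRel P.Good := by
  refine PrimrecPred.and (P.primrec_index.comp Primrec.fst) (PrimrecPred.and ?_ ?_)
  · exact (PrimrecRel.forall_mem_list P.primrec_mem).comp Primrec.snd Primrec.fst
  · have h1 : PrimrecRel fun (x : List (Fin s)) (p : List (Fin g) × List (List (Fin s))) =>
        P.Mem x p.1 → x ∈ p.2 := by
      refine (PrimrecPred.or (PrimrecPred.not (P.primrec_mem.comp Primrec.fst
        (Primrec.fst.comp Primrec.snd))) ((PrimrecRel.exists_mem_list (Primrec.eq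
          (α := List (Fin s)))).comp (Primrec.snd.comp Primrec.snd) Primrec.fst)).of_eq ?_
      rintro ⟨x, e, d⟩
      simp [imp_iff_not_or]
    exact (PrimrecRel.forall_mem_list h1).comp
      ((primrec_wordsUpTo s).comp (Primrec.nat_add.comp (Primrec.list_length.comp Primrec.fst)
        (Primrec.const P.c))) Primrec.id

/-- The states of the learner: the number of the current guess and the parsed data. -/
abbrev LState (s : ℕ) := ℕ × List (List (Fin s)) × List (Fin s)

/-- The guess with number `t`; every word is guessed infinitely often. -/
def guess (g : ℕ) (t : ℕ) : List (Fin g) := (Encodable.decode t.unpair.1).getD []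

theorem primrec_guess : Primrec (guess g) :=
  Primrec.option_getD.comp (Primrec.decode.comp (Primrec.fst.comp Primrec.unpair))
    (Primrec.const [])

open Classical in
/-- The update of the state when a symbol may have been received. -/
noncomputable def step (x : LState s) (a : Option (Sym s)) : LState s :=
  let p := a.elim x.2 (parseStep x.2)
  (if P.Good (guess g x.1) p.1 then x.1 else x.1 + 1, p)

open Classical in
/-- The conjecture in a state. -/
noncomputable def conj (x : LState s) : List (Fin g) :=
  if P.Good (guess g x.1) x.2.1 then guess g x.1 else P.default

theorem primrec_step : Primrec₂ P.step := by
  classical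
  have hp : Primrec fun q : LState s × Option (Sym s) => q.2.elim q.1.2 (parseStep q.1.2) := by
    refine (Primrec.option_casesOn (o := fun q : LState s × Option (Sym s) => q.2)
      (f := fun q => q.1.2) (g := fun q a => parseStep q.1.2 a) Primrec.snd
      (Primrec.snd.comp Primrec.fst) ?_).of_eq fun q => by cases q.2 <;> rfl
    have hd : Primrec fun r : (LState s × Option (Sym s)) × Sym s => r.1.1.2 :=
      Primrec.snd.comp (Primrec.fst.comp Primrec.fst)
    refine (Primrec.option_casesOn (o := fun r : (LState s × Option (Sym s)) × Sym s => r.2)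
      (f := fun r => (r.1.1.2.1 ++ [r.1.1.2.2], []))
      (g := fun r a => (r.1.1.2.1, r.1.1.2.2 ++ [a])) Primrec.snd ?_ ?_).of_eq
      fun r => by cases r.2 <;> simp [parseStep]
    · exact Primrec.pair (Primrec.list_concat.comp (Primrec.fst.comp hd) (Primrec.snd.comp hd))
        (Primrec.const [])
    · exact Primrec.pair (Primrec.fst.comp (hd.comp Primrec.fst))
        (Primrec.list_concat.comp (Primrec.snd.comp (hd.comp Primrec.fst)) Primrec.snd)
  have ht : Primrec fun q : LState s × Option (Sym s) => q.1.1 := Primrec.fst.comp Primrec.fst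
  exact Primrec.pair (Primrec.ite (P.primrec_good.comp (primrec_guess.comp ht)
    (Primrec.fst.comp hp)) ht (Primrec.succ.comp ht)) hp

theorem primrec_conj : Primrec P.conj := by
  classical
  have hg : Primrec fun x : LState s => guess g x.1 := primrec_guess.comp Primrec.fst
  exact Primrec.ite (P.primrec_good.comp hg (Primrec.fst.comp Primrec.snd)) hg (Primrec.const _)

theorem index_conj (h : P.Index P.default) (x : LState s) : P.Index (P.conj x) := by
  unfold conj
  split_ifs with hx
  · exact hx.1
  · exact h

/-- Convergence of the learner. -/
theorem converges (x : ℕ → LState s) (a : ℕ → Option (Sym s))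
    (hx : ∀ i, x (i + 1) = P.step (x i) (a i)) {e : List (Fin g)} (he : P.Index e)
    (htell : ∀ e, P.Index e → ∀ d, P.Index d →
      (∀ y, P.Mem y e → y.length ≤ e.length + P.c → P.Mem y d) → (∀ y, P.Mem y d → P.Mem y e) →
        ∀ y, P.Mem y d ↔ P.Mem y e)
    (hsub : ∀ i, ∀ y ∈ (x i).2.1, P.Mem y e) (hall : ∀ y, P.Mem y e → ∃ i, y ∈ (x i).2.1) :
    ∃ i d, P.Index d ∧ (∀ y, P.Mem y d ↔ P.Mem y e) ∧ ∀ j ≥ i, P.conj (x j) = d := by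
  classical
  have hpre : ∀ i, (x i).2.1 <+: (x (i + 1)).2.1 := by
    intro i
    rw [hx]
    cases h : a i with
    | none => exact List.prefix_rfl
    | some b => exact foldl_parseStep_prefix [b] (x i).2
  have hmono : ∀ i j, i ≤ j → ∀ y ∈ (x i).2.1, y ∈ (x j).2.1 := by
    intro i j hij
    induction j, hij using Nat.le_induction with
    | base => exact fun y hy => hy
    | succ j _ ih => exact fun y hy => (hpre j).subset (ih y hy)
  have hfin : ∀ l : List (List (Fin s)), (∀ y ∈ l, P.Mem y e) → ∃ i, ∀ y ∈ l, y ∈ (x i).2.1 := by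
    intro l hl
    induction l with
    | nil => exact ⟨0, by simp⟩
    | cons y l ih =>
      obtain ⟨i, hi⟩ := ih fun z hz => hl z (List.mem_cons_of_mem _ hz)
      obtain ⟨j, hj⟩ := hall y (hl y (by simp))
      refine ⟨max i j, fun z hz => ?_⟩
      rcases List.mem_cons.1 hz with rfl | hz
      · exact hmono _ _ (le_max_right _ _) _ hj
      · exact hmono _ _ (le_max_left _ _) _ (hi z hz)
  have hstep : ∀ i, (x (i + 1)).1 =
      if P.Good (guess g (x i).1) (x (i + 1)).2.1 then (x i).1 else (x i).1 + 1 := by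
    intro i
    rw [hx]
    rfl
  have htmono : ∀ i, (x i).1 ≤ (x (i + 1)).1 := fun i => by
    rw [hstep]; split_ifs <;> omega
  -- the number of the guess is eventually constant
  obtain ⟨i0, hi0⟩ : ∃ i0, ∀ i ≥ i0, (x (i + 1)).1 = (x i).1 := by
    by_contra hcon
    push Not at hcon
    -- The alternative `m < 0` is void. The number grows by at most one at a time and never stops
    -- for good, so it takes every value from the initial one on.
    have hreach : ∀ t ≥ (x 0).1, ∀ m, ∃ i ≥ 0, (x i).1 = t ∨ m < 0 := by
      intro t ht m
      suffices h : ∃ i, (x i).1 = t by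
        obtain ⟨i, hi⟩ := h
        exact ⟨i, Nat.zero_le _, Or.inl hi⟩
      induction t, ht using Nat.le_induction with
      | base => exact ⟨0, rfl⟩
      | succ t _ ih =>
        obtain ⟨i, hi⟩ := ih
        by_contra hno
        push Not at hno
        have hconst : ∀ j ≥ i, (x j).1 = t := by
          intro j hj
          induction j, hj using Nat.le_induction with
          | base => exact hi
          | succ j _ ihj =>
            have := hstep j
            have h2 := hno (j + 1)
            rw [ihj] at this
            split_ifs at this with hg
            · exact this
            · exact absurd this h2
        obtain ⟨j, hj, hne⟩ := hcon i
        exact hne (by rw [hconst _ hj, hconst _ (by omega)])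
    obtain ⟨i1, hi1⟩ := hfin ((wordsUpTo s (e.length + P.c)).filter fun y => P.Mem y e)
      (fun y hy => by simpa using (List.mem_filter.1 hy).2)
    have hgood : ∀ i ≥ i1, P.Good e (x i).2.1 := fun i hi => ⟨he, hsub i, fun y hy hye =>
      hmono _ _ hi y (hi1 y (List.mem_filter.2 ⟨hy, by simpa using hye⟩))⟩
    -- A number of the guess `e` that exceeds all numbers in use up to step `i1`; when it is
    -- reached, the tell-tale of `e` has been seen, and the guess is never abandoned.
    let t := Nat.pair (Encodable.encode e) (max (x 0).1 ((x i1).1 + 1))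
    have ht : max (x 0).1 ((x i1).1 + 1) ≤ t := Nat.right_le_pair _ _
    have hge : guess g t = e := by simp [guess, t]
    obtain ⟨i, -, hi | hi⟩ := hreach t (le_trans (le_max_left _ _) ht) 0
    · have hii : i1 ≤ i := by
        by_contra hlt
        have : (x i).1 ≤ (x i1).1 :=
          monotone_nat_of_le_succ (f := fun i => (x i).1) htmono (by omega)
        have := le_trans (le_max_right (x 0).1 ((x i1).1 + 1)) ht
        omega
      have hconst : ∀ j ≥ i, (x j).1 = t := by
        intro j hj
        induction j, hj using Nat.le_induction with
        | base => exact hi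
        | succ j hj ihj => rw [hstep, ihj, if_pos (by rw [hge]; exact hgood _ (by omega))]
      obtain ⟨j, hj, hne⟩ := hcon i
      exact hne (by rw [hconst _ hj, hconst _ (by omega)])
    · omega
  have hconst : ∀ j ≥ i0, (x j).1 = (x i0).1 := by
    intro j hj
    induction j, hj using Nat.le_induction with
    | base => rfl
    | succ j hj ihj => rw [hi0 j hj, ihj]
  have hgood : ∀ j ≥ i0, P.Good (guess g (x i0).1) (x (j + 1)).2.1 := by
    intro j hj
    have := hstep j
    rw [hi0 j hj, hconst j hj] at this
    split_ifs at this with h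
    · exact h
    · omega
  -- The limit guess contains all data, hence the language of `e`, while its tell-tale consists of
  -- data, hence lies in the language of `e`. The tell-tale property of the limit guess excludes a
  -- proper inclusion.
  refine ⟨i0 + 1, guess g (x i0).1, (hgood i0 le_rfl).1, ?_, ?_⟩
  · have h1 : ∀ y, P.Mem y e → P.Mem y (guess g (x i0).1) := by
      intro y hy
      obtain ⟨i, hi⟩ := hall y hy
      exact (hgood (max i i0) (le_max_right _ _)).2.1 y
        (hmono _ _ ((le_max_left _ _).trans (Nat.le_succ _)) y hi)
    intro y
    refine (htell _ (hgood i0 le_rfl).1 e he ?_ h1 y).symm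
    intro z hz hzl
    exact hsub _ z ((hgood i0 le_rfl).2.2 z (mem_wordsUpTo.2 hzl) hz)
  · intro j hj
    obtain ⟨j, rfl⟩ : ∃ j', j = j' + 1 := ⟨j - 1, by omega⟩
    rw [conj, hconst _ (by omega), if_pos (hgood j (by omega))]

/-- The learner with states and inputs coded by numbers. -/
noncomputable def upd (n a : ℕ) : ℕ :=
  Encodable.encode (P.step ((Encodable.decode n).getD (0, [], []))
    -- The inverse of `Sym.code`; the code `0` means that the queue had no symbol to offer.
    (if a = 0 then none else if a = 1 then some none
      else (Encodable.decode (α := Fin s) (a - 2)).map some))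

/-- The conjecture in a coded state. -/
noncomputable def out (n : ℕ) : List (Fin g) :=
  P.conj ((Encodable.decode n).getD (0, [], []))

theorem primrec_upd : Primrec₂ P.upd := by
  have h1 : Primrec fun p : ℕ × ℕ => ((Encodable.decode p.1).getD (0, [], []) : LState s) :=
    Primrec.option_getD.comp (Primrec.decode.comp Primrec.fst) (Primrec.const _)
  refine Primrec.encode.comp (P.primrec_step.comp h1 ?_)
  refine Primrec.ite (Primrec.eq.comp Primrec.snd (Primrec.const 0)) (Primrec.const _) ?_
  refine Primrec.ite (Primrec.eq.comp Primrec.snd (Primrec.const 1)) (Primrec.const _) ?_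
  exact Primrec.option_map (Primrec.decode.comp (Primrec.nat_sub.comp Primrec.snd
    (Primrec.const 2))) (Primrec.option_some.comp Primrec.snd)

theorem primrec_out : Primrec P.out :=
  P.primrec_conj.comp (Primrec.option_getD.comp Primrec.decode (Primrec.const _))

theorem upd_encode (x : LState s) (a : Sym s) :
    P.upd (Encodable.encode x) a.code = Encodable.encode (P.step x (some a)) := by
  cases a with
  | none => simp [upd, Sym.code]
  | some b =>
    have : Encodable.decode (α := Fin s) b = some b := Encodable.encodek b
    simp [upd, Sym.code, this]

theorem upd_encode_zero (x : LState s) :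
    P.upd (Encodable.encode x) 0 = Encodable.encode (P.step x none) := by
  simp [upd]

theorem out_encode (x : LState s) : P.out (Encodable.encode x) = P.conj x := by
  simp [out]

/-- The registers are zero at the start, so no initialisation is needed. -/
theorem encode_init : Encodable.encode ((0, [], []) : LState s) = 0 := by
  simp [Nat.pair]

end Guesser

end LinLearn


/-! ### Turing machines that work in four sweeps -/

namespace LinLearn

universe u v

/-- A learner that works in four sweeps over the base tape: to the right, during which the input is
converted and which may append a symbol; back; to the right again; and back, during which the output
is produced. -/
structure Sweeper (S : Type u) (G : Type v) where
  Q : Type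
  Mem : Type
  Aux : Type
  Work : Type
  finite_q : Finite Q
  finite_mem : Finite Mem
  finite_aux : Finite Aux
  finite_work : Finite Work
  init : Q
  fstCell : Q → Option S × Option Mem → Option (Option Work) → Q × Aux × Option Work × Move
  fstEnd : Q → Option (Option Work) → Q × Option Aux × Option Work × Move
  sndStart : Q → Option (Option Work) → Q × Option Work × Move
  sndCell : Q → Aux → Option (Option Work) → Q × Aux × Option Work × Move
  sndEnd : Q → Option (Option Work) → Q × Option Work × Move
  back : Q → Aux → Q × Mem
  letter : Mem → Option G
  initMem : List Mem

namespace Sweeper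

/-- The phases of a cycle. -/
inductive Phase
  | start | fst | ret | snd | last | done
  deriving DecidableEq

instance : Finite Phase :=
  Finite.of_surjective ![Phase.start, .fst, .ret, .snd, .last, .done] fun p => by
    cases p
    exacts [⟨0, rfl⟩, ⟨1, rfl⟩, ⟨2, rfl⟩, ⟨3, rfl⟩, ⟨4, rfl⟩, ⟨5, rfl⟩]

variable {S : Type u} {G : Type v} (P : Sweeper S G)

/-- Writing and moving on the work tape. -/
def act {A : Type u} (T : Tape A) (a : A × Move) : Tape A := (T.write a.1).move a.2

/-- The transition function of the Turing machine of a sweeper. -/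
def trans : Phase × P.Q → Option (BaseSym S G P.Mem P.Aux) → Option (Option P.Work) →
    (Phase × P.Q) × (BaseSym S G P.Mem P.Aux × Move) × (Option P.Work × Move)
  | (.start, _), _, w => ((.fst, P.init), (.blank, .right), (w.getD none, .stay))
  | (.fst, q), some (.inp x), w =>
    let r := P.fstCell q x w
    ((.fst, r.1), (.aux r.2.1, .right), r.2.2)
  | (.fst, q), _, w =>
    let r := P.fstEnd q w
    ((.ret, r.1), (r.2.1.elim .blank .aux, .left), r.2.2)
  | (.ret, q), some b, w => ((.ret, q), (b, .left), (w.getD none, .stay))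
  | (.ret, q), none, w =>
    let r := P.sndStart q w
    ((.snd, r.1), (.blank, .right), r.2)
  | (.snd, q), some (.aux x), w =>
    let r := P.sndCell q x w
    ((.snd, r.1), (.aux r.2.1, .right), r.2.2)
  | (.snd, q), _, w =>
    let r := P.sndEnd q w
    ((.last, r.1), (.blank, .left), r.2)
  | (.last, q), some (.aux x), w =>
    let r := P.back q x
    ((.last, r.1), (.out (some r.2, P.letter r.2), .left), (w.getD none, .stay))
  | (.last, q), _, w => ((.done, q), (.blank, .stay), (w.getD none, .stay))
  | (.done, q), _, w => ((.done, q), (.blank, .stay), (w.getD none, .stay))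

/-- The Turing machine learner of a sweeper. -/
abbrev toLearner : Learner S G where
  State := Phase × P.Q
  Mem := P.Mem
  Aux := P.Aux
  Work := P.Work
  finite_state := have := P.finite_q; inferInstance
  finite_mem := P.finite_mem
  finite_aux := P.finite_aux
  finite_work := P.finite_work
  start := (.start, P.init)
  accept := fun s => s.1 == .done
  trans := P.trans
  initMem := P.initMem

/-- The effect of the first sweep to the right on a list of input symbols. -/
def runFst : P.Q → Tape (Option P.Work) → List (Option S × Option P.Mem) →
    P.Q × Tape (Option P.Work) × List P.Aux
  | q, T, [] => (q, T, [])
  | q, T, x :: l =>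
    let r := P.fstCell q x T.read
    let s := runFst r.1 (act T r.2.2) l
    (s.1, s.2.1, r.2.1 :: s.2.2)

/-- The effect of the second sweep to the right. -/
def runSnd : P.Q → Tape (Option P.Work) → List P.Aux →
    P.Q × Tape (Option P.Work) × List P.Aux
  | q, T, [] => (q, T, [])
  | q, T, x :: l =>
    let r := P.sndCell q x T.read
    let s := runSnd r.1 (act T r.2.2) l
    (s.1, s.2.1, r.2.1 :: s.2.2)

/-- The effect of the last sweep, to the left. -/
def runBack (q : P.Q) : List P.Aux → P.Q × List P.Mem
  | [] => (q, [])
  | x :: l =>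
    let s := runBack q l
    let r := P.back s.1 x
    (r.1, r.2 :: s.2)

/-- State, work tape and base tape after the first sweep, including the appended symbol. -/
def afterFst (x : List S) (m : List P.Mem) (T : Tape (Option P.Work)) :
    P.Q × Tape (Option P.Work) × List P.Aux :=
  let r := P.runFst P.init T (conv x m)
  let e := P.fstEnd r.1 r.2.1.read
  (e.1, act r.2.1 e.2.2, r.2.2 ++ e.2.1.toList)

/-- State, work tape and base tape after the second sweep to the right. -/
def afterSnd (x : List S) (m : List P.Mem) (T : Tape (Option P.Work)) :
    P.Q × Tape (Option P.Work) × List P.Aux :=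
  let r := P.afterFst x m T
  let b := P.sndStart r.1 r.2.1.read
  let s := P.runSnd b.1 (act r.2.1 b.2) r.2.2
  let e := P.sndEnd s.1 s.2.1.read
  (e.1, act s.2.1 e.2, s.2.2)

/-- The memory after a cycle. -/
def nextMem (x : List S) (m : List P.Mem) (T : Tape (Option P.Work)) : List P.Mem :=
  (P.runBack (P.afterSnd x m T).1 (P.afterSnd x m T).2.2).2

/-- The work tape after a cycle. -/
def nextWork (x : List S) (m : List P.Mem) (T : Tape (Option P.Work)) : Tape (Option P.Work) :=
  (P.afterSnd x m T).2.1

/-- A base tape with the given content followed by blanks. -/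
def baseTape {S : Type u} {G : Type v} {M A : Type} (h : ℕ) (l : List (BaseSym S G M A)) :
    Tape (BaseSym S G M A) where
  head := h
  cell := fun i => (l[i]?).getD .blank

section Tape

variable {M A : Type}

theorem baseTape_read_zero (l : List (BaseSym S G M A)) : (baseTape 0 l).read = none := rfl

theorem baseTape_read_append (l l' : List (BaseSym S G M A)) (b : BaseSym S G M A) :
    (baseTape (l.length + 1) (l ++ b :: l')).read = some b := by
  simp [Tape.read, baseTape]

theorem baseTape_read_end (l : List (BaseSym S G M A)) :
    (baseTape (l.length + 1) l).read = some .blank := by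
  simp [Tape.read, baseTape]

theorem baseTape_write_append (l l' : List (BaseSym S G M A)) (b b' : BaseSym S G M A) :
    (baseTape (l.length + 1) (l ++ b :: l')).write b' =
      baseTape (l.length + 1) (l ++ b' :: l') := by
  simp only [Tape.write, baseTape, Tape.mk.injEq, true_and]
  funext i
  rcases eq_or_ne i l.length with rfl | h
  · simp
  · rw [Function.update_of_ne h]
    simp only [List.getElem?_append]
    split_ifs with h2
    · rfl
    · have : i - l.length ≠ 0 := by omega
      obtain ⟨j, hj⟩ := Nat.exists_eq_succ_of_ne_zero this
      rw [hj]; simp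

theorem baseTape_write_end (l : List (BaseSym S G M A)) (b : BaseSym S G M A) :
    (baseTape (l.length + 1) l).write b = baseTape (l.length + 1) (l ++ [b]) := by
  simp only [Tape.write, baseTape, Tape.mk.injEq, true_and]
  funext i
  rcases lt_trichotomy i l.length with h | rfl | h
  · rw [Function.update_of_ne h.ne, List.getElem?_append_left h]
  · simp
  · rw [Function.update_of_ne h.ne', List.getElem?_eq_none (by omega),
      List.getElem?_eq_none (by simp; omega)]

theorem baseTape_write_end_blank (l : List (BaseSym S G M A)) :
    (baseTape (l.length + 1) l).write .blank = baseTape (l.length + 1) l := by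
  simp only [Tape.write, baseTape, Tape.mk.injEq, true_and]
  funext i
  rcases eq_or_ne i l.length with rfl | h
  · simp
  · rw [Function.update_of_ne h]

theorem Tape.write_read {B : Type} (T : Tape (Option B)) :
    (T.write (T.read.getD none)).move .stay = T := by
  obtain ⟨h, c⟩ := T
  cases h with
  | zero => rfl
  | succ i => simp [Tape.read, Tape.write, Tape.move]

end Tape

/-- `C'` is reached from `C` in `t` steps and the base head stays within the first `b` positions on
the way. -/
def Reaches (M : Learner S G) (b t : ℕ) (C C' : M.Config) : Prop :=
  M.step^[t] C = C' ∧ ∀ i ≤ t, (M.step^[i] C).base.head ≤ b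

theorem Reaches.refl {M : Learner S G} {b : ℕ} {C : M.Config} (h : C.base.head ≤ b) :
    Reaches M b 0 C C :=
  ⟨rfl, fun i hi => by obtain rfl : i = 0 := by omega
                       exact h⟩

theorem Reaches.trans {M : Learner S G} {b t t' : ℕ} {C C' C'' : M.Config}
    (h : Reaches M b t C C') (h' : Reaches M b t' C' C'') : Reaches M b (t + t') C C'' := by
  obtain ⟨h1, h2⟩ := h
  obtain ⟨h3, h4⟩ := h'
  refine ⟨by rw [add_comm, Function.iterate_add_apply, h1, h3], fun i hi => ?_⟩
  rcases le_total i t with h | h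
  · exact h2 i h
  · have := h4 (i - t) (by omega)
    rwa [← h1, ← Function.iterate_add_apply, show i - t + t = i by omega] at this

theorem Reaches.single {M : Learner S G} {b : ℕ} {C C' : M.Config} (h : M.step C = C')
    (h1 : C.base.head ≤ b) (h2 : C'.base.head ≤ b) : Reaches M b 1 C C' :=
  ⟨h, fun i hi => by
    rcases Nat.le_one_iff_eq_zero_or_eq_one.1 hi with rfl | rfl
    · exact h1
    · rw [Function.iterate_one, h]; exact h2⟩

/-- A configuration of the machine of a sweeper. -/
abbrev config (ph : Phase) (q : P.Q) (h : ℕ) (l : List (BaseSym S G P.Mem P.Aux))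
    (T : Tape (Option P.Work)) : P.toLearner.Config :=
  ⟨(ph, q), baseTape h l, T⟩

theorem step_config {ph : Phase} (hph : ph ≠ .done) (q : P.Q) (B : Tape _)
    (T : Tape (Option P.Work)) :
    P.toLearner.step ⟨(ph, q), B, T⟩ =
      let r := P.trans (ph, q) B.read T.read
      ⟨r.1, (B.write r.2.1.1).move r.2.1.2, act T r.2.2⟩ := by
  have : ¬ (ph == Phase.done) = true := by simpa using hph
  exact if_neg this

/-- The part `pre` that has already been converted is general, so that induction on the unread part
applies. -/
theorem reaches_fst (l : List (Option S × Option P.Mem)) :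
    ∀ (b : ℕ) (q : P.Q) (pre : List (BaseSym S G P.Mem P.Aux)) (T : Tape (Option P.Work)),
      pre.length + l.length + 1 ≤ b →
      Reaches P.toLearner b l.length
        (P.config .fst q (pre.length + 1) (pre ++ l.map .inp) T)
        (P.config .fst (P.runFst q T l).1 (pre.length + l.length + 1)
          (pre ++ (P.runFst q T l).2.2.map .aux) (P.runFst q T l).2.1) := by
  induction l with
  | nil => intro b q pre T hb; exact Reaches.refl (by simpa [baseTape] using hb)
  | cons x l ih =>
    intro b q pre T hb
    rw [List.length_cons] at hb
    have h1 : P.toLearner.step (P.config .fst q (pre.length + 1) (pre ++ (x :: l).map .inp) T) =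
        P.config .fst (P.fstCell q x T.read).1
          ((pre ++ [BaseSym.aux (P.fstCell q x T.read).2.1]).length + 1)
          ((pre ++ [BaseSym.aux (P.fstCell q x T.read).2.1]) ++ l.map .inp)
          (act T (P.fstCell q x T.read).2.2) := by
      rw [step_config _ (by simp), List.map_cons, baseTape_read_append]
      simp only [trans, baseTape_write_append]
      simp [Tape.move, baseTape]
    have := (Reaches.single h1 (by simp [baseTape]; omega) (by simp [baseTape]; omega)).trans
      (ih b _ _ _ (by simp; omega))
    rw [List.length_cons, add_comm]
    convert this using 2 <;> first | omega | (simp [runFst]; done) | (simp; omega)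

theorem reaches_snd (l : List P.Aux) :
    ∀ (b : ℕ) (q : P.Q) (pre : List (BaseSym S G P.Mem P.Aux)) (T : Tape (Option P.Work)),
      pre.length + l.length + 1 ≤ b →
      Reaches P.toLearner b l.length
        (P.config .snd q (pre.length + 1) (pre ++ l.map .aux) T)
        (P.config .snd (P.runSnd q T l).1 (pre.length + l.length + 1)
          (pre ++ (P.runSnd q T l).2.2.map .aux) (P.runSnd q T l).2.1) := by
  induction l with
  | nil => intro b q pre T hb; exact Reaches.refl (by simpa [baseTape] using hb)
  | cons x l ih =>
    intro b q pre T hb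
    rw [List.length_cons] at hb
    have h1 : P.toLearner.step (P.config .snd q (pre.length + 1) (pre ++ (x :: l).map .aux) T) =
        P.config .snd (P.sndCell q x T.read).1
          ((pre ++ [BaseSym.aux (P.sndCell q x T.read).2.1]).length + 1)
          ((pre ++ [BaseSym.aux (P.sndCell q x T.read).2.1]) ++ l.map .aux)
          (act T (P.sndCell q x T.read).2.2) := by
      rw [step_config _ (by simp), List.map_cons, baseTape_read_append]
      simp only [trans, baseTape_write_append]
      simp [Tape.move, baseTape]
    have := (Reaches.single h1 (by simp [baseTape]; omega) (by simp [baseTape]; omega)).trans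
      (ih b _ _ _ (by simp; omega))
    rw [List.length_cons, add_comm]
    convert this using 2 <;> first | omega | (simp [runSnd]; done) | (simp; omega)

theorem reaches_ret (q : P.Q) (T : Tape (Option P.Work)) (pre : List (BaseSym S G P.Mem P.Aux)) :
    ∀ (b : ℕ) (suf : List (BaseSym S G P.Mem P.Aux)), pre.length ≤ b →
      Reaches P.toLearner b pre.length
        (P.config .ret q pre.length (pre ++ suf) T) (P.config .ret q 0 (pre ++ suf) T) := by
  induction pre using List.reverseRecOn with
  | nil => intro b suf _; exact Reaches.refl (by simp [baseTape])
  | append_singleton pre x ih =>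
    intro b suf hb
    rw [List.length_append, List.length_singleton] at hb ⊢
    rw [List.append_assoc, List.singleton_append, add_comm]
    refine (Reaches.single ?_ (by simp [baseTape]; omega) (by simp [baseTape]; omega)).trans
      (ih b (x :: suf) (by omega))
    rw [step_config _ (by simp), add_comm, baseTape_read_append]
    simp only [trans, baseTape_write_append]
    simp only [act, Tape.write_read]
    simp [Tape.move, baseTape]

theorem reaches_back (q : P.Q) (T : Tape (Option P.Work)) (l : List P.Aux) :
    ∀ (b : ℕ) (pre : List (BaseSym S G P.Mem P.Aux)), pre.length + l.length ≤ b →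
      Reaches P.toLearner b l.length
        (P.config .last q (pre.length + l.length) (pre ++ l.map .aux) T)
        (P.config .last (P.runBack q l).1 pre.length
          (pre ++ (P.runBack q l).2.map fun m => .out (some m, P.letter m)) T) := by
  induction l with
  | nil => intro b pre hb; exact Reaches.refl (by simpa [baseTape] using hb)
  | cons x l ih =>
    intro b pre hb
    rw [List.length_cons] at hb
    have h1 := ih b (pre ++ [BaseSym.aux x]) (by simp; omega)
    have h2 : P.toLearner.step
        (P.config .last (P.runBack q l).1 (pre ++ [BaseSym.aux x]).length
          ((pre ++ [BaseSym.aux x]) ++ (P.runBack q l).2.map fun m => .out (some m, P.letter m)) T) =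
        P.config .last (P.runBack q (x :: l)).1 pre.length
          (pre ++ (P.runBack q (x :: l)).2.map fun m => .out (some m, P.letter m)) T := by
      rw [step_config _ (by simp), List.append_assoc, List.singleton_append, List.length_append,
        List.length_singleton, baseTape_read_append]
      simp only [trans, baseTape_write_append, act, Tape.write_read]
      simp [Tape.move, baseTape, runBack]
    have h3 := h1.trans (Reaches.single h2 (by simp [baseTape]; omega) (by simp [baseTape]; omega))
    rw [List.length_cons]
    convert h3 using 2 <;> first | (simp; done) | (simp; omega)

theorem runFst_length (l : List (Option S × Option P.Mem)) (q : P.Q) (T : Tape (Option P.Work)) :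
    (P.runFst q T l).2.2.length = l.length := by
  induction l generalizing q T with
  | nil => rfl
  | cons x l ih => simp [runFst, ih]

theorem runSnd_length (l : List P.Aux) (q : P.Q) (T : Tape (Option P.Work)) :
    (P.runSnd q T l).2.2.length = l.length := by
  induction l generalizing q T with
  | nil => rfl
  | cons x l ih => simp [runSnd, ih]

theorem runBack_length (l : List P.Aux) (q : P.Q) : (P.runBack q l).2.length = l.length := by
  induction l with
  | nil => rfl
  | cons x l ih => simp [runBack, ih]

theorem afterFst_length_le (x : List S) (m : List P.Mem) (T : Tape (Option P.Work)) :
    (P.afterFst x m T).2.2.length ≤ max x.length m.length + 1 := by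
  simp only [afterFst, List.length_append, runFst_length, conv_length]
  have : ∀ o : Option P.Aux, o.toList.length ≤ 1 := by intro o; cases o <;> simp
  have := this (P.fstEnd (P.runFst P.init T (conv x m)).1 (P.runFst P.init T (conv x m)).2.1.read).2.1
  omega

theorem le_afterFst_length (x : List S) (m : List P.Mem) (T : Tape (Option P.Work)) :
    max x.length m.length ≤ (P.afterFst x m T).2.2.length := by
  simp only [afterFst, List.length_append, runFst_length, conv_length]
  omega

theorem afterSnd_length (x : List S) (m : List P.Mem) (T : Tape (Option P.Work)) :
    (P.afterSnd x m T).2.2.length = (P.afterFst x m T).2.2.length := by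
  simp [afterSnd, runSnd_length]

/-- A cycle of a sweeper. -/
theorem reaches_cycle (x : List S) (m : List P.Mem) (T : Tape (Option P.Work)) :
    ∃ (t : ℕ) (q : P.Q), t ≤ 4 * max x.length m.length + 10 ∧
      Reaches P.toLearner (max x.length m.length + 2) t (P.toLearner.cycleStart x m T)
        (P.config .done q 0 ((P.nextMem x m T).map fun m => .out (some m, P.letter m))
          (P.nextWork x m T)) := by
  set n := max x.length m.length with hn
  set b := n + 2 with hb
  set l1 := (P.afterFst x m T).2.2 with hl1
  have hl1n : l1.length ≤ n + 1 := P.afterFst_length_le x m T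
  have hnl1 : n ≤ l1.length := P.le_afterFst_length x m T
  have s0 : Reaches P.toLearner b 1 (P.toLearner.cycleStart x m T)
      (P.config .fst P.init 1 ((conv x m).map .inp) T) := by
    apply Reaches.single
    · have : P.toLearner.cycleStart x m T =
          P.config .start P.init 0 ((conv x m).map .inp) T := by
        simp only [Learner.cycleStart, config, baseTape, toLearner]
        congr 2
        funext i
        rw [List.getElem?_map]
        cases (conv x m)[i]? <;> rfl
      rw [this, step_config _ (by simp)]
      simp only [trans, act, Tape.write_read]
      rfl
    · simp [Learner.cycleStart]
    · simp [baseTape, hb]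
  have s1 := P.reaches_fst (conv x m) b P.init [] T (by simp [hb, hn])
  simp only [List.nil_append, List.length_nil, zero_add, conv_length, ← hn] at s1
  set r := P.runFst P.init T (conv x m) with hr
  have hrl : r.2.2.length = n := by rw [hr, runFst_length, conv_length]
  have s2 : Reaches P.toLearner b 1 (P.config .fst r.1 (n + 1) (r.2.2.map .aux) r.2.1)
      (P.config .ret (P.afterFst x m T).1 n (l1.map .aux) (P.afterFst x m T).2.1) := by
    apply Reaches.single
    · have hh : n + 1 = (r.2.2.map BaseSym.aux : List (BaseSym S G P.Mem P.Aux)).length + 1 := by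
        simp [hrl]
      rw [step_config _ (by simp), hh, baseTape_read_end]
      simp only [trans]
      have hcases : ((baseTape ((r.2.2.map BaseSym.aux : List (BaseSym S G P.Mem P.Aux)).length + 1)
          (r.2.2.map BaseSym.aux : List (BaseSym S G P.Mem P.Aux))).write
          ((P.fstEnd r.1 r.2.1.read).2.1.elim .blank .aux)).move .left =
          baseTape n (l1.map .aux) := by
        simp only [hl1, afterFst, ← hr]
        cases (P.fstEnd r.1 r.2.1.read).2.1 with
        | none => 
          rw [Option.elim_none, baseTape_write_end_blank]
          simp [Tape.move, baseTape, hrl]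
        | some a =>
          rw [Option.elim_some, baseTape_write_end]
          simp [Tape.move, baseTape, hrl]
      rw [hcases]
      rfl
    · simp [baseTape, hb]
    · simp [baseTape, hb]
  -- The end of the first sweep moves left from position `n + 1`, so the return starts at position
  -- `n`, to the left of a cell that may have been appended.
  have s3 := P.reaches_ret (P.afterFst x m T).1 (P.afterFst x m T).2.1 ((l1.map .aux).take n) b
    ((l1.map .aux).drop n) (by simp; omega)
  rw [List.take_append_drop, List.length_take, List.length_map, min_eq_left hnl1] at s3
  have s4 : Reaches P.toLearner b 1
      (P.config .ret (P.afterFst x m T).1 0 (l1.map .aux) (P.afterFst x m T).2.1)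
      (P.config .snd (P.sndStart (P.afterFst x m T).1 (P.afterFst x m T).2.1.read).1 1 (l1.map .aux)
        (act (P.afterFst x m T).2.1 (P.sndStart (P.afterFst x m T).1 (P.afterFst x m T).2.1.read).2)) := by
    apply Reaches.single
    · rw [step_config _ (by simp)]
      rfl
    · simp [baseTape]
    · simp [baseTape, hb]
  have s5 := P.reaches_snd l1 b (P.sndStart (P.afterFst x m T).1 (P.afterFst x m T).2.1.read).1 []
    (act (P.afterFst x m T).2.1 (P.sndStart (P.afterFst x m T).1 (P.afterFst x m T).2.1.read).2) (by simp; omega)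
  simp only [List.nil_append, List.length_nil, zero_add] at s5
  set r2 := P.runSnd (P.sndStart (P.afterFst x m T).1 (P.afterFst x m T).2.1.read).1
    (act (P.afterFst x m T).2.1 (P.sndStart (P.afterFst x m T).1 (P.afterFst x m T).2.1.read).2) l1 with hr2
  have hr2l : r2.2.2.length = l1.length := by rw [hr2, runSnd_length]
  have s6 : Reaches P.toLearner b 1
      (P.config .snd r2.1 (l1.length + 1) (r2.2.2.map .aux) r2.2.1)
      (P.config .last (P.afterSnd x m T).1 l1.length ((P.afterSnd x m T).2.2.map .aux)
        (P.afterSnd x m T).2.1) := by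
    apply Reaches.single
    · have hh : l1.length + 1 =
          (r2.2.2.map BaseSym.aux : List (BaseSym S G P.Mem P.Aux)).length + 1 := by simp [hr2l]
      rw [step_config _ (by simp), hh, baseTape_read_end]
      simp only [trans, baseTape_write_end_blank]
      simp only [Tape.move, baseTape, List.length_map, hr2l]
      rfl
    · simp [baseTape]; omega
    · simp [baseTape]; omega
  have s7 := P.reaches_back (P.afterSnd x m T).1 (P.afterSnd x m T).2.1 (P.afterSnd x m T).2.2 b []
    (by simp [afterSnd_length, ← hl1]; omega)
  simp only [List.nil_append, List.length_nil, zero_add, afterSnd_length, ← hl1] at s7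
  have s8 : Reaches P.toLearner b 1
      (P.config .last (P.runBack (P.afterSnd x m T).1 (P.afterSnd x m T).2.2).1 0
        ((P.nextMem x m T).map fun m => .out (some m, P.letter m)) (P.nextWork x m T))
      (P.config .done (P.runBack (P.afterSnd x m T).1 (P.afterSnd x m T).2.2).1 0
        ((P.nextMem x m T).map fun m => .out (some m, P.letter m)) (P.nextWork x m T)) := by
    apply Reaches.single
    · rw [step_config _ (by simp)]
      simp only [baseTape_read_zero, trans, act, Tape.write_read]
      rfl
    · simp [baseTape]
    · simp [baseTape]
  refine ⟨_, _, ?_, ((((((((s0.trans s1).trans s2).trans s3).trans s4).trans s5).trans s6).trans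
    s7).trans s8)⟩
  omega

theorem step_done {C : P.toLearner.Config} (h : C.state.1 = .done) : P.toLearner.step C = C :=
  if_pos (show (C.state.1 == Phase.done) = true by simp [h])

theorem iterate_step_done {C : P.toLearner.Config} (h : C.state.1 = .done) (n : ℕ) :
    P.toLearner.step^[n] C = C :=
  Function.iterate_fixed (P.step_done h) n

/-- Memory and work tape at the beginning of the cycles. -/
def run (w : ℕ → List S) : ℕ → List P.Mem × Tape (Option P.Work)
  | 0 => (P.initMem, { head := 0, cell := fun _ => none })
  | k + 1 =>
    let r := run w k
    (P.nextMem (w k) r.1 r.2, P.nextWork (w k) r.1 r.2)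

/-- The hypothesis says that the conjecture is stored letter by letter from the first memory cell
on, without gaps. Hence it is no longer than the memory, and the output symbols are those of the
convolution. -/
theorem exists_isRun (w : ℕ → List S) (hyp : ℕ → List G)
    (hhyp : ∀ k (i : ℕ), (hyp k)[i]? = ((P.run w (k + 1)).1[i]?).bind P.letter) :
    ∃ time : ℕ → ℕ,
      P.toLearner.IsRun w (fun k => (P.run w k).1) (fun k => (P.run w k).2) hyp time ∧
      (∀ k, time k ≤ 4 * max (w k).length (P.run w k).1.length + 10) ∧
      ∀ k s, (P.toLearner.configAt (w k) (P.run w k).1 (P.run w k).2 s).base.head ≤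
        max (w k).length (P.run w k).1.length + 2 := by
  choose time q htime hreach using fun k => P.reaches_cycle (w k) (P.run w k).1 (P.run w k).2
  have hfin : ∀ k, P.toLearner.configAt (w k) (P.run w k).1 (P.run w k).2 (time k) =
      P.config .done (q k) 0 ((P.run w (k + 1)).1.map fun m => .out (some m, P.letter m))
        (P.run w (k + 1)).2 := fun k => (hreach k).1
  have hlen : ∀ k, (hyp k).length ≤ (P.run w (k + 1)).1.length := by
    intro k
    by_contra hcon
    have := hhyp k (P.run w (k + 1)).1.length
    rw [List.getElem?_eq_getElem (by omega), List.getElem?_eq_none le_rfl] at this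
    simp at this
  refine ⟨time, ⟨rfl, rfl, fun k => ?_, fun k => ?_, fun k => ?_⟩, htime, fun k s => ?_⟩
  · rw [hfin]; rfl
  · rw [hfin]
    constructor
    · intro i b hb
      rw [conv_getElem?] at hb
      split_ifs at hb with hi
      rw [max_eq_left (hlen k)] at hi
      rw [Option.some_inj] at hb
      subst hb
      simp only [baseTape, List.getElem?_map]
      rw [hhyp, List.getElem?_eq_getElem hi]
      rfl
    · rw [conv_length, max_eq_left (hlen k)]
      simp [baseTape]
  · rw [hfin]
  · rcases le_total s (time k) with h | h
    · exact (hreach k).2 s h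
    · obtain ⟨j, rfl⟩ := Nat.exists_eq_add_of_le h
      have : P.toLearner.configAt (w k) (P.run w k).1 (P.run w k).2 (time k + j) =
          P.toLearner.configAt (w k) (P.run w k).1 (P.run w k).2 (time k) := by
        conv_lhs => rw [Learner.configAt, add_comm, Function.iterate_add_apply]
        exact P.iterate_step_done (by
          show (P.toLearner.configAt (w k) (P.run w k).1 (P.run w k).2 (time k)).state.1 = _
          rw [hfin]) j
      rw [this, hfin]
      simp [baseTape]

end Sweeper

end LinLearn


/-! ### The alphabets and transitions of the concrete machine -/

namespace LinLearn

universe u v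

/-- A cell of the work tape: four symbols, of which the first two have been written during the
previous trip of the head and the last two during the present one, each time one symbol on the way
to the right and one on the way to the left. -/
@[ext] structure WCell (s : ℕ) where
  ra : Option (Sym s)
  la : Option (Sym s)
  rb : Option (Sym s)
  lb : Option (Sym s)

namespace WCell

variable {s : ℕ}

/-- The empty cell. -/
def empty : WCell s := ⟨none, none, none, none⟩

/-- A new trip: the symbols become old and `a` is written on the way to the right. -/
def push (c : WCell s) (a : Option (Sym s)) : WCell s := ⟨c.rb, c.lb, a, none⟩

/-- The symbol `a` is written on the way to the left. -/
def setLb (c : WCell s) (a : Option (Sym s)) : WCell s := { c with lb := a }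

end WCell

/-- The control information of the machine. -/
structure Glob (g s : ℕ) (L : Type) where
  loc : L
  left : Bool
  letter : Fin (s + 2)
  pend : Fin (g + 1)

/-- The part of a memory cell that represents the store. -/
structure Core (s g R : ℕ) where
  reg : Fin R → Bool
  ldR : Option (Sym s)
  ldL : Option (Sym s)
  build : Option (Fin g)
  pub : Option (Fin g)

/-- The letters of the long term memory. -/
structure MCell (s g R : ℕ) (L : Type) where
  glob : Glob g s L
  dig : Option Bool
  core : Core s g R

/-- What the machine does in a cycle. -/
inductive Kind
  | idle | load | op | grab
  deriving DecidableEq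

/-- The states of the machine. -/
structure QState (s g : ℕ) (L : Type) where
  gl : Option (Glob g s L)
  carry : Bool
  kind : Kind
  flag : Bool
  sym : Option (Sym s)

section Finite

variable {s g R : ℕ} {L : Type}

instance : Finite (WCell s) :=
  Finite.of_injective (fun c : WCell s => (c.ra, c.la, c.rb, c.lb)) fun c d h => by
    cases c; cases d; simpa using h

instance [Finite L] : Finite (Glob g s L) :=
  Finite.of_injective (fun c : Glob g s L => (c.loc, c.left, c.letter, c.pend)) fun c d h => by
    cases c; cases d; simpa using h

instance : Finite (Core s g R) :=
  Finite.of_injective (fun c : Core s g R => (c.reg, c.ldR, c.ldL, c.build, c.pub)) fun c d h => by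
    cases c; cases d; simpa using h

instance [Finite L] : Finite (MCell s g R L) :=
  Finite.of_injective (fun c : MCell s g R L => (c.glob, c.dig, c.core)) fun c d h => by
    cases c; cases d; simpa using h

instance : Finite Kind :=
  Finite.of_surjective ![Kind.idle, .load, .op, .grab] fun p => by
    cases p
    exacts [⟨0, rfl⟩, ⟨1, rfl⟩, ⟨2, rfl⟩, ⟨3, rfl⟩]

instance [Finite L] : Finite (QState s g L) :=
  Finite.of_injective (fun c : QState s g L => (c.gl, c.carry, c.kind, c.flag, c.sym))
    fun c d h => by
      cases c; cases d; simpa using h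

end Finite

namespace Core

variable {s g R : ℕ}

/-- The empty core. -/
def empty : Core s g R := ⟨fun _ => false, none, none, none, none⟩

/-- The mark of register `r`. -/
def getReg (r : ℕ) (c : Core s g R) : Bool := if h : r < R then c.reg ⟨r, h⟩ else false

/-- Change the mark of register `r`. -/
def setReg (r : ℕ) (b : Bool) (c : Core s g R) : Core s g R :=
  if h : r < R then { c with reg := Function.update c.reg ⟨r, h⟩ b } else c

end Core

namespace Machine

section Edit

variable {s g R : ℕ} {L : Type}

/-- The cells to which an instruction applies. -/
def applies (gl : Glob g s L) : Instr → Core s g R → Bool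
  | .test r, c => c.getReg r
  | .act (.inc r), c => !c.getReg r
  | .act (.unload r), c => decide (gl.letter ≠ 0) && !c.getReg r
  | .act .push, c => decide (gl.pend ≠ 0) && c.build.isNone
  | .act .publish, _ => true
  | .act (.fill _), _ => true
  | .act .fetch, c => c.ldR.isSome
  | .act .turn, c => c.ldR.isSome || c.ldL.isSome
  | .act .nop, _ => false
  | .act .tick, _ => false

/-- The effect of an instruction on the cells to which it applies. -/
def edit (gl : Glob g s L) : Instr → Core s g R → Core s g R
  | .test r, c => c.setReg r false
  | .act (.inc r), c => c.setReg r true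
  | .act (.unload r), c => c.setReg r true
  | .act (.fill r), c => c.setReg r true
  | .act .push, c => { c with build := if h : gl.pend = 0 then none else some (gl.pend.pred h) }
  | .act .publish, c => { c with pub := c.build, build := none }
  | .act .fetch, c => { c with ldR := none }
  | .act .turn, c => c
  | .act .nop, c => c
  | .act .tick, c => c

/-- Does an instruction apply to the first suitable cell only? -/
def once : Instr → Bool
  | .act .publish => false
  | .act (.fill _) => false
  | _ => true

end Edit

variable {S : Type u} {G : Type v} {s g : ℕ} (eS : S → Fin s) (eG : Fin g → G) (body : Prog)
  (pub₀ : List (Fin g))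

/-- The initial control information. -/
def glob₀ : Glob g s body.Loc := ⟨body.entry, true, 0, 0⟩

/-- An empty memory cell. -/
def cell₀ : MCell s g body.bound body.Loc := ⟨glob₀ body, none, Core.empty⟩

variable {body}

/-- The control information after an instruction, depending on its outcome. -/
def nextGlob (gl : Glob g s body.Loc) (flag : Bool) (sym : Option (Sym s)) :
    Glob g s body.Loc where
  loc := (body.next gl.loc (match body.instr gl.loc with | .test _ => flag | _ => true)).getD
    body.entry
  left := match body.instr gl.loc with | .act .turn => !flag | _ => gl.left
  letter := match body.instr gl.loc with
    | .act (.unload _) => if gl.letter = 0 then 0 else gl.letter - 1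
    | .act .fetch => sym.elim 0 Sym.code
    | _ => gl.letter
  pend := match body.instr gl.loc with
    | .act .tick => if h : gl.pend + 1 < g + 1 then ⟨gl.pend + 1, h⟩ else gl.pend
    | .act .push => 0
    | _ => gl.pend

variable (body)

/-- The content of a work tape symbol. -/
def rd (w : Option (Option (WCell s))) : WCell s := (w.getD none).getD WCell.empty

/-- Writing on the work tape during the first sweep. -/
def track (left : Bool) (w : Option (Option (WCell s))) (a : Option (Sym s)) :
    Option (WCell s) × Move :=
  if left then if w.isNone then (none, .stay) else (some ((rd w).setLb a), .left)
  else (some ((rd w).push a), .right)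

/-- The first sweep: the datum is written on the work tape and the counter is incremented. -/
def fstCell (q : QState s g body.Loc) (x : Option S × Option (MCell s g body.bound body.Loc))
    (w : Option (Option (WCell s))) : QState s g body.Loc ×
      (Option (Sym s) × MCell s g body.bound body.Loc) × Option (WCell s) × Move :=
  let c := x.2.getD (cell₀ body)
  -- The control information is taken from the first cell only and then kept in the state.
  let gl := q.gl.getD c.glob
  let a := x.1.map fun a => some (eS a)
  ({ q with gl := some gl, carry := q.carry && c.dig.getD true },
    -- Letters met after the work head has reached the marker stay on the base tape and are written
    -- to the work tape in the second sweep.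
    (if gl.left && w.isNone then a else none,
      { c with dig := c.dig.map fun b => xor b q.carry }), track gl.left w a)

/-- The end of the first sweep. -/
def fstEnd (q : QState s g body.Loc) (w : Option (Option (WCell s))) : QState s g body.Loc ×
    Option (Option (Sym s) × MCell s g body.bound body.Loc) × Option (WCell s) × Move :=
  let gl := q.gl.getD (glob₀ body)
  ({ q with
      -- An instruction is executed only if the counter overflows, that is, when an empty cell is
      -- appended, and never during the way to the left.
      kind := if gl.left && w.isNone then .load else if q.carry && !gl.left then .op else .idle },
    if q.carry then some (none, { cell₀ body with dig := some false }) else none,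
    track gl.left w (some none))

/-- The beginning of the second sweep. -/
def sndStart (q : QState s g body.Loc) (w : Option (Option (WCell s))) :
    QState s g body.Loc × Option (WCell s) × Move :=
  (q, w.getD none, if q.kind = .load then .right else .stay)

/-- The second sweep: symbols are loaded from the work tape, or an instruction is executed. -/
def sndCell (q : QState s g body.Loc) (x : Option (Sym s) × MCell s g body.bound body.Loc)
    (w : Option (Option (WCell s))) : QState s g body.Loc ×
      (Option (Sym s) × MCell s g body.bound body.Loc) × Option (WCell s) × Move :=
  let gl := q.gl.getD (glob₀ body)
  let c := x.2.core
  match q.kind with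
  | .load => (q, (none, { x.2 with core := { c with ldR := (rd w).ra, ldL := (rd w).la } }),
      some ((rd w).push x.1), .right)
  | .op =>
    let i := body.instr gl.loc
    if applies gl i c && !(once i && q.flag) then
      ({ q with flag := true, sym := c.ldR },
        (none, { x.2 with core := edit gl i c }), w.getD none, .stay)
    else (q, x, w.getD none, .stay)
  | _ => (q, x, w.getD none, .stay)

/-- The end of the second sweep. -/
def sndEnd (q : QState s g body.Loc) (w : Option (Option (WCell s))) :
    QState s g body.Loc × Option (WCell s) × Move :=
  let gl := q.gl.getD (glob₀ body)
  match q.kind with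
  | .load => ({ q with kind := .idle, gl := some { gl with left := false } },
      some ((rd w).push (some none)), .right)
  | .op =>
    ({ q with
        -- The queue consists of the track `ldR` from left to right followed by `ldL` from right to
        -- left. If `ldR` is used up, the next symbol is the rightmost one on `ldL`, which the final
        -- sweep to the left meets first.
        kind := if body.instr gl.loc = .act .fetch ∧ q.flag = false then .grab else .idle
        gl := some (nextGlob gl q.flag q.sym) }, w.getD none, .stay)
  | _ => (q, w.getD none, .stay)

/-- The last sweep: the new control information is distributed. -/
def back (q : QState s g body.Loc) (x : Option (Sym s) × MCell s g body.bound body.Loc) :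
    QState s g body.Loc × MCell s g body.bound body.Loc :=
  let gl := q.gl.getD (glob₀ body)
  if q.kind = .grab ∧ x.2.core.ldL ≠ none then
    let gl' := { gl with letter := x.2.core.ldL.elim 0 Sym.code }
    ({ q with kind := .idle, gl := some gl' },
      { x.2 with glob := gl', core := { x.2.core with ldL := none } })
  else (q, { x.2 with glob := gl })

/-- The machine that interprets `body`. -/
abbrev sweeper : Sweeper S G where
  Q := QState s g body.Loc
  Mem := MCell s g body.bound body.Loc
  Aux := Option (Sym s) × MCell s g body.bound body.Loc
  Work := WCell s
  finite_q := have := body.finite_loc; inferInstance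
  finite_mem := have := body.finite_loc; inferInstance
  finite_aux := have := body.finite_loc; inferInstance
  finite_work := inferInstance
  init := ⟨none, true, .idle, false, none⟩
  fstCell := fstCell eS body
  fstEnd := fstEnd body
  sndStart := sndStart body
  sndCell := sndCell body
  sndEnd := sndEnd body
  back := back body
  letter c := c.core.pub.map eG
  -- The extra cell keeps the memory non-empty, so that there is always a first cell with the
  -- control information.
  initMem := (pub₀.map fun a => { cell₀ body with core := { Core.empty with pub := some a } }) ++
    [cell₀ body]

end Machine

end LinLearn


/-! ### The effect of the sweeps on the work tape and the counter -/

namespace LinLearn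

universe u v

open Sweeper

namespace Machine

section View

variable {s : ℕ}

/-- The work tape with the blanks read as empty cells. -/
def view (T : Tape (Option (WCell s))) : Tape (WCell s) :=
  ⟨T.head, fun i => (T.cell i).getD WCell.empty⟩

theorem view_act (T : Tape (Option (WCell s))) (c : WCell s) (d : Move) :
    view (act T (some c, d)) = act (view T) (c, d) := by
  obtain ⟨h, f⟩ := T
  have : view (Tape.write ⟨h, f⟩ (some c)) = (view ⟨h, f⟩).write c := by
    cases h with
    | zero => rfl
    | succ i =>
      simp only [Tape.write, view, Tape.mk.injEq, true_and]
      funext j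
      simp only [Function.update_apply]
      split_ifs <;> rfl
  rw [act, act, ← this]
  cases d <;> rfl

theorem act_stay (T : Tape (Option (WCell s))) : act T (T.read.getD none, .stay) = T :=
  Tape.write_read T

theorem act_marker {T : Tape (Option (WCell s))} (h : T.head = 0) (a : Option (WCell s))
    (d : Move) : act T (a, d) = T.move d := by
  simp [act, Tape.write, h]

theorem read_isNone {A : Type} (T : Tape A) : T.read.isNone = decide (T.head = 0) := by
  obtain ⟨h, f⟩ := T
  cases h <;> simp [Tape.read]

theorem rd_read {T : Tape (Option (WCell s))} (h : T.head ≠ 0) :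
    rd T.read = (view T).cell (T.head - 1) := by
  obtain ⟨i, f⟩ := T
  cases i with
  | zero => exact absurd rfl h
  | succ i => simp [Tape.read, rd, view]

/-- Writing a list of symbols on the way to the right. -/
def goRight (T : Tape (WCell s)) (n : ℕ) (a : ℕ → Option (Sym s)) : Tape (WCell s) where
  head := T.head + n
  cell i := if T.head ≤ i + 1 ∧ i + 1 < T.head + n then (T.cell i).push (a (i + 1 - T.head))
    else T.cell i

/-- Writing a list of symbols on the way to the left. -/
def goLeft (T : Tape (WCell s)) (n : ℕ) (a : ℕ → Option (Sym s)) : Tape (WCell s) where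
  head := T.head - n
  cell i := if i < T.head ∧ T.head ≤ i + n then (T.cell i).setLb (a (T.head - 1 - i))
    else T.cell i

theorem tape_ext {A : Type} {T T' : Tape A} (h1 : T.head = T'.head)
    (h2 : ∀ i, T.cell i = T'.cell i) : T = T' := by
  obtain ⟨h, f⟩ := T
  obtain ⟨h', f'⟩ := T'
  obtain rfl : h = h' := h1
  obtain rfl : f = f' := funext h2
  rfl

theorem act_cell {A : Type} {T : Tape A} (h : T.head ≠ 0) (a : A) (d : Move) (i : ℕ) :
    (act T (a, d)).cell i = if i = T.head - 1 then a else T.cell i := by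
  obtain ⟨j, f⟩ := T
  cases j with
  | zero => exact absurd rfl h
  | succ j => cases d <;> simp [act, Tape.write, Tape.move, Function.update_apply]

theorem act_right_head {A : Type} (T : Tape A) (a : A) : (act T (a, .right)).head = T.head + 1 := by
  obtain ⟨j, f⟩ := T
  cases j <;> rfl

theorem act_left_head {A : Type} (T : Tape A) (a : A) : (act T (a, .left)).head = T.head - 1 := by
  obtain ⟨j, f⟩ := T
  cases j <;> rfl

theorem goRight_head (T : Tape (WCell s)) (n : ℕ) (a : ℕ → Option (Sym s)) :
    (goRight T n a).head = T.head + n := rfl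

theorem goLeft_head (T : Tape (WCell s)) (n : ℕ) (a : ℕ → Option (Sym s)) :
    (goLeft T n a).head = T.head - n := rfl

theorem goRight_zero (T : Tape (WCell s)) (a : ℕ → Option (Sym s)) : goRight T 0 a = T :=
  tape_ext rfl fun i => if_neg (by omega)

theorem goLeft_zero (T : Tape (WCell s)) (a : ℕ → Option (Sym s)) : goLeft T 0 a = T :=
  tape_ext rfl fun i => if_neg (by omega)

/-- Splits off the first symbol, for the induction along a sweep; `goRight_append_one` splits off
the last one, which is the end marker of the word. -/
theorem goRight_succ (T : Tape (WCell s)) (hT : T.head ≠ 0) (n : ℕ) (a : ℕ → Option (Sym s)) :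
    goRight (act T ((T.cell (T.head - 1)).push (a 0), .right)) n (fun i => a (i + 1)) =
      goRight T (n + 1) a := by
  refine tape_ext ?_ fun i => ?_
  · simp only [goRight, act_right_head]
    omega
  · simp only [goRight, act_right_head, act_cell hT]
    rcases eq_or_ne i (T.head - 1) with rfl | hi
    · rw [if_neg (by omega), if_pos rfl, if_pos (by omega)]
      congr 2
      omega
    · rw [if_neg hi]
      by_cases h1 : T.head < i + 1 ∧ i + 1 < T.head + (n + 1)
      · rw [if_pos (by omega), if_pos (by omega)]
        congr 2
        omega
      · rw [if_neg (by omega), if_neg (by omega)]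

theorem goLeft_succ (T : Tape (WCell s)) (hT : T.head ≠ 0) (n : ℕ) (a : ℕ → Option (Sym s)) :
    goLeft (act T ((T.cell (T.head - 1)).setLb (a 0), .left)) n (fun i => a (i + 1)) =
      goLeft T (n + 1) a := by
  refine tape_ext ?_ fun i => ?_
  · simp only [goLeft, act_left_head]
    omega
  · simp only [goLeft, act_left_head, act_cell hT]
    rcases eq_or_ne i (T.head - 1) with rfl | hi
    · rw [if_neg (by omega), if_pos rfl, if_pos (by omega)]
      congr 2
      omega
    · rw [if_neg hi]
      by_cases h1 : i < T.head - 1 ∧ T.head - 1 ≤ i + n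
      · rw [if_pos (by omega), if_pos (by omega)]
        congr 2
        omega
      · rw [if_neg (by omega), if_neg (by omega)]

theorem goLeft_marker {T : Tape (WCell s)} (hT : T.head = 0) (n : ℕ) (a : ℕ → Option (Sym s)) :
    goLeft T n a = T :=
  tape_ext (by simp [goLeft, hT]) fun i => if_neg (by omega)

theorem goRight_append_one (T : Tape (WCell s)) (hT : T.head ≠ 0) (n : ℕ)
    (a : ℕ → Option (Sym s)) :
    act (goRight T n a) (((goRight T n a).cell ((goRight T n a).head - 1)).push (a n), .right) =
      goRight T (n + 1) a := by
  have h0 : (goRight T n a).head ≠ 0 := by simp only [goRight]; omega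
  refine tape_ext ?_ fun i => ?_
  · rw [act_right_head, goRight_head, goRight_head]
    omega
  · rw [act_cell h0, goRight_head]
    simp only [goRight]
    rcases eq_or_ne i (T.head + n - 1) with rfl | hi
    · rw [if_pos rfl, if_neg (by omega), if_pos (by omega)]
      congr 2
      omega
    · rw [if_neg hi]
      by_cases h1 : T.head ≤ i + 1 ∧ i + 1 < T.head + n
      · rw [if_pos (by omega), if_pos (by omega)]
      · rw [if_neg (by omega), if_neg (by omega)]

theorem goLeft_append_one (T : Tape (WCell s)) (n : ℕ) (hT : n < T.head)
    (a : ℕ → Option (Sym s)) :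
    act (goLeft T n a) (((goLeft T n a).cell ((goLeft T n a).head - 1)).setLb (a n), .left) =
      goLeft T (n + 1) a := by
  have h0 : (goLeft T n a).head ≠ 0 := by simp only [goLeft]; omega
  refine tape_ext ?_ fun i => ?_
  · rw [act_left_head, goLeft_head, goLeft_head]
    omega
  · rw [act_cell h0, goLeft_head]
    simp only [goLeft]
    rcases eq_or_ne i (T.head - n - 1) with rfl | hi
    · rw [if_pos rfl, if_neg (by omega), if_pos (by omega)]
      congr 2
      omega
    · rw [if_neg hi]
      by_cases h1 : i < T.head ∧ T.head ≤ i + n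
      · rw [if_pos (by omega), if_pos (by omega)]
      · rw [if_neg (by omega), if_neg (by omega)]

end View

section Digits

/-- Adding a carry to a list of binary digits. -/
def incr : Bool → List Bool → List Bool
  | _, [] => []
  | c, b :: l => xor b c :: incr (c && b) l

/-- The value of a list of binary digits, the least significant one first. -/
def bval : List Bool → ℕ
  | [] => 0
  | b :: l => b.toNat + 2 * bval l

theorem length_incr (c : Bool) (l : List Bool) : (incr c l).length = l.length := by
  induction l generalizing c with
  | nil => rfl
  | cons b l ih => simp [incr, ih]

/-- The number of digits is fixed, so the sum is correct modulo `2 ^ l.length`; a carry is lost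
exactly if `c` holds and all digits are one. -/
theorem bval_incr (c : Bool) (l : List Bool) :
    bval (incr c l) + 2 ^ l.length * (c && l.all id).toNat = bval l + c.toNat := by
  induction l generalizing c with
  | nil => simp [incr, bval]
  | cons b l ih =>
    have := ih (c && b)
    have e : (incr (c && b) l).length = l.length := length_incr _ _
    simp only [incr, bval, List.length_cons, pow_succ, List.all_cons, id]
    generalize l.all id = d at *
    generalize bval l = v at *
    generalize 2 ^ l.length = u at *
    cases b <;> cases c <;> cases d <;> simp at * <;> omega

theorem bval_lt (l : List Bool) : bval l < 2 ^ l.length := by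
  induction l with
  | nil => simp [bval]
  | cons b l ih =>
    cases b <;> simp [bval, pow_succ] <;> omega

theorem bval_append_false (l : List Bool) : bval (l ++ [false]) = bval l := by
  induction l with
  | nil => rfl
  | cons b l ih => simp [bval, ih]

end Digits

section Sweeps

variable {S : Type u} {G : Type v} {s g : ℕ} (eS : S → Fin s) (eG : Fin g → G) (body : Prog)
  (pub₀ : List (Fin g))

local notation "PP" => sweeper eS eG body pub₀

/-- The symbol for a letter of the datum. -/
def enc (x : Option S × Option (MCell s g body.bound body.Loc)) : Option (Sym s) :=
  x.1.map fun a => some (eS a)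

/-- Letter `i` goes to the work tape as long as the head is off the marker, which means `i <
T.head`; the later letters survive on the base tape. -/
theorem runFst_left (gl : Glob g s body.Loc) (hgl : gl.left = true) :
    ∀ (l : List (Option S × Option (MCell s g body.bound body.Loc)))
      (q : QState s g body.Loc) (T : Tape (Option (WCell s))), q.gl = some gl →
      view ((PP).runFst q T l).2.1 =
        goLeft (view T) l.length (fun i => (l[i]?).bind (enc eS body)) ∧
      ∀ i : ℕ, (((PP).runFst q T l).2.2[i]?).bind Prod.fst =
        if T.head ≤ i then (l[i]?).bind (enc eS body) else none := by
  intro l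
  induction l with
  | nil => intro q T _; simp [runFst, goLeft_zero]
  | cons x l ih =>
    intro q T hq
    have hgl' : q.gl.getD (x.2.getD (cell₀ body)).glob = gl := by simp [hq]
    by_cases h0 : T.head = 0
    · have hact : act T (fstCell eS body q x T.read).2.2 = T := by
        rw [act_marker h0]
        simp [fstCell, hgl', track, hgl, read_isNone, h0, Tape.move]
      obtain ⟨h1, h2⟩ := ih (fstCell eS body q x T.read).1 T (by simp [fstCell, hgl'])
      simp only [runFst]
      rw [hact]
      refine ⟨?_, ?_⟩
      · rw [h1, goLeft_marker h0, goLeft_marker h0]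
      · intro i
        cases i with
        | zero => simp [fstCell, hgl', hgl, read_isNone, h0, enc]
        | succ i => simpa [h0] using h2 i
    · have hact : view (act T (fstCell eS body q x T.read).2.2) =
          act (view T) (((view T).cell ((view T).head - 1)).setLb (enc eS body x), .left) := by
        have : (fstCell eS body q x T.read).2.2 = (some ((rd T.read).setLb (enc eS body x)), .left) := by
          simp [fstCell, hgl', track, hgl, read_isNone, h0, enc]
        rw [this, view_act, rd_read h0]
        rfl
      have hhead : (act T (fstCell eS body q x T.read).2.2).head = T.head - 1 := by
        have := congrArg Tape.head hact
        simp only [view] at this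
        rw [this]
        obtain ⟨h, f⟩ := T
        cases h <;> simp [act, Tape.write, Tape.move]
      obtain ⟨h1, h2⟩ := ih (fstCell eS body q x T.read).1 _ (by simp [fstCell, hgl'])
      simp only [runFst]
      refine ⟨?_, ?_⟩
      · rw [h1, hact, List.length_cons, ← goLeft_succ (view T) h0 l.length
          (fun i => ((x :: l)[i]?).bind (enc eS body))]
        simp
      · intro i
        cases i with
        | zero => simp [fstCell, hgl', read_isNone, h0]
        | succ i =>
          have := h2 i
          rw [hhead] at this
          simp only [List.getElem?_cons_succ]
          rw [this]
          by_cases h3 : T.head ≤ i + 1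
          · rw [if_pos (by omega), if_pos h3]
          · rw [if_neg (by omega), if_neg h3]

theorem runFst_right (gl : Glob g s body.Loc) (hgl : gl.left = false) :
    ∀ (l : List (Option S × Option (MCell s g body.bound body.Loc)))
      (q : QState s g body.Loc) (T : Tape (Option (WCell s))), q.gl = some gl → T.head ≠ 0 →
      view ((PP).runFst q T l).2.1 =
        goRight (view T) l.length (fun i => (l[i]?).bind (enc eS body)) := by
  intro l
  induction l with
  | nil => intro q T _; simp [runFst, goRight_zero]
  | cons x l ih =>
    intro q T hq h0
    have hgl' : q.gl.getD (x.2.getD (cell₀ body)).glob = gl := by simp [hq]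
    have hact : view (act T (fstCell eS body q x T.read).2.2) =
        act (view T) (((view T).cell ((view T).head - 1)).push (enc eS body x), .right) := by
      have : (fstCell eS body q x T.read).2.2 = (some ((rd T.read).push (enc eS body x)), .right) := by
        simp [fstCell, hgl', track, hgl, enc]
      rw [this, view_act, rd_read h0]
      rfl
    have hhead : (act T (fstCell eS body q x T.read).2.2).head ≠ 0 := by
      have := congrArg Tape.head hact
      simp only [view] at this
      rw [this]
      simp [act, Tape.move]
    have h1 := ih (fstCell eS body q x T.read).1 _ (by simp [fstCell, hgl']) hhead
    simp only [runFst]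
    rw [h1, hact, List.length_cons, ← goRight_succ (view T) h0 l.length
      (fun i => ((x :: l)[i]?).bind (enc eS body))]
    simp

/-- Counter, cores and carry do not depend on the direction or on the work tape, so one statement
covers all kinds of cycles. -/
theorem runFst_state (gl : Glob g s body.Loc) :
    ∀ (l : List (Option S × Option (MCell s g body.bound body.Loc)))
      (q : QState s g body.Loc) (T : Tape (Option (WCell s))), q.gl = some gl →
      ((PP).runFst q T l).1 = { q with carry := q.carry &&
        (l.filterMap fun x => (x.2.getD (cell₀ body)).dig).all id } ∧
      (((PP).runFst q T l).2.2.map fun a => a.2.core) =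
        l.map (fun x => (x.2.getD (cell₀ body)).core) ∧
      (((PP).runFst q T l).2.2.filterMap fun a => a.2.dig) =
        incr q.carry (l.filterMap fun x => (x.2.getD (cell₀ body)).dig) := by
  intro l
  induction l with
  | nil => intro q T _; simp [runFst, incr]
  | cons x l ih =>
    intro q T hq
    have hgl' : q.gl.getD (x.2.getD (cell₀ body)).glob = gl := by simp [hq]
    obtain ⟨h1, h2, h3⟩ := ih (fstCell eS body q x T.read).1
      (act T (fstCell eS body q x T.read).2.2) (by simp [fstCell, hgl'])
    simp only [runFst]
    refine ⟨?_, ?_, ?_⟩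
    · rw [h1]
      rcases hd : (x.2.getD (cell₀ body)).dig with _ | b <;>
        simp [fstCell, hq, hd, Bool.and_assoc]
    · simp only [List.map_cons]
      rw [h2]
      simp [fstCell]
    · simp only [List.filterMap_cons]
      rw [h3]
      rcases hd : (x.2.getD (cell₀ body)).dig with _ | b <;> simp [fstCell, hd, incr]

theorem runSnd_idle (q : QState s g body.Loc) (hl : q.kind ≠ .load) (ho : q.kind ≠ .op)
    (T : Tape (Option (WCell s))) (l : List (Option (Sym s) × MCell s g body.bound body.Loc)) :
    (PP).runSnd q T l = (q, T, l) := by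
  induction l with
  | nil => rfl
  | cons x l ih =>
    have : sndCell body q x T.read = (q, x, T.read.getD none, .stay) := by
      simp only [sndCell]
    simp only [runSnd]
    rw [this]
    simp only [act_stay]
    rw [ih]

/-- Loading and writing share a single pass: the two old tracks of a cell are read before
`WCell.push` overwrites them. -/
theorem runSnd_load :
    ∀ (l : List (Option (Sym s) × MCell s g body.bound body.Loc)) (q : QState s g body.Loc)
      (_ : q.kind = .load) (T : Tape (Option (WCell s))), T.head ≠ 0 →
      ((PP).runSnd q T l).1 = q ∧
      view ((PP).runSnd q T l).2.1 = goRight (view T) l.length (fun i => (l[i]?).bind Prod.fst) ∧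
      ((PP).runSnd q T l).2.2 = l.mapIdx fun i a => (none, { a.2 with
        core := { a.2.core with
          ldR := ((view T).cell (T.head - 1 + i)).ra
          ldL := ((view T).cell (T.head - 1 + i)).la } }) := by
  intro l
  induction l with
  | nil => intro q _ T _; simp [runSnd, goRight_zero]
  | cons x l ih =>
    intro q hq T h0
    have hcell : sndCell body q x T.read = (q, (none, { x.2 with core := { x.2.core with
        ldR := (rd T.read).ra, ldL := (rd T.read).la } }), some ((rd T.read).push x.1), .right) := by
      simp only [sndCell, hq]
    have hact : view (act T (some ((rd T.read).push x.1), .right)) =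
        act (view T) (((view T).cell ((view T).head - 1)).push x.1, .right) := by
      rw [view_act, rd_read h0]
      rfl
    have hhead : (act T (some ((rd T.read).push x.1), .right)).head = T.head + 1 := by
      have := congrArg Tape.head hact
      simp only [view] at this
      rw [this]
      obtain ⟨h, f⟩ := T
      cases h <;> simp [act, Tape.write, Tape.move]
    obtain ⟨h1, h2, h3⟩ := ih q hq _ (by rw [hhead]; omega)
    simp only [runSnd]
    rw [hcell]
    refine ⟨h1, ?_, ?_⟩
    · rw [h2, hact, List.length_cons, ← goRight_succ (view T) h0 l.length (fun i => ((x :: l)[i]?).bind Prod.fst)]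
      simp
    · rw [h3, hact, hhead, List.mapIdx_cons, rd_read h0]
      simp only [add_zero, List.cons.injEq, true_and]
      congr 1
      funext i a
      obtain ⟨h, f⟩ := T
      obtain ⟨h, rfl⟩ := Nat.exists_eq_succ_of_ne_zero h0
      have e1 : h + 1 + 1 - 1 + i = h + 1 - 1 + (i + 1) := by omega
      have : ∀ c, (act (view (⟨h + 1, f⟩ : Tape (Option (WCell s)))) (c, .right)).cell
          (h + 1 + 1 - 1 + i) =
          (view (⟨h + 1, f⟩ : Tape (Option (WCell s)))).cell (h + 1 - 1 + (i + 1)) := by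
        intro c
        rw [e1]
        simp only [act, Tape.write, Tape.move, view]
        rw [Function.update_of_ne (by omega)]
      simp only [this]

end Sweeps

end Machine

end LinLearn


/-! ### Memory cells as a representation of the store -/

namespace LinLearn

universe u v

open Sweeper

namespace Core

variable {s g R : ℕ}

theorem getReg_setReg {r : ℕ} (hr : r < R) (r' : ℕ) (b : Bool) (c : Core s g R) :
    (c.setReg r b).getReg r' = if r' = r then b else c.getReg r' := by
  unfold getReg setReg
  by_cases h : r' < R
  · rw [dif_pos h, dif_pos h, dif_pos hr]
    simp [Function.update_apply]
  · rw [dif_neg h, dif_neg h, if_neg (by omega)]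

@[simp] theorem setReg_ldR (r : ℕ) (b : Bool) (c : Core s g R) : (c.setReg r b).ldR = c.ldR := by
  unfold setReg; split_ifs <;> rfl
@[simp] theorem setReg_ldL (r : ℕ) (b : Bool) (c : Core s g R) : (c.setReg r b).ldL = c.ldL := by
  unfold setReg; split_ifs <;> rfl
@[simp] theorem setReg_build (r : ℕ) (b : Bool) (c : Core s g R) :
    (c.setReg r b).build = c.build := by
  unfold setReg; split_ifs <;> rfl
@[simp] theorem setReg_pub (r : ℕ) (b : Bool) (c : Core s g R) : (c.setReg r b).pub = c.pub := by
  unfold setReg; split_ifs <;> rfl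

theorem getReg_empty (r : ℕ) : (empty : Core s g R).getReg r = false := by
  unfold getReg empty; split_ifs <;> rfl

end Core

/-- A list of optional letters consists of a word followed by empty places. -/
def Holds {A : Type} (l : List (Option A)) (x : List A) : Prop :=
  ∃ n, l = x.map some ++ List.replicate n none

theorem Holds.append_none {A : Type} {l : List (Option A)} {x : List A} (h : Holds l x) (n : ℕ) :
    Holds (l ++ List.replicate n none) x := by
  obtain ⟨m, rfl⟩ := h
  exact ⟨m + n, by simp⟩

theorem Holds.getElem? {A : Type} {l : List (Option A)} {x : List A} (h : Holds l x) (i : ℕ) :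
    (l[i]?).bind id = x[i]? := by
  obtain ⟨n, rfl⟩ := h
  rw [List.getElem?_append]
  split_ifs with hi
  · rw [List.getElem?_map]
    cases x[i]? <;> rfl
  · rw [List.getElem?_eq_none (l := x) (by simpa using hi), List.getElem?_replicate]
    split_ifs <;> rfl

/-- By `h₁` the place filled is the first empty one, hence the one directly behind the word. -/
theorem Holds.concat {A : Type} {l₁ l₂ : List (Option A)} {x : List A}
    (h : Holds (l₁ ++ none :: l₂) x) (h₁ : ∀ a ∈ l₁, a ≠ none) (a : A) :
    Holds (l₁ ++ some a :: l₂) (x ++ [a]) := by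
  induction x generalizing l₁ with
  | nil =>
    obtain ⟨n, hn⟩ := h
    cases l₁ with
    | nil =>
      cases n with
      | zero => simp at hn
      | succ n =>
        simp only [List.nil_append, List.map_nil, List.replicate_succ, List.cons.injEq,
          true_and] at hn
        exact ⟨n, by simp [hn]⟩
    | cons b l₁ =>
      exfalso
      cases n with
      | zero => simp at hn
      | succ n =>
        simp only [List.map_nil, List.nil_append, List.replicate_succ, List.cons_append,
          List.cons.injEq] at hn
        exact h₁ b (by simp) hn.1
  | cons y x ih =>
    obtain ⟨n, hn⟩ := h
    cases l₁ with
    | nil => simp at hn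
    | cons b l₁ =>
      simp only [List.cons_append, List.map_cons, List.cons.injEq] at hn
      obtain ⟨m, hm⟩ := ih ⟨n, hn.2⟩ fun a ha => h₁ a (by simp [ha])
      exact ⟨m, by rw [List.cons_append, hm, hn.1]; simp⟩

/-- The cells `cs` represent the store `σ`. -/
structure RepCore {s g R : ℕ} (cs : List (Core s g R)) (σ : Store s g) : Prop where
  reg : ∀ r < R, cs.countP (Core.getReg r) = σ.reg r
  load : cs.filterMap Core.ldR ++ (cs.filterMap Core.ldL).reverse = σ.load
  build : Holds (cs.map Core.build) σ.build
  pub : Holds (cs.map Core.pub) σ.pub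

/-- The memory may be lengthened at any time, be it by a long datum or by an overflow. -/
theorem RepCore.append_empty {s g R : ℕ} {cs : List (Core s g R)} {σ : Store s g}
    (h : RepCore cs σ) (n : ℕ) : RepCore (cs ++ List.replicate n Core.empty) σ where
  reg r hr := by
    rw [List.countP_append, h.reg r hr, List.countP_replicate, Core.getReg_empty]
    simp
  load := by
    rw [← h.load]
    simp [Core.empty, List.filterMap_replicate_of_none]
  build := by
    have := h.build.append_none n
    simpa [Core.empty] using this
  pub := by
    have := h.pub.append_none n
    simpa [Core.empty] using this

namespace Machine

variable {s g R : ℕ} {L : Type}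

/-- The effect of an instruction on the cells. -/
inductive Edits (gl : Glob g s L) (i : Instr) :
    List (Core s g R) → Bool → Option (Sym s) → List (Core s g R) → Prop
  | none {cs : List (Core s g R)} (hi : once i = true) (h : ∀ c ∈ cs, applies gl i c = false) :
      Edits gl i cs false Option.none cs
  | one {cs₁ cs₂ : List (Core s g R)} {c : Core s g R} (hi : once i = true)
      (h : ∀ c ∈ cs₁, applies gl i c = false) (hc : applies gl i c = true) :
      Edits gl i (cs₁ ++ c :: cs₂) true c.ldR (cs₁ ++ edit gl i c :: cs₂)
  | all {cs : List (Core s g R)} (hi : once i = false) (f : Bool) (a : Option (Sym s)) :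
      Edits gl i cs f a (cs.map (edit gl i))

/-- The last symbol on the left track is removed. -/
inductive Grabs : List (Core s g R) → Option (Sym s) → List (Core s g R) → Prop
  | none {cs : List (Core s g R)} (h : ∀ c ∈ cs, c.ldL = Option.none) : Grabs cs Option.none cs
  | one {cs₁ cs₂ : List (Core s g R)} {c : Core s g R} {a : Sym s}
      (h : ∀ c ∈ cs₂, c.ldL = Option.none) (hc : c.ldL = some a) :
      Grabs (cs₁ ++ c :: cs₂) (some a) (cs₁ ++ { c with ldL := Option.none } :: cs₂)

/-- The new control information after the symbol `a` has been grabbed. -/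
def grabGlob (gl : Glob g s L) (a : Option (Sym s)) : Glob g s L :=
  { gl with letter := a.elim gl.letter Sym.code }

theorem countP_eq_zero_of {cs : List (Core s g R)} {p : Core s g R → Bool}
    (h : ∀ c ∈ cs, p c = false) : cs.countP p = 0 :=
  List.countP_eq_zero.2 fun c hc => by simp [h c hc]

theorem filterMap_eq_nil_of {A B : Type} {f : A → Option B} {l : List A}
    (h : ∀ a ∈ l, f a = none) : l.filterMap f = [] :=
  List.filterMap_eq_nil_iff.2 h

variable {body : Prog}

/-- Setting one mark. -/
theorem RepCore.set_one {cs₁ cs₂ : List (Core s g R)} {c : Core s g R} {σ : Store s g}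
    (h : RepCore (cs₁ ++ c :: cs₂) σ) {r : ℕ} (hr : r < R) (b : Bool)
    (v : ℕ) (hv : v + (c.getReg r).toNat = σ.reg r + b.toNat) :
    RepCore (cs₁ ++ c.setReg r b :: cs₂) (σ.setReg (Function.update σ.reg r v)) where
  reg r' hr' := by
    have := h.reg r' hr'
    simp only [List.countP_append, List.countP_cons, Core.getReg_setReg hr, Store.setReg_reg,
      Function.update_apply] at this ⊢
    by_cases e : r' = r
    · subst e
      rw [if_pos rfl, if_pos rfl]
      cases b <;> cases hc : c.getReg r' <;> simp [hc] at this hv ⊢ <;> omega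
    · rw [if_neg e, if_neg e, this]
  load := by simpa [List.filterMap_cons, Store.setReg] using h.load
  build := by simpa [Store.setReg] using h.build
  pub := by simpa [Store.setReg] using h.pub

/-- The empty cell at the end, present because of the overflow, guarantees that `inc`, `unload` and
`push` find a free place; this is why unary registers of unbounded value can be simulated. The
length `cs.length + 1` is the value written by `fill`. -/
theorem RepCore.exec {gl : Glob g s body.Loc} {cs cs' cs'' : List (Core s g body.bound)}
    {σ : Store s g} (h : RepCore (cs ++ [Core.empty]) σ) (hl : gl.letter = σ.letter)
    (hp : gl.pend = σ.pend) {flag : Bool} {sym y : Option (Sym s)}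
    (hE : Edits gl (body.instr gl.loc) (cs ++ [Core.empty]) flag sym cs')
    (hG : if body.instr gl.loc = .act .fetch ∧ flag = false then Grabs cs' y cs''
      else y = none ∧ cs'' = cs') :
    RepCore cs'' ((body.instr gl.loc).exec (cs.length + 1) σ).1 ∧
      grabGlob (nextGlob gl flag sym) y =
        ⟨(body.next gl.loc ((body.instr gl.loc).exec (cs.length + 1) σ).2).getD body.entry,
          (match body.instr gl.loc with | .act .turn => σ.load.isEmpty | _ => gl.left),
          ((body.instr gl.loc).exec (cs.length + 1) σ).1.letter,
          ((body.instr gl.loc).exec (cs.length + 1) σ).1.pend⟩ := by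
  have hb := body.instr_below gl.loc
  have hmem : Core.empty ∈ cs ++ [(Core.empty : Core s g body.bound)] := by simp
  have hlen : (cs ++ [(Core.empty : Core s g body.bound)]).length = cs.length + 1 := by simp
  generalize cs ++ [(Core.empty : Core s g body.bound)] = ds at *
  rcases hi : body.instr gl.loc with a | r
  · rw [hi] at hE hG hb
    cases a with
    | nop =>
      simp only [Instr.act.injEq, reduceCtorEq, false_and, if_false] at hG
      obtain ⟨rfl, rfl⟩ := hG
      cases hE with
      | none => exact ⟨h, by simp [grabGlob, nextGlob, hi, Instr.exec, Store.act, hl, hp]⟩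
      | one _ _ hc => simp [applies] at hc
      | all hi => simp [once] at hi
    | tick =>
      simp only [Instr.act.injEq, reduceCtorEq, false_and, if_false] at hG
      obtain ⟨rfl, rfl⟩ := hG
      cases hE with
      | none =>
        exact ⟨⟨h.reg, h.load, h.build, h.pub⟩,
          by simp [grabGlob, nextGlob, hi, Instr.exec, Store.act, hl, hp]⟩
      | one _ _ hc => simp [applies] at hc
      | all hi => simp [once] at hi
    | inc r =>
      simp only [Instr.act.injEq, reduceCtorEq, false_and, if_false] at hG
      obtain ⟨rfl, rfl⟩ := hG
      cases hE with
      | none _ hn =>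
        have := hn _ hmem
        simp [applies, Core.getReg_empty] at this
      | one _ _ hc =>
        refine ⟨?_, by simp [grabGlob, nextGlob, hi, Instr.exec, Store.act, hl, hp, Store.setReg]⟩
        simp only [applies, Bool.not_eq_eq_eq_not, Bool.not_true] at hc
        exact RepCore.set_one h hb true _ (by simp [hc])
      | all hi => simp [once] at hi
    | unload r =>
      simp only [Instr.act.injEq, reduceCtorEq, false_and, if_false] at hG
      obtain ⟨rfl, rfl⟩ := hG
      cases hE with
      | none _ hn =>
        have := hn _ hmem
        have h0 : σ.letter = 0 := by simpa [applies, Core.getReg_empty, hl] using this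
        refine ⟨?_, ?_⟩
        · simpa [Instr.exec, Store.act, h0] using h
        · simp [grabGlob, nextGlob, hi, Instr.exec, Store.act, hl, hp, h0]
      | one _ _ hc =>
        have h0 : σ.letter ≠ 0 := by
          intro h0
          simp [applies, hl, h0] at hc
        simp only [applies, Bool.and_eq_true, Bool.not_eq_eq_eq_not, Bool.not_true] at hc
        have h1 := RepCore.set_one h hb true (σ.reg r + 1) (by simp [hc.2])
        refine ⟨?_, ?_⟩
        · simp only [Instr.exec, Store.act, if_neg h0]
          exact ⟨h1.reg, h1.load, h1.build, h1.pub⟩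
        · simp [grabGlob, nextGlob, hi, Instr.exec, Store.act, hl, hp, h0]
      | all hi => simp [once] at hi
    | push =>
      simp only [Instr.act.injEq, reduceCtorEq, false_and, if_false] at hG
      obtain ⟨rfl, rfl⟩ := hG
      cases hE with
      | none _ hn =>
        have := hn _ hmem
        have h0 : σ.pend = 0 := by simpa [applies, Core.empty, hp] using this
        refine ⟨?_, ?_⟩
        · simpa [Instr.exec, Store.act, h0] using h
        · simp [grabGlob, nextGlob, hi, Instr.exec, Store.act, hl, h0]
      | @one cs₁ cs₂ c _ h1 hc =>
        have h0 : σ.pend ≠ 0 := by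
          intro h0
          simp [applies, hp, h0] at hc
        simp only [applies, Bool.and_eq_true, Option.isNone_iff_eq_none] at hc
        refine ⟨?_, ?_⟩
        · simp only [Instr.exec, Store.act, dif_neg h0, edit, dif_neg (hp ▸ h0)]
          refine ⟨?_, ?_, ?_, ?_⟩
          · intro r hr
            rw [← h.reg r hr]
            simp [List.countP_cons, Core.getReg]
          · rw [← h.load]
            simp [List.filterMap_cons]
          · have hb := h.build
            simp only [List.map_append, List.map_cons, hc.2] at hb ⊢
            have e : gl.pend.pred (hp ▸ h0) = σ.pend.pred h0 := by
              simp only [hp]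
            rw [e]
            refine hb.concat ?_ _
            intro a ha
            obtain ⟨d, hd, rfl⟩ := List.mem_map.1 ha
            have := h1 d hd
            simpa [applies, hp, h0, Option.isSome_iff_ne_none] using this
          · simpa using h.pub
        · simp [grabGlob, nextGlob, hi, Instr.exec, Store.act, hl, h0]
      | all hi => simp [once] at hi
    | publish =>
      simp only [Instr.act.injEq, reduceCtorEq, false_and, if_false] at hG
      obtain ⟨rfl, rfl⟩ := hG
      cases hE with
      | none hi => simp [once] at hi
      | one hi => simp [once] at hi
      | all _ f a =>
        refine ⟨⟨?_, ?_, ?_, ?_⟩, by simp [grabGlob, nextGlob, hi, Instr.exec, Store.act, hl, hp]⟩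
        · intro r hr
          rw [List.countP_map]
          exact h.reg r hr
        · simp only [Instr.exec, Store.act]
          rw [← h.load, List.filterMap_map, List.filterMap_map]
          rfl
        · refine ⟨ds.length, ?_⟩
          rw [List.map_map]
          simp only [Instr.exec, Store.act, List.map_nil, List.nil_append]
          refine List.eq_replicate_iff.2 ⟨by simp, ?_⟩
          intro b hb
          obtain ⟨c, -, rfl⟩ := List.mem_map.1 hb
          rfl
        · rw [List.map_map]
          exact h.build
    | fill r =>
      simp only [Instr.act.injEq, reduceCtorEq, false_and, if_false] at hG
      obtain ⟨rfl, rfl⟩ := hG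
      cases hE with
      | none hi => simp [once] at hi
      | one hi => simp [once] at hi
      | all _ f a =>
        refine ⟨⟨?_, ?_, ?_, ?_⟩,
          by simp [grabGlob, nextGlob, hi, Instr.exec, Store.act, hl, hp, Store.setReg]⟩
        · intro r' hr'
          rw [List.countP_map]
          simp only [Instr.exec, Store.act, Store.setReg_reg, Function.update_apply]
          split_ifs with e
          · subst e
            rw [← hlen, List.countP_eq_length]
            intro c _
            simp [edit, Core.getReg_setReg hr']
          · rw [← h.reg r' hr']
            congr 1
            funext c
            simp [edit, Core.getReg_setReg (show r < _ from hb), e]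
        · simp only [Instr.exec, Store.act, Store.setReg]
          rw [← h.load, List.filterMap_map, List.filterMap_map]
          simp only [Function.comp_def, edit, Core.setReg_ldR, Core.setReg_ldL]
        · rw [List.map_map]
          simp only [Function.comp_def, edit, Core.setReg_build]
          exact h.build
        · rw [List.map_map]
          simp only [Function.comp_def, edit, Core.setReg_pub]
          exact h.pub
    | fetch =>
      cases hE with
      | none _ hn =>
        rw [if_pos ⟨rfl, rfl⟩] at hG
        -- Nothing is left on `ldR`, so the queue is the reversal of `ldL` and its first symbol is
        -- the last one on that track.
        have h0 : cs'.filterMap Core.ldR = [] :=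
          filterMap_eq_nil_of fun c hc => by simpa [applies] using hn c hc
        have hld := h.load
        rw [h0, List.nil_append] at hld
        cases hG with
        | none hn' =>
          rw [filterMap_eq_nil_of hn', List.reverse_nil] at hld
          refine ⟨⟨?_, ?_, ?_, ?_⟩, ?_⟩
          · simpa [Instr.exec, Store.act, ← hld] using h.reg
          · simpa [Instr.exec, Store.act, ← hld] using h.load
          · simpa [Instr.exec, Store.act, ← hld] using h.build
          · simpa [Instr.exec, Store.act, ← hld] using h.pub
          · simp [grabGlob, nextGlob, hi, Instr.exec, Store.act, ← hld, hp]
        | @one cs₁ cs₂ c a hn' hc =>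
          simp only [List.filterMap_append, List.filterMap_cons, hc, List.append_eq_nil_iff] at hld h0
          rw [filterMap_eq_nil_of hn'] at hld
          simp only [List.reverse_append, List.reverse_cons, List.reverse_nil, List.nil_append,
            List.singleton_append] at hld
          refine ⟨⟨?_, ?_, ?_, ?_⟩, ?_⟩
          · intro r hr
            have := h.reg r hr
            simp only [Instr.exec, Store.act, ← hld]
            rw [← this]
            simp [List.countP_cons, Core.getReg]
          · simp only [Instr.exec, Store.act, ← hld]
            simp [List.filterMap_append, List.filterMap_cons, h0.1, filterMap_eq_nil_of hn']
            cases hR : c.ldR <;> simp [hR] at h0 ⊢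
            exact fun c hc => by simpa using h0.2 c hc
          · simpa [Instr.exec, Store.act, ← hld] using h.build
          · simpa [Instr.exec, Store.act, ← hld] using h.pub
          · simp [grabGlob, nextGlob, hi, Instr.exec, Store.act, ← hld, hp]
      | @one cs₁ cs₂ c _ h1 hc =>
        simp only [Bool.true_eq_false, and_false, if_false] at hG
        obtain ⟨rfl, rfl⟩ := hG
        simp only [applies] at hc
        obtain ⟨a, ha⟩ := Option.isSome_iff_exists.1 hc
        have h0 : cs₁.filterMap Core.ldR = [] :=
          filterMap_eq_nil_of fun c hc => by simpa [applies] using h1 c hc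
        have hld := h.load
        simp only [List.filterMap_append, List.filterMap_cons, ha, h0, List.nil_append,
          List.cons_append] at hld
        refine ⟨⟨?_, ?_, ?_, ?_⟩, ?_⟩
        · intro r hr
          have := h.reg r hr
          simp only [Instr.exec, Store.act, ← hld]
          rw [← this]
          simp [List.countP_cons, Core.getReg, edit]
        · simp only [Instr.exec, Store.act, ← hld, edit]
          simp [List.filterMap_append, List.filterMap_cons, h0]
        · simpa [Instr.exec, Store.act, ← hld, edit] using h.build
        · simpa [Instr.exec, Store.act, ← hld, edit] using h.pub
        · simp [grabGlob, nextGlob, hi, Instr.exec, Store.act, ← hld, hp, ha]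
      | all hi => simp [once] at hi
    | turn =>
      simp only [Instr.act.injEq, reduceCtorEq, false_and, if_false] at hG
      obtain ⟨rfl, rfl⟩ := hG
      cases hE with
      | none _ hn =>
        refine ⟨h, ?_⟩
        -- The flag stays unset exactly if both loaded tracks are empty, which is the condition for
        -- changing the direction.
        have h0 : σ.load = [] := by
          rw [← h.load, filterMap_eq_nil_of, filterMap_eq_nil_of]
          · rfl
          · intro c hc
            have := hn c hc
            simp only [applies, Bool.or_eq_false_iff] at this
            simpa using this.2
          · intro c hc
            have := hn c hc
            simp only [applies, Bool.or_eq_false_iff] at this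
            simpa using this.1
        simp [grabGlob, nextGlob, hi, Instr.exec, Store.act, hl, hp, h0]
      | @one cs₁ cs₂ c _ h1 hc =>
        refine ⟨h, ?_⟩
        have h0 : σ.load ≠ [] := by
          rw [← h.load]
          intro h2
          simp only [List.append_eq_nil_iff, List.reverse_eq_nil_iff,
            List.filterMap_eq_nil_iff] at h2
          simp [applies, h2.1 c (by simp), h2.2 c (by simp)] at hc
        simp [grabGlob, nextGlob, hi, Instr.exec, Store.act, hl, hp, h0]
      | all hi => simp [once] at hi
  · rw [hi] at hE hG hb
    simp only [reduceCtorEq, false_and, if_false] at hG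
    obtain ⟨rfl, rfl⟩ := hG
    cases hE with
    | none _ hn =>
      have h0 : σ.reg r = 0 := by
        rw [← h.reg r hb]
        exact countP_eq_zero_of fun c hc => by simpa [applies] using hn c hc
      refine ⟨?_, ?_⟩
      · simpa [Instr.exec, h0] using h
      · simp [grabGlob, nextGlob, hi, Instr.exec, hl, hp, h0]
    | @one cs₁ cs₂ c _ h1 hc =>
      simp only [applies] at hc
      have h0 : σ.reg r ≠ 0 := by
        rw [← h.reg r hb]
        simp [hc]
      refine ⟨?_, ?_⟩
      · simp only [Instr.exec, if_neg h0]
        exact RepCore.set_one h hb false _ (by simp [hc]; omega)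
      · simp [grabGlob, nextGlob, hi, Instr.exec, hl, hp, h0, Store.setReg]
    | all hi => simp [once] at hi

end Machine

end LinLearn


/-! ### The abstract state and its simulation by the machine -/

namespace LinLearn

universe u v

open Sweeper

/-- The abstract state of the machine: control location and direction, store, length of the base
tape, work tape. -/
structure Abs (s g : ℕ) (body : Prog) where
  loc : body.Loc
  left : Bool
  store : Store s g
  len : ℕ
  tape : Tape (WCell s)

/-- The symbols written on the work tape in a cycle with `n` cells on the base tape: the letters of
the datum, and at the end the end marker of the word. -/
def inp {s : ℕ} (x : List (Fin s)) (n i : ℕ) : Option (Sym s) :=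
  if i = n then some none else (x[i]?).map some

namespace Abs

variable {s g : ℕ} {body : Prog}

/-- One instruction is executed. -/
def exec (A : Abs s g body) : Abs s g body :=
  { A with
    loc := (body.next A.loc ((body.instr A.loc).exec A.len A.store).2).getD body.entry
    left := match body.instr A.loc with | .act .turn => A.store.load.isEmpty | _ => A.left
    store := ((body.instr A.loc).exec A.len A.store).1 }

/-- One cycle with datum `x`, in which the counter overflows if `ov` holds. -/
def step (A : Abs s g body) (x : List (Fin s)) (ov : Bool) : Abs s g body :=
  let n := max x.length A.len
  let len' := n + ov.toNat
  if A.left then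
    if n < A.tape.head then { A with tape := Machine.goLeft A.tape (n + 1) (inp x n), len := len' }
    else
      let T := Machine.goLeft A.tape n (inp x n)
      { A with
        left := false
        len := len'
        -- Chronological order: the way out from left to right, then the way back from right to
        -- left. Only the first `len'` cells are seen.
        store := { A.store with load := (List.range len').filterMap (fun i => (T.cell i).ra) ++
          ((List.range len').filterMap fun i => (T.cell i).la).reverse }
        tape := Machine.goRight ⟨1, T.cell⟩ (len' + 1) fun i =>
          -- The letters before index `A.tape.head` were written on the way to the left; the others
          -- are written now, and the end marker comes behind the last cell.
          if i = len' then some none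
          else if A.tape.head ≤ i ∧ i < n then inp x n i else none }
  else
    let B : Abs s g body := { A with tape := Machine.goRight A.tape (n + 1) (inp x n), len := len' }
    if ov then B.exec else B

end Abs

theorem goRight_congr {s : ℕ} (T : Tape (WCell s)) (n : ℕ) {a b : ℕ → Option (Sym s)}
    (h : ∀ i < n, a i = b i) : Machine.goRight T n a = Machine.goRight T n b := by
  refine Machine.tape_ext rfl fun i => ?_
  simp only [Machine.goRight]
  by_cases hi : T.head ≤ i + 1 ∧ i + 1 < T.head + n
  · rw [if_pos hi, if_pos hi, h _ (by omega)]
  · rw [if_neg hi, if_neg hi]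

theorem goLeft_congr {s : ℕ} (T : Tape (WCell s)) (n : ℕ) {a b : ℕ → Option (Sym s)}
    (h : ∀ i < n, a i = b i) : Machine.goLeft T n a = Machine.goLeft T n b := by
  refine Machine.tape_ext rfl fun i => ?_
  simp only [Machine.goLeft]
  by_cases hi : i < T.head ∧ T.head ≤ i + n
  · rw [if_pos hi, if_pos hi, h _ (by omega)]
  · rw [if_neg hi, if_neg hi]

/-- Where the datum is longer than the memory, the sweep treats the padding as fresh empty cells, so
the memory grows to the length of the datum. -/
theorem conv_map_getD {A : Type u} {B : Type v} (x : List A) (m : List B) (d : B) :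
    ((conv x m).map fun p => p.2.getD d) =
      m ++ List.replicate (max x.length m.length - m.length) d := by
  apply List.ext_getElem?
  intro i
  rw [List.getElem?_map, conv_getElem?, List.getElem?_append]
  by_cases h1 : i < m.length
  · rw [if_pos (by omega), if_pos h1, List.getElem?_eq_getElem h1]
    rfl
  · rw [if_neg h1, List.getElem?_replicate]
    by_cases h2 : i < max x.length m.length
    · rw [if_pos h2, if_pos (by omega), List.getElem?_eq_none (l := m) (by omega)]
      rfl
    · rw [if_neg h2, if_neg (by omega)]
      rfl

namespace Machine

variable {S : Type u} {G : Type v} {s g : ℕ} (eS : S → Fin s) (eG : Fin g → G) (body : Prog)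
  (pub₀ : List (Fin g))

local notation "PP" => sweeper eS eG body pub₀

/-- The memory `m` and the work tape `T` represent the abstract state `A`. -/
structure Rep {body : Prog} (m : List (MCell s g body.bound body.Loc))
    (T : Tape (Option (WCell s))) (A : Abs s g body) : Prop where
  glob : ∃ c m', m = c :: m' ∧ c.glob = ⟨A.loc, A.left, A.store.letter, A.store.pend⟩
  core : RepCore (m.map MCell.core) A.store
  len : m.length = A.len
  tape : view T = A.tape
  -- On the marker a symbol to be written would be lost.
  head : A.left = false → A.tape.head ≠ 0

section First

variable {x : List S} {m : List (MCell s g body.bound body.Loc)} {T : Tape (Option (WCell s))}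

/-- The state in which the first sweep ends. -/
theorem runFst_conv {c : MCell s g body.bound body.Loc} {m' : List (MCell s g body.bound body.Loc)}
    (hm : m = c :: m') :
    (PP).runFst (PP).init T (conv x m) =
      (PP).runFst ⟨some c.glob, true, .idle, false, none⟩ T (conv x m) := by
  subst hm
  have : ∃ a l, conv x (c :: m') = (a, some c) :: l := by
    cases x with
    | nil => exact ⟨_, _, conv_nil_cons _ _⟩
    | cons b x => exact ⟨_, _, conv_cons_cons _ _ _ _⟩
  obtain ⟨a, l, h⟩ := this
  rw [h]
  rfl

theorem enc_conv (i : ℕ) :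
    ((conv x m)[i]?).bind (enc eS body) = ((x.map eS)[i]?).map some := by
  rw [conv_getElem?, List.getElem?_map]
  split_ifs with h
  · cases hx : x[i]? <;> simp [enc]
  · rw [List.getElem?_eq_none (by omega)]
    rfl

theorem inp_of_ne {x : List (Fin s)} {n i : ℕ} (h : i ≠ n) : inp x n i = (x[i]?).map some :=
  if_neg h

theorem inp_self {x : List (Fin s)} {n : ℕ} : inp x n n = some none := if_pos rfl

/-- The cells after the first sweep. -/
theorem afterFst_cells {c : MCell s g body.bound body.Loc}
    {m' : List (MCell s g body.bound body.Loc)} (hm : m = c :: m') :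
    ((PP).afterFst x m T).2.2.map (fun a => a.2.core) = m.map MCell.core ++
        List.replicate (max x.length m.length - m.length +
          ((m.filterMap MCell.dig).all id).toNat) Core.empty ∧
      ((PP).afterFst x m T).2.2.filterMap (fun a => a.2.dig) =
        incr true (m.filterMap MCell.dig) ++
          if (m.filterMap MCell.dig).all id then [false] else [] := by
  have hconv := conv_map_getD x m (cell₀ body)
  have hdig : (conv x m).filterMap (fun p => (p.2.getD (cell₀ body)).dig) =
      m.filterMap MCell.dig := by
    have := congrArg (List.filterMap MCell.dig) hconv
    rw [List.filterMap_map] at this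
    refine this.trans ?_
    rw [List.filterMap_append, filterMap_eq_nil_of (l := List.replicate _ _), List.append_nil]
    intro a ha
    rw [(List.mem_replicate.1 ha).2]
    rfl
  have hcore : (conv x m).map (fun p => (p.2.getD (cell₀ body)).core) =
      m.map MCell.core ++ List.replicate (max x.length m.length - m.length) Core.empty := by
    have := congrArg (List.map MCell.core) hconv
    rw [List.map_map, List.map_append, List.map_replicate] at this
    exact this
  obtain ⟨h1, h2, h3⟩ := runFst_state eS eG body pub₀ c.glob (conv x m)
    ⟨some c.glob, true, .idle, false, none⟩ T rfl
  rw [hdig, Bool.true_and] at h1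
  rw [hcore] at h2
  rw [hdig] at h3
  simp only [afterFst, runFst_conv eS eG body pub₀ hm]
  rw [List.map_append, List.filterMap_append, h2, h3, h1]
  simp only [fstEnd]
  cases (m.filterMap MCell.dig).all id <;> simp [cell₀, List.replicate_succ']

/-- The state after the first sweep. -/
theorem afterFst_state {c : MCell s g body.bound body.Loc}
    {m' : List (MCell s g body.bound body.Loc)} (hm : m = c :: m') :
    ∃ k, ((PP).afterFst x m T).1 =
        ⟨some c.glob, (m.filterMap MCell.dig).all id, k, false, none⟩ ∧
      (c.glob.left = true → max x.length m.length < T.head → k = .idle ∧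
        view ((PP).afterFst x m T).2.1 = goLeft (view T) (max x.length m.length + 1)
          (inp (x.map eS) (max x.length m.length))) ∧
      (c.glob.left = true → T.head ≤ max x.length m.length → k = .load ∧
        view ((PP).afterFst x m T).2.1 = goLeft (view T) (max x.length m.length)
          (inp (x.map eS) (max x.length m.length)) ∧
        ∀ i : ℕ, (((PP).afterFst x m T).2.2[i]?).bind Prod.fst =
          if T.head ≤ i ∧ i < max x.length m.length
            then inp (x.map eS) (max x.length m.length) i else none) ∧
      (c.glob.left = false → T.head ≠ 0 →
        k = (if (m.filterMap MCell.dig).all id then .op else .idle) ∧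
        view ((PP).afterFst x m T).2.1 = goRight (view T) (max x.length m.length + 1)
          (inp (x.map eS) (max x.length m.length))) := by
  have hconv := conv_map_getD x m (cell₀ body)
  have hdig : (conv x m).filterMap (fun p => (p.2.getD (cell₀ body)).dig) =
      m.filterMap MCell.dig := by
    have := congrArg (List.filterMap MCell.dig) hconv
    rw [List.filterMap_map] at this
    refine this.trans ?_
    rw [List.filterMap_append, filterMap_eq_nil_of (l := List.replicate _ _), List.append_nil]
    intro a ha
    rw [(List.mem_replicate.1 ha).2]
    rfl
  have h1 := (runFst_state eS eG body pub₀ c.glob (conv x m)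
    ⟨some c.glob, true, .idle, false, none⟩ T rfl).1
  have hlen := conv_length x m
  rw [hdig, Bool.true_and] at h1
  simp only [afterFst, runFst_conv eS eG body pub₀ hm]
  generalize hr : (PP).runFst ⟨some c.glob, true, .idle, false, none⟩ T (conv x m) = r at h1 ⊢
  generalize hn : max x.length m.length = n at *
  refine ⟨_, by rw [h1]; rfl, fun hl hh => ?_, fun hl hh => ?_, fun hl hh => ?_⟩
  · obtain ⟨h2, -⟩ := runFst_left eS eG body pub₀ c.glob hl (conv x m)
      ⟨some c.glob, true, .idle, false, none⟩ T rfl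
    rw [hr, hlen, goLeft_congr (b := inp (x.map eS) n) _ _ fun i hi => by
      rw [enc_conv, inp_of_ne hi.ne]] at h2
    have hhead : r.2.1.head = T.head - n := congrArg Tape.head h2
    have h0 : r.2.1.head ≠ 0 := by omega
    refine ⟨by simp [hl, read_isNone, h0], ?_⟩
    have he : (fstEnd body r.1 r.2.1.read).2.2 = (some ((rd r.2.1.read).setLb (some none)), .left) := by
      simp [h1, fstEnd, hl, track, read_isNone, h0]
    rw [he, view_act, rd_read h0, ← goLeft_append_one _ _ (by exact hh), ← h2, inp_self]
    rfl
  · obtain ⟨h2, h3⟩ := runFst_left eS eG body pub₀ c.glob hl (conv x m)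
      ⟨some c.glob, true, .idle, false, none⟩ T rfl
    rw [hr, hlen, goLeft_congr (b := inp (x.map eS) n) _ _ fun i hi => by
      rw [enc_conv, inp_of_ne hi.ne]] at h2
    have hhead : r.2.1.head = T.head - n := congrArg Tape.head h2
    have h0 : r.2.1.head = 0 := by omega
    refine ⟨by simp [hl, read_isNone, h0], ?_, ?_⟩
    · have he : (fstEnd body r.1 r.2.1.read).2.2 = (none, .stay) := by
        simp [h1, fstEnd, hl, track, read_isNone, h0]
      rw [he, act_marker h0]
      exact h2
    · intro i
      have h4 := h3 i
      rw [hr, enc_conv] at h4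
      have hrl : r.2.2.length = n := by
        rw [← hr, runFst_length, hlen]
      rw [List.getElem?_append]
      split_ifs with hi hi2 hi2
      · rw [h4, if_pos hi2.1, inp_of_ne hi2.2.ne]
      · rw [h4, if_neg (by omega)]
      · omega
      · rw [h1]
        simp only [fstEnd]
        split_ifs
        · rw [Option.toList_some, List.getElem?_singleton]
          split_ifs <;> rfl
        · rfl
  · have h2 := runFst_right eS eG body pub₀ c.glob hl (conv x m)
      ⟨some c.glob, true, .idle, false, none⟩ T rfl hh
    rw [hr, hlen, goRight_congr (b := inp (x.map eS) n) _ _ fun i hi => by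
      rw [enc_conv, inp_of_ne hi.ne]] at h2
    have hhead : r.2.1.head = T.head + n := congrArg Tape.head h2
    have h0 : r.2.1.head ≠ 0 := by omega
    refine ⟨by simp [hl], ?_⟩
    have he : (fstEnd body r.1 r.2.1.read).2.2 = (some ((rd r.2.1.read).push (some none)), .right) := by
      simp [h1, fstEnd, hl, track]
    rw [he, view_act, rd_read h0, ← goRight_append_one _ (by exact hh), ← h2, inp_self]
    rfl

end First

section Second

variable {q : QState s g body.Loc} {gl : Glob g s body.Loc} (T : Tape (Option (WCell s)))

theorem runSnd_flag (hk : q.kind = .op) (hq : q.gl = some gl) (hf : q.flag = true)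
    (ho : once (body.instr gl.loc) = true)
    (l : List (Option (Sym s) × MCell s g body.bound body.Loc)) :
    (PP).runSnd q T l = (q, T, l) := by
  induction l with
  | nil => rfl
  | cons a l ih =>
    have : sndCell body q a T.read = (q, a, T.read.getD none, .stay) := by
      simp [sndCell, hk, hq, hf, ho]
    simp only [runSnd]
    rw [this]
    simp only [act_stay]
    rw [ih]

/-- Instructions act either on the first suitable cell, recorded by the flag, or, for `publish` and
`fill`, on all cells at once. The latter makes a new conjecture appear as a whole within one cycle.
-/
theorem runSnd_op (hk : q.kind = .op) (hq : q.gl = some gl) (hf : q.flag = false)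
    (hs : q.sym = none) (l : List (Option (Sym s) × MCell s g body.bound body.Loc)) :
    ∃ f a l', (PP).runSnd q T l = ({ q with flag := f, sym := a }, T, l') ∧
      Edits gl (body.instr gl.loc) (l.map fun a => a.2.core) f a (l'.map fun a => a.2.core) ∧
      (l'.filterMap fun a => a.2.dig) = l.filterMap fun a => a.2.dig := by
  by_cases ho : once (body.instr gl.loc) = true
  · induction l with
    | nil =>
      refine ⟨false, none, [], ?_, Edits.none ho (by simp), rfl⟩
      rw [← hf, ← hs]
      rfl
    | cons x l ih =>
      by_cases ha : applies gl (body.instr gl.loc) x.2.core = true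
      · have : sndCell body q x T.read = ({ q with flag := true, sym := x.2.core.ldR },
            (none, { x.2 with core := edit gl (body.instr gl.loc) x.2.core }),
            T.read.getD none, .stay) := by
          simp [sndCell, hk, hq, hf, ha]
        refine ⟨true, x.2.core.ldR,
          (none, { x.2 with core := edit gl (body.instr gl.loc) x.2.core }) :: l, ?_, ?_, ?_⟩
        · simp only [runSnd]
          rw [this]
          simp only [act_stay]
          rw [runSnd_flag eS eG body pub₀ T (gl := gl) (by exact hk) (by exact hq) rfl ho]
        · exact Edits.one (cs₁ := []) ho (by simp) ha
        · simp [List.filterMap_cons]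
      · rw [Bool.not_eq_true] at ha
        have : sndCell body q x T.read = (q, x, T.read.getD none, .stay) := by
          simp [sndCell, hk, hq, ha]
        obtain ⟨f, a, l', h1, h2, h3⟩ := ih
        refine ⟨f, a, x :: l', ?_, ?_, ?_⟩
        · simp only [runSnd]
          rw [this]
          simp only [act_stay]
          rw [h1]
        · rw [List.map_cons, List.map_cons]
          generalize (l.map fun a => a.2.core) = cs at h2
          generalize (l'.map fun a => a.2.core) = cs' at h2
          cases h2 with
          | none _ h =>
            refine Edits.none ho fun c hc => ?_
            rcases List.mem_cons.1 hc with rfl | hc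
            · exact ha
            · exact h c hc
          | @one cs₁ cs₂ c _ h hc =>
            refine Edits.one (cs₁ := x.2.core :: cs₁) ho (fun c hc => ?_) hc
            rcases List.mem_cons.1 hc with rfl | hc
            · exact ha
            · exact h c hc
          | all hi => simp [ho] at hi
        · rw [List.filterMap_cons, List.filterMap_cons, h3]
  · have hall : ∀ c : Core s g body.bound, applies gl (body.instr gl.loc) c = true := by
      intro c
      generalize body.instr gl.loc = i at ho ⊢
      rcases i with a | r
      · cases a <;> simp_all [once, applies]
      · simp [once] at ho
    rw [Bool.not_eq_true] at ho
    suffices h : ∀ (l : List (Option (Sym s) × MCell s g body.bound body.Loc))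
        (q : QState s g body.Loc) (_ : q.kind = .op) (_ : q.gl = some gl),
        ∃ f a l', (PP).runSnd q T l = ({ q with flag := f, sym := a }, T, l') ∧
          (l'.map fun a => a.2.core) =
            (l.map fun a => a.2.core).map (edit gl (body.instr gl.loc)) ∧
          (l'.filterMap fun a => a.2.dig) = l.filterMap fun a => a.2.dig by
      obtain ⟨f, a, l', h1, h2, h3⟩ := h l q hk hq
      exact ⟨f, a, l', h1, by rw [h2]; exact Edits.all ho f a, h3⟩
    intro l
    induction l with
    | nil => intro q _ _; exact ⟨q.flag, q.sym, [], rfl, rfl, rfl⟩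
    | cons x l ih =>
      intro q hk hq
      have : sndCell body q x T.read = ({ q with flag := true, sym := x.2.core.ldR },
          (none, { x.2 with core := edit gl (body.instr gl.loc) x.2.core }),
          T.read.getD none, .stay) := by
        simp [sndCell, hk, hq, hall, ho]
      obtain ⟨f, a, l', h1, h2, h3⟩ := ih { q with flag := true, sym := x.2.core.ldR } hk hq
      refine ⟨f, a, (none, { x.2 with core := edit gl (body.instr gl.loc) x.2.core }) :: l',
        ?_, ?_, ?_⟩
      · simp only [runSnd]
        rw [this]
        simp only [act_stay]
        rw [h1]
      · rw [List.map_cons, h2]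
        rfl
      · rw [List.filterMap_cons, List.filterMap_cons, h3]

theorem runBack_of_ne (hk : q.kind ≠ .grab) (hq : q.gl = some gl)
    (l : List (Option (Sym s) × MCell s g body.bound body.Loc)) :
    (PP).runBack q l = (q, l.map fun a => { a.2 with glob := gl }) := by
  induction l with
  | nil => rfl
  | cons x l ih =>
    simp only [runBack]
    rw [ih]
    simp [back, hk, hq]

/-- Cells to the right of the grabbed symbol receive control information without the new letter.
This is harmless, since only the first cell is consulted later; hence the form of the last clause.
-/
theorem runBack_grab (hk : q.kind = .grab) (hq : q.gl = some gl)
    (l : List (Option (Sym s) × MCell s g body.bound body.Loc)) :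
    ∃ a, Grabs (l.map fun a => a.2.core) a (((PP).runBack q l).2.map MCell.core) ∧
      ((PP).runBack q l).2.filterMap MCell.dig = l.filterMap (fun a => a.2.dig) ∧
      ((PP).runBack q l).1.gl = some (grabGlob gl a) ∧
      (((PP).runBack q l).1.kind = .grab ↔ a = none) ∧
      (∀ c m', ((PP).runBack q l).2 = c :: m' → c.glob = grabGlob gl a) := by
  induction l with
  | nil =>
    refine ⟨none, Grabs.none (by simp), rfl, hq, by simp [runBack, hk], ?_⟩
    intro c m' h
    simp [runBack] at h
  | cons x l ih =>
    obtain ⟨a, h1, h2, h3, h4, -⟩ := ih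
    simp only [runBack]
    generalize (PP).runBack q l = r at *
    obtain ⟨r1, r2⟩ := r
    simp only at h1 h2 h3 h4 ⊢
    generalize hcs : (l.map fun a => a.2.core) = cs at h1
    generalize hcs' : r2.map MCell.core = cs' at h1
    rw [List.map_cons, List.map_cons, hcs, hcs', List.filterMap_cons, List.filterMap_cons, h2]
    cases h1 with
    | none h =>
      have hr1 : r1.kind = .grab := h4.2 rfl
      rcases hx : x.2.core.ldL with _ | b
      · have hb : back body r1 x = (r1, { x.2 with glob := grabGlob gl none }) := by
          simp [back, h3, hx]
        rw [hb]
        refine ⟨none, Grabs.none fun c hc => ?_, rfl, h3, h4, ?_⟩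
        · rcases List.mem_cons.1 hc with rfl | hc
          · exact hx
          · exact h c hc
        · rintro c m' ⟨⟩
          rfl
      · have hb : back body r1 x = ({ r1 with kind := .idle, gl := some (grabGlob gl (some b)) },
            { x.2 with glob := grabGlob gl (some b), core := { x.2.core with ldL := none } }) := by
          simp [back, h3, hx, hr1, grabGlob]
        rw [hb]
        refine ⟨some b, Grabs.one (cs₁ := []) h hx, rfl, rfl, by simp, ?_⟩
        rintro c m' ⟨⟩
        rfl
    | @one cs₁ cs₂ c b h hc =>
      have hr1 : r1.kind ≠ .grab := fun e => by simpa using h4.1 e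
      have hb : back body r1 x = (r1, { x.2 with glob := grabGlob gl (some b) }) := by
        simp [back, h3, hr1]
      rw [hb]
      refine ⟨some b, Grabs.one (cs₁ := x.2.core :: cs₁) h hc, rfl, h3, h4, ?_⟩
      rintro c m' ⟨⟩
      rfl

end Second

section Cycle

variable {m : List (MCell s g body.bound body.Loc)} {T : Tape (Option (WCell s))}
  {A : Abs s g body}

theorem Rep.of_map {L : List (Option (Sym s) × MCell s g body.bound body.Loc)}
    (gl : Glob g s body.Loc)
    (hgl : gl = ⟨A.loc, A.left, A.store.letter, A.store.pend⟩)
    (hcore : RepCore (L.map fun a => a.2.core) A.store) (hlen : L.length = A.len)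
    (hpos : 0 < L.length) (htape : view T = A.tape) (hhead : A.left = false → A.tape.head ≠ 0) :
    Rep (L.map fun a => { a.2 with glob := gl }) T A := by
  obtain ⟨a, L', rfl⟩ : ∃ a L', L = a :: L' := by
    cases L with
    | nil => simp at hpos
    | cons a L => exact ⟨a, L, rfl⟩
  refine ⟨⟨_, _, rfl, hgl⟩, ?_, by simpa using hlen, htape, hhead⟩
  rw [List.map_map]
  exact hcore

/-- The machine simulates the abstract steps. -/
theorem Rep.step (h : Rep m T A) (x : List S) :
    Rep ((PP).nextMem x m T) ((PP).nextWork x m T)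
        (A.step (x.map eS) ((m.filterMap MCell.dig).all id)) ∧
      ((PP).nextMem x m T).filterMap MCell.dig = incr true (m.filterMap MCell.dig) ++
        if (m.filterMap MCell.dig).all id then [false] else [] := by
  obtain ⟨c, m', hm, hc⟩ := h.glob
  obtain ⟨hcells, hdig⟩ := afterFst_cells eS eG body pub₀ (x := x) (T := T) hm
  obtain ⟨k, hst, hleft, hload, hright⟩ := afterFst_state eS eG body pub₀ (x := x) (T := T) hm
  have hcl : c.glob.left = A.left := by rw [hc]
  have hthead : T.head = A.tape.head := congrArg Tape.head h.tape
  have hmpos : 0 < m.length := by rw [hm]; simp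
  rw [hcl, hthead, h.tape, h.len] at hleft hload hright
  rw [h.len] at hcells
  have hA : A.step (x.map eS) ((m.filterMap MCell.dig).all id) = A.step (x.map eS)
    ((m.filterMap MCell.dig).all id) := rfl
  conv_rhs at hA => rw [Abs.step, List.length_map]
  rw [hA]
  simp only [nextMem, nextWork, afterSnd]
  generalize (PP).afterFst x m T = r at *
  obtain ⟨q, T₁, L⟩ := r
  simp only at *
  generalize (m.filterMap MCell.dig).all id = ov at *
  generalize hn : max x.length A.len = n at *
  have hnA : A.len ≤ n := by omega
  have hcore := h.core.append_empty (n - A.len + ov.toNat)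
  rw [← hcells] at hcore
  have hL : L.length = n + ov.toNat := by
    have := congrArg List.length hcells
    simp only [List.length_map, List.length_append, List.length_replicate, h.len] at this
    omega
  have hLpos : 0 < L.length := by
    rw [← h.len] at hnA
    omega
  clear hA
  -- In cycles of this kind the last two sweeps change nothing in the store; two of the four cases
  -- below are instances.
  have idle : ∀ (_ : k = .idle) (B : Abs s g body), B.loc = A.loc → B.left = A.left →
      B.store = A.store → B.len = n + ov.toNat → view T₁ = B.tape →
      (B.left = false → B.tape.head ≠ 0) →
      let u := (PP).runSnd (sndStart body q T₁.read).1
        (act T₁ (sndStart body q T₁.read).2) L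
      Rep ((PP).runBack (sndEnd body u.1 u.2.1.read).1 u.2.2).2
        (act u.2.1 (sndEnd body u.1 u.2.1.read).2) B ∧
        ((PP).runBack (sndEnd body u.1 u.2.1.read).1 u.2.2).2.filterMap MCell.dig =
          L.filterMap fun a => a.2.dig := by
    intro hk B h1 h2 h3 h4 h5 h6
    have e1 : sndStart body q T₁.read = (q, T₁.read.getD none, .stay) := by
      simp [sndStart, hst, hk]
    simp only [e1, act_stay]
    rw [runSnd_idle eS eG body pub₀ q (by simp [hst, hk]) (by simp [hst, hk])]
    have e2 : sndEnd body q T₁.read = (q, T₁.read.getD none, .stay) := by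
      simp [sndEnd, hst, hk]
    simp only [e2, act_stay]
    rw [runBack_of_ne eS eG body pub₀ (gl := c.glob) (by simp [hst, hk]) (by simp [hst])]
    refine ⟨Rep.of_map body c.glob (by rw [hc, h1, h2, h3]) (by rw [h3]; exact hcore)
      (by rw [hL, h4]) hLpos h5 h6, ?_⟩
    rw [List.filterMap_map]
    rfl
  by_cases hAl : A.left = true
  · rw [if_pos hAl]
    by_cases hh : n < A.tape.head
    · rw [if_pos hh]
      obtain ⟨hk, ht⟩ := hleft hAl hh
      obtain ⟨h1, h2⟩ := idle hk { A with
          tape := goLeft A.tape (n + 1) (inp (x.map eS) n)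
          len := n + ov.toNat } rfl rfl rfl rfl ht (by simp [hAl])
      exact ⟨h1, h2.trans hdig⟩
    · rw [if_neg hh]
      obtain ⟨hk, ht, hlet⟩ := hload hAl (by omega)
      have h0 : T₁.head = 0 := by
        have := congrArg Tape.head ht
        rw [goLeft_head] at this
        simp only [view] at this
        omega
      have e1 : sndStart body q T₁.read = (q, T₁.read.getD none, .right) := by
        simp [sndStart, hst, hk]
      have e3 : T₁.move .right = ⟨1, T₁.cell⟩ := by simp [Tape.move, h0]
      simp only [e1]
      rw [act_marker h0, e3]
      obtain ⟨h1, h2, h3⟩ := runSnd_load eS eG body pub₀ L q (by simp [hst, hk]) ⟨1, T₁.cell⟩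
        (by simp)
      generalize (PP).runSnd q ⟨1, T₁.cell⟩ L = u at *
      obtain ⟨u1, u2, u3⟩ := u
      simp only at h1 h2 h3 ⊢
      subst h1
      have hu2 : u2.head = L.length + 1 := by
        have := congrArg Tape.head h2
        rw [goRight_head] at this
        simp only [view] at this
        omega
      have e2 : sndEnd body u1 u2.read = ({ u1 with kind := .idle, gl := some { c.glob with left := false } },
          some ((rd u2.read).push (some none)), .right) := by
        simp [sndEnd, hst, hk]
      simp only [e2]
      have hcell : ∀ i, (view (⟨1, T₁.cell⟩ : Tape (Option (WCell s)))).cell i =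
          (goLeft A.tape n (inp (x.map eS) n)).cell i := fun i => by rw [← ht]; rfl
      rw [runBack_of_ne eS eG body pub₀ (gl := { c.glob with left := false }) (by simp) (by simp)]
      simp only [Nat.sub_self, zero_add, hcell] at h3
      have hfield : ∀ {B : Type} (F : Core s g body.bound → B), (∀ c a b,
          F { c with ldR := a, ldL := b } = F c) →
          (u3.map fun a => F a.2.core) = (L.map fun a => a.2.core).map F := by
        intro B F hF
        rw [h3]
        apply List.ext_getElem?
        intro i
        simp only [List.getElem?_map, List.getElem?_mapIdx, Option.map_map]
        congr 1
        funext a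
        -- Loading touches only `ldR` and `ldL`, so registers, `build` and `pub` are read off
        -- unchanged.
        exact hF _ _ _
      have hld : ∀ {B : Type} (F : Core s g body.bound → B) (H : WCell s → B), (∀ (c : Core s g body.bound) (w : WCell s),
          F { c with ldR := w.ra, ldL := w.la } = H w) →
          (u3.map fun a => F a.2.core) = (List.range (n + ov.toNat)).map fun i =>
            H ((goLeft A.tape n (inp (x.map eS) n)).cell i) := by
        intro B F H hF
        rw [h3, ← hL]
        apply List.ext_getElem
        · simp
        · intro i _ _
          simp [hF]
      refine ⟨Rep.of_map body { c.glob with left := false } (by rw [hc]) ⟨?_, ?_, ?_, ?_⟩ ?_ ?_ ?_ ?_, ?_⟩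
      · intro r hr
        rw [← hcore.reg r hr]
        have := hfield (Core.getReg r) fun _ _ _ => rfl
        have h4 := congrArg (List.countP id) this
        rw [List.countP_map, List.countP_map] at h4
        rw [List.countP_map]
        exact h4
      · have h4 := congrArg (List.filterMap id) (hld Core.ldR WCell.ra fun _ _ => rfl)
        have h5 := congrArg (List.filterMap id) (hld Core.ldL WCell.la fun _ _ => rfl)
        rw [List.filterMap_map, List.filterMap_map] at h4 h5
        rw [List.filterMap_map, List.filterMap_map]
        exact congrArg₂ (fun a b => a ++ List.reverse b) h4 h5
      · rw [List.map_map]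
        exact (hfield Core.build fun _ _ _ => rfl) ▸ hcore.build
      · rw [List.map_map]
        exact (hfield Core.pub fun _ _ _ => rfl) ▸ hcore.pub
      · rw [h3, List.length_mapIdx, hL]
      · rw [h3, List.length_mapIdx]
        exact hLpos
      · rw [view_act, rd_read (by omega)]
        have hv : view (⟨1, T₁.cell⟩ : Tape (Option (WCell s))) =
            ⟨1, (goLeft A.tape n (inp (x.map eS) n)).cell⟩ := tape_ext rfl hcell
        rw [hv, hL, goRight_congr (b := fun i => if i = n + ov.toNat then some none
          else if A.tape.head ≤ i ∧ i < n then inp (x.map eS) n i else none) _ _ fun i hi => by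
            rw [hlet, if_neg (show ¬ i = n + ov.toNat by omega)]] at h2
        have hT := goRight_append_one
          (⟨1, (goLeft A.tape n (inp (x.map eS) n)).cell⟩ : Tape (WCell s)) (by simp)
          (n + ov.toNat) fun i => if i = n + ov.toNat then some none
            else if A.tape.head ≤ i ∧ i < n then inp (x.map eS) n i else none
        rw [← h2, if_pos rfl] at hT
        exact hT
      · intro _
        rw [goRight_head]
        simp
      · rw [← hdig]
        have : u3.map (fun a => a.2.dig) = L.map fun a => a.2.dig := by
          rw [h3]
          apply List.ext_getElem?
          intro i
          simp only [List.getElem?_map, List.getElem?_mapIdx, Option.map_map]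
          rfl
        have h4 := congrArg (List.filterMap id) this
        rw [List.filterMap_map, List.filterMap_map] at h4
        rw [List.filterMap_map]
        exact h4
  · rw [Bool.not_eq_true] at hAl
    rw [if_neg (by simp [hAl])]
    obtain ⟨hk, ht⟩ := hright hAl (h.head hAl)
    rcases hov : ov with _ | _
    · rw [hov] at hk
      obtain ⟨h1, h2⟩ := idle hk { A with
          tape := goRight A.tape (n + 1) (inp (x.map eS) n)
          len := n + Bool.toNat false } rfl rfl rfl (by rw [hov]) ht
        (fun _ => by rw [goRight_head]; omega)
      refine ⟨?_, h2.trans (by rw [hdig, hov])⟩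
      rw [if_neg (by simp)]
      exact h1
    · subst hov
      rw [if_pos rfl] at hk
      have e1 : sndStart body q T₁.read = (q, T₁.read.getD none, .stay) := by
        simp [sndStart, hst, hk]
      simp only [e1, act_stay]
      obtain ⟨f, a, L', h1, h2, h3⟩ := runSnd_op eS eG body pub₀ (q := q) (gl := c.glob) T₁
        (by simp [hst, hk]) (by simp [hst]) (by simp [hst]) (by simp [hst]) L
      have hL' : L'.length = n + 1 := by
        have := runSnd_length PP L q T₁
        rw [h1] at this
        simpa [hL] using this
      rw [h1]
      have e2 : sndEnd body { q with flag := f, sym := a } T₁.read = ({ q with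
          kind := if body.instr c.glob.loc = .act .fetch ∧ f = false then .grab else .idle
          gl := some (nextGlob c.glob f a), flag := f, sym := a }, T₁.read.getD none, .stay) := by
        simp [sndEnd, hst, hk]
      simp only [e2, act_stay]
      rw [hcells, Bool.toNat_true, List.replicate_succ', ← List.append_assoc] at h2 hcore
      have hcslen : (m.map MCell.core ++ List.replicate (n - A.len)
          (Core.empty : Core s g body.bound)).length + 1 = n + 1 := by
        simp [h.len]; omega
      have hkind : ∀ y cs, (if body.instr c.glob.loc = .act .fetch ∧ f = false
            then Grabs (L'.map fun a => a.2.core) y cs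
            else y = none ∧ cs = (L'.map fun a => a.2.core)) →
          RepCore cs ((body.instr A.loc).exec (n + 1) A.store).1 ∧
          grabGlob (nextGlob c.glob f a) y =
            ⟨(body.next A.loc ((body.instr A.loc).exec (n + 1) A.store).2).getD body.entry,
              (match body.instr A.loc with | .act .turn => A.store.load.isEmpty | _ => A.left),
              ((body.instr A.loc).exec (n + 1) A.store).1.letter,
              ((body.instr A.loc).exec (n + 1) A.store).1.pend⟩ := by
        intro y cs hG
        have := RepCore.exec (gl := c.glob) hcore (by rw [hc]) (by rw [hc]) h2 hG
        rw [hcslen, hc] at this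
        rw [hc]
        exact this
      by_cases hgr : body.instr c.glob.loc = .act .fetch ∧ f = false
      · rw [if_pos hgr]
        obtain ⟨y, g1, g2, -, -, g5⟩ := runBack_grab eS eG body pub₀
          (q := { q with kind := .grab, gl := some (nextGlob c.glob f a), flag := f, sym := a })
          rfl rfl L'
        obtain ⟨k1, k2⟩ := hkind _ _ (by rw [if_pos hgr]; exact g1)
        have hl2 := runBack_length PP L'
          { q with kind := .grab, gl := some (nextGlob c.glob f a), flag := f, sym := a }
        refine ⟨⟨?_, k1, by rw [hl2, hL']; rfl, ht, fun _ => ?_⟩, g2.trans (h3.trans hdig)⟩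
        · generalize ((PP).runBack _ L').2 = l2 at *
          cases l2 with
          | nil => simp at hl2; omega
          | cons d l2 => exact ⟨d, l2, rfl, (g5 d l2 rfl).trans k2⟩
        · show (goRight A.tape (n + 1) (inp (x.map eS) n)).head ≠ 0
          rw [goRight_head]; omega
      · rw [if_neg hgr]
        obtain ⟨k1, k2⟩ := hkind none _ (by rw [if_neg hgr]; exact ⟨rfl, rfl⟩)
        rw [runBack_of_ne eS eG body pub₀ (gl := nextGlob c.glob f a) (by simp) rfl]
        refine ⟨Rep.of_map body (nextGlob c.glob f a) ?_ k1 (by rw [hL']; rfl) (by omega) ht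
          (fun _ => ?_), ?_⟩
        · rw [← show grabGlob (nextGlob c.glob f a) none = nextGlob c.glob f a from rfl, k2]
          rfl
        · show (goRight A.tape (n + 1) (inp (x.map eS) n)).head ≠ 0
          rw [goRight_head]; omega
        · rw [List.filterMap_map]
          exact h3.trans hdig

end Cycle

end Machine

end LinLearn


/-! ### Runs of the machine, the counter and the length of the memory -/

namespace LinLearn

universe u v

open Sweeper

/-- The initial abstract state, in which the word `pub₀` is published. -/
def Abs.init {s g : ℕ} (body : Prog) (pub₀ : List (Fin g)) : Abs s g body :=
  ⟨body.entry, true, ⟨fun _ => 0, [], 0, 0, [], pub₀, []⟩, pub₀.length + 1,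
    ⟨0, fun _ => WCell.empty⟩⟩

theorem Abs.step_len {s g : ℕ} {body : Prog} (A : Abs s g body) (x : List (Fin s)) (ov : Bool) :
    (A.step x ov).len = max x.length A.len + ov.toNat := by
  simp only [Abs.step]
  split_ifs <;> rfl

namespace Machine

variable {S : Type u} {G : Type v} {s g : ℕ} (eS : S → Fin s) (eG : Fin g → G) (body : Prog)
  (pub₀ : List (Fin g))

local notation "PP" => sweeper eS eG body pub₀

theorem rep_init : Rep (PP).initMem { head := 0, cell := fun _ => none }
    (Abs.init body pub₀) := by
  have hne : ∃ c m', (PP).initMem = c :: m' ∧ c.glob = ⟨body.entry, true, 0, 0⟩ := by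
    cases pub₀ with
    | nil => exact ⟨_, _, rfl, rfl⟩
    | cons a l => exact ⟨_, _, rfl, rfl⟩
  refine ⟨hne, ⟨?_, ?_, ?_, ?_⟩, by simp [Abs.init], rfl, by simp [Abs.init]⟩
  · intro r _
    refine countP_eq_zero_of fun c hc => ?_
    obtain ⟨d, hd, rfl⟩ := List.mem_map.1 hc
    simp only [List.mem_append, List.mem_map, List.mem_singleton] at hd
    rcases hd with ⟨a, -, rfl⟩ | rfl
    · simp [Core.getReg, Core.empty]
    · simp [Core.getReg, Core.empty, cell₀]
  · have h : ∀ c ∈ (PP).initMem.map MCell.core, c.ldR = none ∧ c.ldL = none := by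
      intro c hc
      obtain ⟨d, hd, rfl⟩ := List.mem_map.1 hc
      simp only [List.mem_append, List.mem_map, List.mem_singleton] at hd
      rcases hd with ⟨a, -, rfl⟩ | rfl <;> exact ⟨rfl, rfl⟩
    rw [filterMap_eq_nil_of fun c hc => (h c hc).1, filterMap_eq_nil_of fun c hc => (h c hc).2]
    rfl
  · refine ⟨pub₀.length + 1, ?_⟩
    rw [List.replicate_succ']
    simp [Abs.init, cell₀, Core.empty, Function.comp_def]
  · exact ⟨1, by simp [Abs.init, cell₀, Core.empty, Function.comp_def]⟩

/-- The runs of the machine are described by sequences of abstract states. -/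
theorem exists_abs (w : ℕ → List S) :
    ∃ (A : ℕ → Abs s g body) (ov : ℕ → Bool), A 0 = Abs.init body pub₀ ∧
      (∀ k, A (k + 1) = (A k).step ((w k).map eS) (ov k)) ∧ (∀ k, ∃ j ≥ k, ov j = true) ∧
      (∀ k, Rep ((PP).run w k).1 ((PP).run w k).2 (A k)) ∧ (∀ k, k < 2 ^ (A k).len) ∧
      ∀ k, (A k).len ≤ pub₀.length + 1 + Nat.log 2 (k + 1) +
        (Finset.range k).sup fun i => (w i).length := by
  let D : ℕ → List Bool := fun k => ((PP).run w k).1.filterMap MCell.dig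
  let ov : ℕ → Bool := fun k => (D k).all id
  let A : ℕ → Abs s g body := fun k =>
    Nat.rec (Abs.init body pub₀) (fun k B => B.step ((w k).map eS) (ov k)) k
  have hrep : ∀ k, Rep ((PP).run w k).1 ((PP).run w k).2 (A k) := by
    intro k
    induction k with
    | zero => exact rep_init eS eG body pub₀
    | succ k ih => exact (Rep.step eS eG body pub₀ ih (w k)).1
  have hD : ∀ k, D (k + 1) = incr true (D k) ++ if ov k then [false] else [] := fun k =>
    (Rep.step eS eG body pub₀ (hrep k) (w k)).2
  have hD0 : D 0 = [] := by
    refine filterMap_eq_nil_of fun c hc => ?_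
    simp only [run, List.mem_append, List.mem_map, List.mem_singleton] at hc
    rcases hc with ⟨a, -, rfl⟩ | rfl <;> rfl
  have hlenD : ∀ k, (D (k + 1)).length = (D k).length + (ov k).toNat := by
    intro k
    rw [hD, List.length_append, length_incr]
    cases ov k <;> rfl
  -- With an implicit leading one, the digits are the binary representation of `k + 1`; the empty
  -- list at the start represents `1`.
  have hval : ∀ k, bval (D k) + 2 ^ (D k).length = k + 1 := by
    intro k
    induction k with
    | zero => rw [hD0]; rfl
    | succ k ih =>
      have h1 := bval_incr true (D k)
      have h2 := hlenD k
      have h3 : bval (D (k + 1)) = bval (incr true (D k)) := by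
        rw [hD]
        split_ifs
        · exact bval_append_false _
        · rw [List.append_nil]
      rw [h2, h3]
      have h4 : (true && (D k).all id) = ov k := Bool.true_and _
      rw [h4] at h1
      cases hov : ov k <;> simp [hov, pow_succ] at h1 ⊢ <;> omega
  have hlog : ∀ k, (D k).length = Nat.log 2 (k + 1) := by
    intro k
    have h1 := hval k
    have h2 := bval_lt (D k)
    refine (Nat.log_eq_of_pow_le_of_lt_pow ?_ ?_).symm
    · rw [← h1]
      exact Nat.le_add_left _ _
    · rw [pow_succ]
      omega
  have hlen : ∀ k, (D k).length + 1 ≤ (A k).len := by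
    intro k
    induction k with
    | zero =>
      rw [hD0]
      show 0 + 1 ≤ pub₀.length + 1
      omega
    | succ k ih =>
      have h1 : (A (k + 1)).len = max ((w k).map eS).length (A k).len + (ov k).toNat :=
        Abs.step_len _ _ _
      rw [h1, hlenD]
      omega
  refine ⟨A, ov, rfl, fun k => rfl, ?_, hrep, fun k => ?_, ?_⟩
  · intro k
    -- Without further overflows the number of digits would be constant while the value grows by one
    -- in each cycle.
    by_contra hcon
    push Not at hcon
    have hconst : ∀ j ≥ k, (D j).length = (D k).length := by
      intro j hj
      induction j, hj using Nat.le_induction with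
      | base => rfl
      | succ j hj ih =>
        have := hcon j hj
        rw [hlenD, ih]
        simp [Bool.not_eq_true] at this
        simp [this]
    have h1 := hconst (k + 2 ^ ((D k).length + 1)) (Nat.le_add_right _ _)
    have h2 := hval (k + 2 ^ ((D k).length + 1))
    have h3 := bval_lt (D (k + 2 ^ ((D k).length + 1)))
    rw [h1, pow_succ] at h3
    rw [h1, pow_succ] at h2
    omega
  · have h1 := hval k
    have h2 := bval_lt (D k)
    refine lt_of_lt_of_le ?_ (Nat.pow_le_pow_right (by norm_num) (hlen k))
    rw [pow_succ]
    omega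
  · intro k
    rw [← hlog]
    induction k with
    | zero => rw [hD0]; exact Nat.le_add_right _ _
    | succ k ih =>
      have h1 : (A (k + 1)).len = max ((w k).map eS).length (A k).len + (ov k).toNat :=
        Abs.step_len _ _ _
      rw [h1, hlenD, Finset.range_add_one, Finset.sup_insert, List.length_map]
      rw [Nat.add_comm (D k).length]
      have : max (w k).length ((Finset.range k).sup fun i => (w i).length) =
        (w k).length ⊔ ((Finset.range k).sup fun i => (w i).length) := rfl
      omega

/-- The runs of the machine are runs of a learner in the sense of the definition. -/
theorem exists_run (w : ℕ → List S) :
    ∃ (A : ℕ → Abs s g body) (ov : ℕ → Bool) (mem : ℕ → List (PP).toLearner.Mem)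
      (work : ℕ → Tape (Option (PP).toLearner.Work)) (time : ℕ → ℕ),
      A 0 = Abs.init body pub₀ ∧
      (∀ k, A (k + 1) = (A k).step ((w k).map eS) (ov k)) ∧ (∀ k, ∃ j ≥ k, ov j = true) ∧
      (∀ k, (A k).len ≤ pub₀.length + 1 + Nat.log 2 (k + 1) +
        (Finset.range k).sup fun i => (w i).length) ∧
      (PP).toLearner.IsRun w mem work (fun k => (A (k + 1)).store.pub.map eG) time ∧
      (∀ k, time k ≤ 4 * max (w k).length (A k).len + 10) ∧
      (∀ k s, ((PP).toLearner.configAt (w k) (mem k) (work k) s).base.head ≤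
        max (w k).length (A k).len + 2) ∧
      (∀ k, (mem k).length = (A k).len) ∧ (∀ k, (A k).store.pub.length ≤ (A k).len) ∧
      (∀ k, k < 2 ^ (A k).len) ∧ ∀ k, ∀ r < body.bound, (A k).store.reg r ≤ (A k).len := by
  obtain ⟨A, ov, h0, hstep, hov, hrep, hpow, hlen⟩ := exists_abs eS eG body pub₀ w
  have hpub : ∀ k (i : ℕ), ((A k).store.pub.map eG)[i]? =
      ((((PP).run w k).1)[i]?).bind (PP).letter := by
    intro k i
    have := (hrep k).core.pub.getElem? i
    rw [List.getElem?_map, ← this]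
    simp only [List.getElem?_map]
    cases (((PP).run w k).1)[i]? <;> rfl
  obtain ⟨time, h1, h2, h3⟩ := (PP).exists_isRun w (fun k => (A (k + 1)).store.pub.map eG)
    fun k i => hpub (k + 1) i
  refine ⟨A, ov, _, _, time, h0, hstep, hov, hlen, h1, ?_, ?_, fun k => (hrep k).len, fun k => ?_, hpow,
    fun k r hr => ?_⟩
  · intro k
    rw [← (hrep k).len]
    exact h2 k
  · intro k s
    rw [← (hrep k).len]
    exact h3 k s
  · obtain ⟨n, hn⟩ := (hrep k).core.pub
    have := congrArg List.length hn
    simp only [List.length_map, List.length_append, List.length_replicate, (hrep k).len] at this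
    omega
  · rw [← (hrep k).core.reg r hr, ← (hrep k).len]
    exact List.countP_le_length.trans (by simp)

end Machine

end LinLearn


/-! ### Where the data are on the work tape -/

namespace LinLearn

open Machine

section Fm

variable {B : Type}

/-- The symbols in the first `n` places. -/
def fm (f : ℕ → Option B) (n : ℕ) : List B := (List.range n).filterMap f

theorem fm_congr {f f' : ℕ → Option B} {n : ℕ} (h : ∀ i < n, f i = f' i) : fm f n = fm f' n :=
  List.filterMap_congr fun i hi => h i (List.mem_range.1 hi)

theorem fm_add (f : ℕ → Option B) (m n : ℕ) :
    fm f (m + n) = fm f m ++ fm (fun i => f (m + i)) n := by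
  simp only [fm, List.range_add, List.filterMap_append, List.filterMap_map]
  rfl

theorem fm_eq_nil {f : ℕ → Option B} {n : ℕ} (h : ∀ i < n, f i = none) : fm f n = [] :=
  List.filterMap_eq_nil_iff.2 fun i hi => h i (List.mem_range.1 hi)

theorem fm_of_none {f : ℕ → Option B} {m n : ℕ} (hmn : m ≤ n) (h : ∀ i, m ≤ i → f i = none) :
    fm f n = fm f m := by
  obtain ⟨d, rfl⟩ := Nat.exists_eq_add_of_le hmn
  rw [fm_add, fm_eq_nil (n := d) fun i _ => h _ (by omega), List.append_nil]

/-- Symbols written on the way to the left lie on the tape in reverse chronological order. -/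
theorem fm_reverse (f : ℕ → Option B) (n : ℕ) : (fm f n).reverse = fm (fun i => f (n - 1 - i)) n := by
  induction n with
  | zero => rfl
  | succ n ih =>
    have h1 := fm_add f n 1
    have h2 := fm_add (fun i => f (1 + n - 1 - i)) 1 n
    rw [h1, List.reverse_append, ih, add_comm n 1, h2]
    congr 1
    · simp only [fm, List.range_one, List.filterMap_cons, List.filterMap_nil]
      rw [show n + 0 = 1 + n - 1 - 0 by omega]
      cases f (1 + n - 1 - 0) <;> rfl
    · refine fm_congr fun i hi => ?_
      congr 1
      omega

theorem fm_inp_lt {s : ℕ} (x : List (Fin s)) (n m : ℕ) (h : m ≤ n) :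
    fm (inp x n) m = (x.take m).map some := by
  induction m with
  | zero => rfl
  | succ m ih =>
    rw [fm_add, ih (by omega), List.take_add_one, List.map_append]
    congr 1
    rw [show fm (fun i => inp x n (m + i)) 1 = (inp x n m).toList by
      cases h : inp x n m <;> simp [fm, h], inp_of_ne (by omega)]
    cases x[m]? <;> rfl

theorem fm_inp {s : ℕ} (x : List (Fin s)) (n : ℕ) (h : x.length ≤ n) :
    fm (inp x n) (n + 1) = x.map some ++ [none] := by
  rw [fm_add, fm_inp_lt _ _ _ le_rfl, List.take_of_length_le h]
  simp [fm, inp_self]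

end Fm

/-- A run of the abstract machine. -/
structure Traj (s g : ℕ) (body : Prog) where
  A : ℕ → Abs s g body
  x : ℕ → List (Fin s)
  ov : ℕ → Bool
  step : ∀ k, A (k + 1) = (A k).step (x k) (ov k)
  exists_ov : ∀ k, ∃ j ≥ k, ov j = true
  reg_le : ∀ k, ∀ r < body.bound, (A k).store.reg r ≤ (A k).len
  le_len : ∀ k, k < 2 ^ (A k).len
  head_zero : (A 0).tape.head = 0

/-- A bound for the position of the head in terms of the length of the base tape. -/
def headBound (l : ℕ) : ℕ := 2 ^ l * (l + 2)

theorem headBound_mono {l l' : ℕ} (h : l ≤ l') : headBound l ≤ headBound l' :=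
  Nat.mul_le_mul (Nat.pow_le_pow_right (by norm_num) h) (by omega)

namespace Traj

variable {s g : ℕ} {body : Prog} (t : Traj s g body)

theorem len_succ (k : ℕ) :
    (t.A (k + 1)).len = max (t.x k).length (t.A k).len + (t.ov k).toNat := by
  rw [t.step, Abs.step_len]

theorem len_mono {j k : ℕ} (h : j ≤ k) : (t.A j).len ≤ (t.A k).len :=
  monotone_nat_of_le_succ (f := fun k => (t.A k).len) (fun k => by rw [t.len_succ]; omega) h

theorem head_succ_le (k : ℕ) : (t.A (k + 1)).tape.head ≤ (t.A k).tape.head + (t.A (k + 1)).len + 2 := by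
  rw [t.len_succ, t.step, Abs.step]
  generalize max (t.x k).length (t.A k).len = n
  split_ifs
  · show (goLeft _ _ _).head ≤ _
    rw [goLeft_head]; omega
  · show 1 + _ ≤ _
    omega
  · show (goRight _ _ _).head ≤ _
    rw [goRight_head]; omega
  · show (goRight _ _ _).head ≤ _
    rw [goRight_head]; omega

/-- A cycle moves the head to the right by at most the length of the base tape plus two, and fewer
than `2 ^ len` cycles have passed. The bound depends on the length alone, so the program can compute
it with `fill`. -/
theorem head_le (k : ℕ) : (t.A k).tape.head ≤ headBound (t.A k).len := by
  have h : (t.A k).tape.head ≤ k * ((t.A k).len + 2) := by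
    induction k with
    | zero => simp [t.head_zero]
    | succ k ih =>
      have h1 := t.head_succ_le k
      have h2 := Nat.mul_le_mul_left k (Nat.add_le_add_right (t.len_mono (show k ≤ k + 1 by omega)) 2)
      rw [Nat.succ_mul]
      omega
  exact h.trans (Nat.mul_le_mul_right _ (t.le_len k).le)

/-- The machine is in the mode in which it works and moves right on the work tape; cells from `X` on
do not contain old symbols, and `V` consists of all symbols except for those written during the
present trip. -/
structure Right (k X : ℕ) (V : List (Sym s)) : Prop where
  left : (t.A k).left = false
  len_lt : (t.A k).len < (t.A k).tape.head
  old : ∀ i ≥ X, ((t.A k).tape.cell i).ra = none ∧ ((t.A k).tape.cell i).la = none ∧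
    ((t.A k).tape.head ≤ i + 1 →
      ((t.A k).tape.cell i).rb = none ∧ ((t.A k).tape.cell i).lb = none)
  new : ∀ i, i + 1 < (t.A k).tape.head → ((t.A k).tape.cell i).lb = none
  -- In cells already passed on this trip the symbols of the preceding trip have been shifted to the
  -- old tracks; in the others they are still on the new ones.
  data : V = (t.A k).store.eaten ++ (t.A k).store.load ++
    (fm (fun i => if i + 1 < (t.A k).tape.head then ((t.A k).tape.cell i).ra
      else ((t.A k).tape.cell i).rb) X ++
    (fm (fun i => if i + 1 < (t.A k).tape.head then ((t.A k).tape.cell i).la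
      else ((t.A k).tape.cell i).lb) X).reverse)
  all : stream t.x k = V ++ fm (fun i => ((t.A k).tape.cell i).rb) ((t.A k).tape.head - 1)

/-- The machine moves left on the work tape and does not work. -/
structure Left (k X Y : ℕ) (V : List (Sym s)) : Prop where
  left : (t.A k).left = true
  blank : ∀ i ≥ Y, (t.A k).tape.cell i = WCell.empty
  old : ∀ i ≥ X, ((t.A k).tape.cell i).ra = none ∧ ((t.A k).tape.cell i).la = none
  new : ∀ i, i < (t.A k).tape.head → ((t.A k).tape.cell i).lb = none
  head_le : (t.A k).tape.head ≤ Y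
  -- On arrival all symbols on the old tracks lie among the cells that are loaded.
  le_len : X ≤ (t.A k).len
  load : (t.A k).store.load = []
  data : V = (t.A k).store.eaten ++ (fm (fun i => ((t.A k).tape.cell i).ra) X ++
    (fm (fun i => ((t.A k).tape.cell i).la) X).reverse)
  all : stream t.x k = V ++ (fm (fun i => ((t.A k).tape.cell i).rb) Y ++
    (fm (fun i => ((t.A k).tape.cell i).lb) Y).reverse)

/-- The tape after a cycle in the working mode. -/
theorem Right.tape_succ {t : Traj s g body} {k X : ℕ} {V : List (Sym s)} (h : t.Right k X V) :
    (t.A (k + 1)).tape = goRight (t.A k).tape (max (t.x k).length (t.A k).len + 1)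
      (inp (t.x k) (max (t.x k).length (t.A k).len)) := by
  rw [t.step, Abs.step, if_neg (by simp [h.left])]
  simp only
  split_ifs <;> rfl

/-- A cycle in the working mode in which the direction does not change. -/
theorem Right.succ {t : Traj s g body} {k X : ℕ} {V : List (Sym s)} (h : t.Right k X V)
    (hl : (t.A (k + 1)).left = false)
    (he : (t.A (k + 1)).store.eaten ++ (t.A (k + 1)).store.load =
      (t.A k).store.eaten ++ (t.A k).store.load) : t.Right (k + 1) X V := by
  have ht := h.tape_succ
  have hlen := t.len_succ k
  have hov : (t.ov k).toNat ≤ 1 := Bool.toNat_le _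
  have hh := h.len_lt
  generalize hn : max (t.x k).length (t.A k).len = n at *
  have hhead : (t.A (k + 1)).tape.head = (t.A k).tape.head + (n + 1) := by rw [ht, goRight_head]
  have hcell : ∀ i, (t.A (k + 1)).tape.cell i =
      if (t.A k).tape.head ≤ i + 1 ∧ i + 1 < (t.A k).tape.head + (n + 1)
        then ((t.A k).tape.cell i).push (inp (t.x k) n (i + 1 - (t.A k).tape.head))
        else (t.A k).tape.cell i := fun i => by rw [ht]; rfl
  refine ⟨hl, by omega, fun i hi => ?_, fun i hi => ?_, ?_, ?_⟩
  · obtain ⟨h1, h2, h3⟩ := h.old i hi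
    rw [hcell]
    split_ifs with hc
    · exact ⟨(h3 hc.1).1, (h3 hc.1).2, fun hc' => by omega⟩
    · exact ⟨h1, h2, fun hc' => h3 (by omega)⟩
  · rw [hcell]
    split_ifs with hc
    · rfl
    · exact h.new i (by omega)
  · rw [he, h.data]
    congr 2
    · refine fm_congr fun i _ => ?_
      rw [hcell]
      split_ifs <;> first | rfl | omega
    · congr 1
      refine fm_congr fun i _ => ?_
      rw [hcell]
      split_ifs <;> first | rfl | omega
  · rw [stream_succ, h.all, List.append_assoc]
    congr 1
    rw [hhead, show (t.A k).tape.head + (n + 1) - 1 = ((t.A k).tape.head - 1) + (n + 1) by omega,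
      fm_add]
    congr 1
    · refine fm_congr fun i hi => ?_
      rw [hcell, if_neg (by omega)]
    · rw [← fm_inp _ n (by omega)]
      refine fm_congr fun i hi => ?_
      rw [hcell, if_pos (by omega)]
      simp only [WCell.push]
      congr 1
      omega

/-- The direction changes. -/
theorem Right.turn {t : Traj s g body} {k X : ℕ} {V : List (Sym s)} (h : t.Right k X V)
    (hX : X ≤ (t.A (k + 1)).len) (hl : (t.A (k + 1)).left = true)
    (he : (t.A (k + 1)).store.eaten = (t.A k).store.eaten)
    (hld : (t.A k).store.load = []) (hld' : (t.A (k + 1)).store.load = []) :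
    t.Left (k + 1) X (t.A (k + 1)).tape.head V := by
  have ht := h.tape_succ
  have hlen := t.len_succ k
  have hov : (t.ov k).toNat ≤ 1 := Bool.toNat_le _
  have hh := h.len_lt
  generalize hn : max (t.x k).length (t.A k).len = n at *
  have hhead : (t.A (k + 1)).tape.head = (t.A k).tape.head + (n + 1) := by rw [ht, goRight_head]
  have hcell : ∀ i, (t.A (k + 1)).tape.cell i =
      if (t.A k).tape.head ≤ i + 1 ∧ i + 1 < (t.A k).tape.head + (n + 1)
        then ((t.A k).tape.cell i).push (inp (t.x k) n (i + 1 - (t.A k).tape.head))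
        else (t.A k).tape.cell i := fun i => by rw [ht]; rfl
  have hlb : ∀ i, ((t.A (k + 1)).tape.cell i).lb = none := by
    intro i
    rw [hcell]
    split_ifs with hc
    · rfl
    · by_cases hi : i + 1 < (t.A k).tape.head
      · exact h.new i hi
      · exact ((h.old i (by omega)).2.2 (by omega)).2
  refine ⟨hl, fun i hi => ?_, fun i hi => ?_, fun i _ => hlb i, le_rfl, hX, hld', ?_, ?_⟩
  · obtain ⟨h1, h2, h3⟩ := h.old i (by omega)
    rw [hcell, if_neg (by omega)]
    exact WCell.ext h1 h2 (h3 (by omega)).1 (h3 (by omega)).2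
  · obtain ⟨h1, h2, h3⟩ := h.old i hi
    rw [hcell]
    split_ifs with hc
    · exact ⟨(h3 hc.1).1, (h3 hc.1).2⟩
    · exact ⟨h1, h2⟩
  · rw [he, h.data, hld, List.append_nil]
    congr 2
    -- By `hX` all cells below `X` have been passed by now, so their symbols are on the old tracks.
    · refine fm_congr fun i hi => ?_
      rw [hcell]
      split_ifs <;> first | rfl | omega
    · congr 1
      refine fm_congr fun i hi => ?_
      rw [hcell]
      split_ifs <;> first | rfl | omega
  · rw [stream_succ, h.all, List.append_assoc]
    congr 1
    rw [fm_eq_nil (f := fun i => ((t.A (k + 1)).tape.cell i).lb) fun i _ => hlb i, List.reverse_nil,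
      List.append_nil, hhead,
      show (t.A k).tape.head + (n + 1) = ((t.A k).tape.head - 1) + (n + 1) + 1 by omega,
      fm_add, fm_add]
    have hlast : fm (fun i => ((t.A (k + 1)).tape.cell ((t.A k).tape.head - 1 + (n + 1) + i)).rb) 1 =
        [] := by
      refine fm_eq_nil fun i hi => ?_
      rw [hcell, if_neg (by omega)]
      exact ((h.old _ (by omega)).2.2 (by omega)).1
    rw [hlast, List.append_nil]
    congr 1
    · refine fm_congr fun i hi => ?_
      rw [hcell, if_neg (by omega)]
    · rw [← fm_inp _ n (by omega)]
      refine fm_congr fun i hi => ?_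
      rw [hcell, if_pos (by omega)]
      simp only [WCell.push]
      congr 1
      omega

/-- A cycle in which the head on the work tape does not arrive at the marker. -/
theorem Left.succ {t : Traj s g body} {k X Y : ℕ} {V : List (Sym s)} (h : t.Left k X Y V)
    (hh : max (t.x k).length (t.A k).len < (t.A k).tape.head) :
    t.Left (k + 1) X Y V ∧ (t.A (k + 1)).tape.head < (t.A k).tape.head ∧
      (t.A (k + 1)).store = (t.A k).store ∧ (t.A (k + 1)).loc = (t.A k).loc := by
  have hlen := t.len_succ k
  have hs := t.step k
  rw [Abs.step, if_pos h.left] at hs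
  simp only at hs
  rw [if_pos hh] at hs
  generalize hn : max (t.x k).length (t.A k).len = n at *
  have ht : (t.A (k + 1)).tape = goLeft (t.A k).tape (n + 1) (inp (t.x k) n) := by rw [hs]
  have hstore : (t.A (k + 1)).store = (t.A k).store := by rw [hs]
  have hhead : (t.A (k + 1)).tape.head = (t.A k).tape.head - (n + 1) := by rw [ht, goLeft_head]
  have hcell : ∀ i, (t.A (k + 1)).tape.cell i =
      if i < (t.A k).tape.head ∧ (t.A k).tape.head ≤ i + (n + 1)
        then ((t.A k).tape.cell i).setLb (inp (t.x k) n ((t.A k).tape.head - 1 - i))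
        else (t.A k).tape.cell i := fun i => by rw [ht]; rfl
  have hY := h.head_le
  have hra : ∀ i, ((t.A (k + 1)).tape.cell i).ra = ((t.A k).tape.cell i).ra := fun i => by
    rw [hcell]; split_ifs <;> rfl
  have hla : ∀ i, ((t.A (k + 1)).tape.cell i).la = ((t.A k).tape.cell i).la := fun i => by
    rw [hcell]; split_ifs <;> rfl
  have hrb : ∀ i, ((t.A (k + 1)).tape.cell i).rb = ((t.A k).tape.cell i).rb := fun i => by
    rw [hcell]; split_ifs <;> rfl
  refine ⟨⟨by rw [hs]; exact h.left, fun i hi => ?_, fun i hi => ?_, fun i hi => ?_, by omega, ?_, ?_, ?_, ?_⟩,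
    by omega, hstore, by rw [hs]⟩
  · rw [hcell, if_neg (by omega)]
    exact h.blank i hi
  · rw [hra, hla]
    exact h.old i hi
  · rw [hcell, if_neg (by omega)]
    exact h.new i (by omega)
  · rw [hlen]
    have := h.le_len
    omega
  · rw [hstore, h.load]
  · simp only [hra, hla, hstore]
    exact h.data
  · rw [stream_succ, h.all, List.append_assoc, List.append_assoc]
    simp only [hrb]
    congr 2
    obtain ⟨d, hd⟩ := Nat.exists_eq_add_of_le hY
    have e : (t.A k).tape.head = ((t.A k).tape.head - (n + 1)) + (n + 1) := by omega
    have h1 : fm (fun i => ((t.A k).tape.cell i).lb) Y =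
        fm (fun i => ((t.A k).tape.cell ((t.A k).tape.head + i)).lb) d := by
      rw [hd, fm_add, fm_eq_nil fun i hi => h.new i hi, List.nil_append]
    -- The datum is placed, in reverse, directly to the left of what this trip has written on the
    -- way back so far; the cells further left are still empty on this track.
    have h2 : fm (fun i => ((t.A (k + 1)).tape.cell i).lb) Y =
        (fm (inp (t.x k) n) (n + 1)).reverse ++
        fm (fun i => ((t.A k).tape.cell ((t.A k).tape.head + i)).lb) d := by
      rw [hd, fm_add]
      congr 1
      · rw [e, fm_add, fm_eq_nil (n := (t.A k).tape.head - (n + 1)), List.nil_append, fm_reverse]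
        · refine fm_congr fun i hi => ?_
          rw [hcell, if_pos (by omega)]
          simp only [WCell.setLb]
          congr 1
          omega
        · intro i hi
          rw [hcell, if_neg (by omega)]
          exact h.new i (by omega)
      · refine fm_congr fun i hi => ?_
        rw [hcell, if_neg (by omega)]
    rw [h1, h2, List.reverse_append, List.reverse_reverse, fm_inp _ _ (by omega)]

/-- The cycle in which the head on the work tape arrives at the marker. -/
theorem Left.arrive {t : Traj s g body} {k X Y : ℕ} {V : List (Sym s)} (h : t.Left k X Y V)
    (hh : (t.A k).tape.head ≤ max (t.x k).length (t.A k).len) :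
    ∃ l V', t.Right (k + 1) Y V' ∧ (t.A (k + 1)).loc = (t.A k).loc ∧
      (t.A (k + 1)).store = { (t.A k).store with load := l } ∧
      (t.A k).store.eaten ++ l = V ∧ (stream t.x k).length ≤ V'.length := by
  have hlen := t.len_succ k
  have hs := t.step k
  rw [Abs.step, if_pos h.left] at hs
  simp only at hs
  rw [if_neg (by omega)] at hs
  have hXl := h.le_len
  generalize hn : max (t.x k).length (t.A k).len = n at *
  rw [← hlen] at hs
  generalize hl' : (t.A (k + 1)).len = l' at *
  have hhead : (t.A (k + 1)).tape.head = l' + 2 := by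
    rw [hs]
    show 1 + (l' + 1) = _
    omega
  -- The tape when the head has reached the marker, with the first letters of the datum written; the
  -- remaining letters open the next trip.
  set T := goLeft (t.A k).tape n (inp (t.x k) n) with hT
  have hTc : ∀ i, T.cell i = if i < (t.A k).tape.head then
      ((t.A k).tape.cell i).setLb (inp (t.x k) n ((t.A k).tape.head - 1 - i))
      else (t.A k).tape.cell i := by
    intro i
    rw [hT]
    simp only [goLeft]
    by_cases hi : i < (t.A k).tape.head
    · rw [if_pos (by omega), if_pos hi]
    · rw [if_neg (by omega), if_neg hi]
  have hcell : ∀ i, (t.A (k + 1)).tape.cell i = if i ≤ l' then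
      (T.cell i).push (if i = l' then some none
        else if (t.A k).tape.head ≤ i ∧ i < n then inp (t.x k) n i else none) else T.cell i := by
    intro i
    rw [hs]
    simp only [goRight]
    by_cases hi : i ≤ l'
    · rw [if_pos (by omega), if_pos hi]
      simp only [Nat.add_sub_cancel]
    · rw [if_neg (by omega), if_neg hi]
  have hY := h.head_le
  have hra : ∀ i, (T.cell i).ra = ((t.A k).tape.cell i).ra := fun i => by
    rw [hTc]; split_ifs <;> rfl
  have hla : ∀ i, (T.cell i).la = ((t.A k).tape.cell i).la := fun i => by
    rw [hTc]; split_ifs <;> rfl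
  have hrb : ∀ i, (T.cell i).rb = ((t.A k).tape.cell i).rb := fun i => by
    rw [hTc]; split_ifs <;> rfl
  have hblank : ∀ i ≥ Y, T.cell i = WCell.empty := fun i hi => by
    rw [hTc, if_neg (by omega)]
    exact h.blank i hi
  have hstore : (t.A (k + 1)).store = { (t.A k).store with
      load := fm (fun i => (T.cell i).ra) l' ++ (fm (fun i => (T.cell i).la) l').reverse } := by
    rw [hs]
    rfl
  -- Since `X ≤ len`, restricting the old tracks to the first `l'` cells loses no symbol.
  have hload : (t.A k).store.eaten ++
      (fm (fun i => (T.cell i).ra) l' ++ (fm (fun i => (T.cell i).la) l').reverse) = V := by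
    rw [h.data]
    simp only [hra, hla]
    rw [fm_of_none (m := X) (n := l') (by omega) fun i hi => (h.old i hi).1,
      fm_of_none (m := X) (n := l') (by omega) fun i hi => (h.old i hi).2]
  have hlb : (fm (fun i => (T.cell i).lb) Y).reverse =
      (fm (fun i => ((t.A k).tape.cell i).lb) Y).reverse ++
        ((t.x k).take (t.A k).tape.head).map some := by
    obtain ⟨d, hd⟩ := Nat.exists_eq_add_of_le hY
    rw [hd, fm_add, fm_add, fm_eq_nil (n := (t.A k).tape.head) fun i hi => h.new i hi,
      List.nil_append, List.reverse_append, ← fm_inp_lt (t.x k) n _ hh]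
    congr 1
    · congr 1
      refine fm_congr fun i hi => ?_
      rw [hTc, if_neg (by omega)]
    · rw [fm_reverse]
      refine fm_congr fun i hi => ?_
      rw [hTc, if_pos (by omega)]
      simp only [WCell.setLb]
      congr 1
      omega
  -- The trip just finished becomes the preceding one: its symbols, including the first part of the
  -- current datum, join `V`, and its extent `Y` takes the role of `X`.
  refine ⟨_, V ++ (fm (fun i => (T.cell i).rb) Y ++ (fm (fun i => (T.cell i).lb) Y).reverse),
    ⟨by rw [hs], by omega, fun i hi => ?_, fun i hi => ?_, ?_, ?_⟩, by rw [hs], hstore, hload, ?_⟩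
  · rw [hcell, hblank i hi]
    by_cases hi' : i ≤ l'
    · rw [if_pos hi']
      exact ⟨rfl, rfl, fun hc => by omega⟩
    · rw [if_neg hi']
      exact ⟨rfl, rfl, fun _ => ⟨rfl, rfl⟩⟩
  · rw [hcell, if_pos (by omega)]
    rfl
  · rw [hstore]
    simp only
    rw [hload]
    congr 2
    · refine fm_congr fun i hi => ?_
      rw [hcell]
      split_ifs <;> first | rfl | omega
    · congr 1
      refine fm_congr fun i hi => ?_
      rw [hcell]
      split_ifs <;> first | rfl | omega
  · rw [stream_succ, h.all, hlb]
    simp only [hrb, List.append_assoc]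
    congr 3
    rw [hhead, show l' + 2 - 1 = l' + 1 by omega, fm_add]
    have h1 : fm (fun i => ((t.A (k + 1)).tape.cell (l' + i)).rb) 1 = [none] := by
      have : ((t.A (k + 1)).tape.cell l').rb = some none := by
        rw [hcell, if_pos le_rfl, if_pos rfl]
        rfl
      simp [fm, this]
    have h2 : fm (fun i => ((t.A (k + 1)).tape.cell i).rb) l' =
        ((t.x k).drop (t.A k).tape.head).map some := by
      have h3 : fm (fun i => ((t.A (k + 1)).tape.cell i).rb) l' =
          fm (fun i => if (t.A k).tape.head ≤ i ∧ i < n then inp (t.x k) n i else none) l' := by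
        refine fm_congr fun i hi => ?_
        rw [hcell, if_pos (by omega), if_neg (show i ≠ l' by omega)]
        rfl
      rw [h3, fm_of_none (m := n) (by omega) fun i hi => if_neg (by omega)]
      obtain ⟨d, hd⟩ := Nat.exists_eq_add_of_le hh
      have h4 := fm_inp_lt (t.x k) n n le_rfl
      have h5 := fm_add (inp (t.x k) n) (t.A k).tape.head d
      rw [← hd, h4, fm_inp_lt _ _ _ hh, List.take_of_length_le (by omega)] at h5
      nth_rw 1 [← List.take_append_drop (t.A k).tape.head (t.x k)] at h5
      rw [List.map_append] at h5
      rw [List.append_cancel_left h5]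
      conv_lhs => rw [hd]
      rw [fm_add, fm_eq_nil fun i hi => if_neg (by omega), List.nil_append]
      refine fm_congr fun i hi => ?_
      rw [if_pos (by omega), ← hd]
    rw [h1, h2, ← List.append_assoc, ← List.map_append, List.take_append_drop]
  · rw [h.all, hlb]
    simp only [hrb, List.length_append]
    omega

end Traj

end LinLearn


/-! ### Execution of programs along a run -/

namespace LinLearn

open Machine

/-- The program `p` occurs in `body`, with locations given by `ι` and exit `e`. -/
structure Ctx (body p : Prog) (ι : p.Loc → body.Loc) (e : body.Loc) : Prop where
  instr : ∀ l, body.instr (ι l) = p.instr l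
  next : ∀ l b, (body.next (ι l) b).getD body.entry = (p.next l b).elim e ι

namespace Ctx

variable {body p q : Prog} {e : body.Loc}

/-- At its end the body is entered again, so it is executed as an endless loop. -/
theorem self (body : Prog) : Ctx body body id body.entry :=
  ⟨fun _ => rfl, fun l b => by cases h : body.next l b <;> simp [h]⟩

theorem fst {ι : (Prog.seq p q).Loc → body.Loc} (h : Ctx body (.seq p q) ι e) :
    Ctx body p (fun l => ι (.inl l)) (ι (.inr q.entry)) :=
  ⟨fun l => h.instr (.inl l), fun l b => by
    refine (h.next (.inl l) b).trans ?_
    show ι ((p.next l b).elim (.inr q.entry) .inl) = _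
    cases p.next l b <;> rfl⟩

theorem snd {ι : (Prog.seq p q).Loc → body.Loc} (h : Ctx body (.seq p q) ι e) :
    Ctx body q (fun l => ι (.inr l)) e :=
  ⟨fun l => h.instr (.inr l), fun l b => by
    refine (h.next (.inr l) b).trans ?_
    show ((q.next l b).map .inr).elim e ι = _
    cases q.next l b <;> rfl⟩

theorem loop {r : ℕ} {ι : (Prog.loop r p).Loc → body.Loc} (h : Ctx body (.loop r p) ι e) :
    Ctx body p (fun l => ι (some l)) (ι none) :=
  ⟨fun l => h.instr (some l), fun l b => by
    refine (h.next (some l) b).trans ?_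
    show ι (p.next l b) = _
    cases p.next l b <;> rfl⟩

end Ctx

/-- A fetch only shifts the border between symbols consumed and symbols waiting. Hence no
instruction disturbs the description of the stream in `Right`. -/
theorem exec_eaten_load {s g : ℕ} (len : ℕ) (σ : Store s g) (i : Instr) :
    (i.exec len σ).1.eaten ++ (i.exec len σ).1.load = σ.eaten ++ σ.load := by
  rcases i with a | r
  · cases a with
    | fetch =>
      simp only [Instr.exec, Store.act]
      cases σ.load <;> simp
    | unload r => simp only [Instr.exec, Store.act]; split_ifs <;> rfl
    | push => simp only [Instr.exec, Store.act]; split_ifs <;> rfl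
    | _ => rfl
  · simp only [Instr.exec]
    split_ifs <;> rfl

namespace Traj

variable {s g : ℕ} {body : Prog} {t : Traj s g body}

/-- In the working mode at location `l` with store `σ`. -/
structure At (t : Traj s g body) (k : ℕ) (l : body.Loc) (σ : Store s g) (X : ℕ)
    (V : List (Sym s)) : Prop where
  right : t.Right k X V
  loc : (t.A k).loc = l
  store : (t.A k).store = σ

/-- The word `y` is published from cycle `j` up to cycle `k`. -/
def Pub (t : Traj s g body) (j k : ℕ) (y : List (Fin g)) : Prop :=
  ∀ i, j ≤ i → i < k → (t.A i).store.pub = y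

theorem Pub.trans {i j k : ℕ} {y : List (Fin g)} (h : t.Pub i j y) (h' : t.Pub j k y) :
    t.Pub i k y := fun m h1 h2 => by
  rcases lt_or_ge m j with h3 | h3
  · exact h m h1 h3
  · exact h' m h3 h2

theorem Pub.single {k : ℕ} {y : List (Fin g)} (h : (t.A k).store.pub = y) : t.Pub k (k + 1) y :=
  fun i h1 h2 => by obtain rfl : i = k := by omega
                    exact h

variable {k X : ℕ} {V : List (Sym s)} {l : body.Loc} {σ : Store s g}

theorem At.idle (h : t.At k l σ X V) (hov : t.ov k = false) : t.At (k + 1) l σ X V := by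
  have hs := t.step k
  rw [Abs.step, if_neg (by simp [h.right.left])] at hs
  simp only [hov, Bool.false_eq_true, if_false] at hs
  have hst : (t.A (k + 1)).store = (t.A k).store := by rw [hs]
  refine ⟨h.right.succ ?_ (by rw [hst]), ?_, hst.trans h.store⟩
  · rw [hs]
    exact h.right.left
  · rw [hs]
    exact h.loc

theorem At.exec (h : t.At k l σ X V) (hov : t.ov k = true) :
    (t.A (k + 1)).loc =
      (body.next l ((body.instr l).exec (t.A (k + 1)).len σ).2).getD body.entry ∧
    (t.A (k + 1)).left = (match body.instr l with | .act .turn => σ.load.isEmpty | _ => false) ∧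
    (t.A (k + 1)).store = ((body.instr l).exec (t.A (k + 1)).len σ).1 := by
  have hs := t.step k
  have hlen := t.len_succ k
  rw [Abs.step, if_neg (by simp [h.right.left])] at hs
  simp only [hov, if_true] at hs
  rw [hov] at hlen
  rw [hlen, hs]
  simp only [Abs.exec, h.loc, h.store, h.right.left]
  refine ⟨?_, ?_, ?_⟩ <;> trivial

theorem At.exists_ov (h : t.At k l σ X V) :
    ∃ j ≥ k, t.At j l σ X V ∧ t.ov j = true ∧ t.Pub k j σ.pub := by
  obtain ⟨m, hm, hov⟩ := t.exists_ov k
  obtain ⟨d, rfl⟩ := Nat.exists_eq_add_of_le hm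
  induction d generalizing k with
  | zero => exact ⟨k, le_rfl, h, hov, fun i h1 h2 => by omega⟩
  | succ d ih =>
    rcases hk : t.ov k with _ | _
    · obtain ⟨j, h1, h2, h3, h4⟩ := ih (h.idle hk) (by omega) (by
        rwa [show k + 1 + d = k + (d + 1) by omega])
      exact ⟨j, by omega, h2, h3, (Pub.single (by rw [h.store])).trans h4⟩
    · exact ⟨k, le_rfl, h, hk, fun i h1 h2 => by omega⟩

/-- Wait for the next overflow. The length used by `fill` is the one at the end of that cycle, hence
the occurrence of `k'` in the resulting store. -/
theorem At.op (h : t.At k l σ X V) (hi : body.instr l ≠ .act .turn) :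
    ∃ k' > k, t.At k' ((body.next l ((body.instr l).exec (t.A k').len σ).2).getD body.entry)
      ((body.instr l).exec (t.A k').len σ).1 X V ∧ t.Pub k k' σ.pub := by
  obtain ⟨j, hj, hat, hov, hpub⟩ := h.exists_ov
  obtain ⟨h1, h2, h3⟩ := hat.exec hov
  refine ⟨j + 1, by omega, ⟨hat.right.succ ?_ ?_, h1, h3⟩,
    hpub.trans (Pub.single (by rw [hat.store]))⟩
  · rw [h2]
    split
    · contradiction
    · rfl
  · rw [h3, exec_eaten_load, hat.store]

/-- Every cycle before the arrival moves the head strictly to the left, so the marker is reached by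
induction on the position of the head. -/
theorem Left.exists_right {Y : ℕ} (h : t.Left k X Y V) :
    ∃ k' > k, ∃ L V', t.Right k' Y V' ∧ (t.A k').loc = (t.A k).loc ∧
      (t.A k').store = { (t.A k).store with load := L } ∧ (t.A k).store.eaten ++ L = V ∧
      (stream t.x k).length ≤ V'.length ∧ t.Pub k k' (t.A k).store.pub := by
  obtain ⟨p, hp⟩ : ∃ p, (t.A k).tape.head = p := ⟨_, rfl⟩
  induction p using Nat.strong_induction_on generalizing k with
  | _ p ih =>
    by_cases hh : max (t.x k).length (t.A k).len < (t.A k).tape.head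
    · obtain ⟨h1, h2, h3, h4⟩ := h.succ hh
      obtain ⟨k', hk', L, V', g1, g2, g3, g4, g5, g6⟩ := ih _ (by omega) h1 rfl
      rw [h3] at g3 g4 g6
      refine ⟨k', by omega, L, V', g1, g2.trans h4, g3, g4, ?_, (Pub.single rfl).trans g6⟩
      exact ((stream_prefix t.x (Nat.le_succ k)).length_le).trans g5
    · obtain ⟨L, V', g1, g2, g3, g4, g5⟩ := h.arrive (by omega)
      exact ⟨k + 1, by omega, L, V', g1, g2, g3, g4, g5, Pub.single rfl⟩

/-- With symbols still loaded, `turn` does nothing. Otherwise the head returns to the marker and the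
preceding trip is loaded, completely because of `hX`. The new extent `X'` is the turning point,
bounded by `head_le`. -/
theorem At.turn (h : t.At k l σ X V) (hi : body.instr l = .act .turn) (hX : X ≤ (t.A k).len) :
    ∃ k' > k, ∃ X' V' L,
      t.At k' ((body.next l true).getD body.entry) { σ with load := L } X' V' ∧ t.Pub k k' σ.pub ∧
      ((σ.load ≠ [] ∧ X' = X ∧ V' = V ∧ L = σ.load) ∨
        (σ.load = [] ∧ σ.eaten ++ L = V ∧ (stream t.x k).length ≤ V'.length ∧
          X' ≤ headBound (t.A k').len)) := by
  obtain ⟨j, hj, hat, hov, hpub⟩ := h.exists_ov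
  obtain ⟨h1, h2, h3⟩ := hat.exec hov
  rw [hi] at h1 h2 h3
  simp only [Instr.exec, Store.act] at h1 h2 h3
  have hst := hat.store
  have hpub' := hpub.trans (Pub.single (t := t) (k := j) (y := σ.pub) (by rw [hst]))
  by_cases hl : σ.load = []
  · rw [hl] at h2
    have hleft := hat.right.turn
      (hX.trans ((t.len_mono hj).trans (t.len_mono (Nat.le_succ j)))) h2 (by rw [h3, hst])
      (by rw [hst, hl]) (by rw [h3, hl])
    obtain ⟨k', hk', L, V', g1, g2, g3, g4, g5, g6⟩ := hleft.exists_right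
    rw [h3] at g3 g4 g6
    refine ⟨k', by omega, _, V', L, ⟨g1, g2.trans h1, g3⟩, hpub'.trans g6,
      Or.inr ⟨hl, g4, ?_, ?_⟩⟩
    · exact ((stream_prefix t.x (show k ≤ j + 1 by omega)).length_le).trans g5
    · exact (t.head_le (j + 1)).trans (headBound_mono (t.len_mono hk'.le))
  · refine ⟨j + 1, by omega, X, V, σ.load, ⟨hat.right.succ ?_ ?_, h1, h3⟩, hpub',
      Or.inl ⟨hl, rfl, rfl, rfl⟩⟩
    · rw [h2]
      simpa using hl
    · rw [h3, hat.store]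

theorem act_of_pure {a : Act} (ha : a.Pure) (len : ℕ) (σ : Store s g) : σ.act len a = σ.act 0 a := by
  cases a <;> first | rfl | exact ha.elim

theorem act_pub_of_pure {a : Act} (ha : a.Pure) (σ : Store s g) : (σ.act 0 a).pub = σ.pub := by
  cases a with
  | unload r => simp only [Store.act]; split_ifs <;> rfl
  | push => simp only [Store.act]; split_ifs <;> rfl
  | publish => exact ha.elim
  | fetch => exact ha.elim
  | _ => rfl

/-- Executions of pure programs are carried out by the machine. -/
theorem At.run {p : Prog} {σ' : Store s g} (hp : Exec p σ σ') :
    ∀ {ι : p.Loc → body.Loc} {e : body.Loc} (_ : Ctx body p ι e) {k : ℕ}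
      (_ : t.At k (ι p.entry) σ X V),
      σ'.pub = σ.pub ∧ ∃ k' ≥ k, t.At k' e σ' X V ∧ t.Pub k k' σ.pub := by
  induction hp with
  | @act a σ ha =>
    intro ι e hc k h
    have hin := hc.instr (Prog.entry (.act a))
    rw [Prog.instr] at hin
    obtain ⟨k', hk', h1, h2⟩ := h.op (by
      rw [hin]
      rintro ⟨⟩
      exact ha)
    rw [hc.next, hin] at h1
    simp only [Instr.exec] at h1
    rw [act_of_pure ha] at h1
    exact ⟨act_pub_of_pure ha σ, k', hk'.le, h1, h2⟩
  | @seq p q σ σ' σ'' _ _ ihp ihq =>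
    intro ι e hc k h
    obtain ⟨e1, k1, hk1, h1, h2⟩ := ihp hc.fst h
    obtain ⟨e2, k2, hk2, h3, h4⟩ := ihq hc.snd h1
    rw [e1] at h4
    exact ⟨e2.trans e1, k2, by omega, h3, h2.trans h4⟩
  | @done r p σ h0 =>
    intro ι e hc k h
    have hin := hc.instr (Prog.entry (.loop r p))
    rw [Prog.entry, Prog.instr] at hin
    obtain ⟨k', hk', h1, h2⟩ := h.op (by rw [Prog.entry, hin]; rintro ⟨⟩)
    rw [hc.next, Prog.entry, hin] at h1
    simp only [Instr.exec, if_pos h0] at h1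
    exact ⟨rfl, k', hk'.le, h1, h2⟩
  | @next r p σ σ' σ'' h0 _ _ ihp ihl =>
    intro ι e hc k h
    have hin := hc.instr (Prog.entry (.loop r p))
    rw [Prog.entry, Prog.instr] at hin
    obtain ⟨k', hk', h1, h2⟩ := h.op (by rw [Prog.entry, hin]; rintro ⟨⟩)
    rw [hc.next, Prog.entry, hin] at h1
    simp only [Instr.exec, if_neg h0] at h1
    obtain ⟨e1, k1, hk1, h3, h4⟩ := ihp hc.loop h1
    obtain ⟨e2, k2, hk2, h5, h6⟩ := ihl hc h3
    simp only [Store.setReg] at e1 h4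
    rw [e1] at e2 h6
    exact ⟨e2, k2, by omega, h5, h2.trans (h4.trans h6)⟩

end Traj

end LinLearn


/-! ### The programs for updating the learner and for waiting -/

namespace LinLearn

section Programs

variable {s g : ℕ}

theorem exists_adds_one {f : ℕ → ℕ} (hf : Primrec f) {a out base : ℕ} (ha : a < base)
    (ho : out < base) (hao : a ≠ out) :
    ∃ p, ∀ (σ : Store s g) (ρ : ℕ → ℕ), (∀ r ≥ base, ρ r = 0) →
      Exec p (σ.setReg ρ) (σ.setReg (addReg ρ out (f (ρ a)))) := by
  obtain ⟨p, hp⟩ := exists_adds s g (Nat.Primrec'.prim_iff₁.2 hf) (fun _ => a) out base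
    (fun _ => ha) ho fun _ => hao
  exact ⟨p, fun σ ρ hρ => by simpa [List.Vector.ofFn] using hp σ ρ hρ⟩

theorem exists_adds_two {f : ℕ → ℕ → ℕ} (hf : Primrec₂ f) {a b out base : ℕ} (ha : a < base)
    (hb : b < base) (ho : out < base) (hao : a ≠ out) (hbo : b ≠ out) :
    ∃ p, ∀ (σ : Store s g) (ρ : ℕ → ℕ), (∀ r ≥ base, ρ r = 0) →
      Exec p (σ.setReg ρ) (σ.setReg (addReg ρ out (f (ρ a) (ρ b)))) := by
  obtain ⟨p, hp⟩ := exists_adds s g (Nat.Primrec'.prim_iff₂.2 hf) ![a, b] out base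
    (fun i => by fin_cases i <;> assumption) ho fun i => by fin_cases i <;> assumption
  exact ⟨p, fun σ ρ hρ => by simpa [List.Vector.ofFn] using hp σ ρ hρ⟩

/-- Unloading the whole letter. -/
theorem Exec.unload (σ : Store s g) (r : ℕ) :
    Exec (Prog.seqFin (s + 1) fun _ => .act (.unload r)) σ
      { σ with letter := 0, reg := addReg σ.reg r σ.letter } := by
  have h := Exec.seqFin (s := s) (g := g) (m := s + 1) (fun _ => .act (.unload r))
    (fun j => { σ with
      letter := ⟨σ.letter - j, by omega⟩
      reg := addReg σ.reg r (min j σ.letter) }) fun i => by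
    -- The letter code is at most `s + 1`, so `s + 1` attempts empty it; superfluous ones have no
    -- effect.
    have h1 := Exec.act (a := .unload r) (σ := { σ with
      letter := ⟨σ.letter - i, by omega⟩
      reg := addReg σ.reg r (min i σ.letter) }) trivial
    convert h1 using 1
    simp only [Store.act]
    split_ifs with h0
    · have h2 : (σ.letter : ℕ) - i = 0 := congrArg Fin.val h0
      congr 2
      · omega
      · omega
    · have h2 : (σ.letter : ℕ) - i ≠ 0 := fun e => h0 (Fin.ext e)
      congr 1
      · funext x
        simp only [addReg, Function.update_apply]
        split_ifs <;> omega
      · ext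
        rw [Fin.val_sub_one_of_ne_zero h0]
        simp only
        omega
  have hl := σ.letter.isLt
  convert h using 1
  · simp [addReg]
  · congr 1
    · congr 1
      omega
    · ext
      simp only [Fin.val_zero]
      omega

/-- Forming a letter. -/
theorem Exec.ticks (σ : Store s g) {r v : ℕ} (hr : σ.reg r = v) (hv : v < g + 1)
    (hp : σ.pend = 0) :
    Exec (.loop r (.act .tick)) σ
      { σ with pend := ⟨v, hv⟩, reg := Function.update σ.reg r 0 } := by
  have h := Exec.loop_of (p := .act .tick) (r := r) (fun k => { σ with
    pend := ⟨v - k, by omega⟩, reg := Function.update σ.reg r k }) v (fun k _ => by simp)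
    (fun k hk => by
      have h1 := Exec.act (a := .tick) (σ := { σ with
        pend := ⟨v - (k + 1), by omega⟩, reg := Function.update σ.reg r k }) trivial
      convert h1 using 1
      · simp [Store.setReg]
      · simp only [Store.act]
        rw [dif_pos (by omega)]
        congr 2
        omega)
  have hs : Function.update σ.reg r v = σ.reg := by rw [← hr]; simp
  rw [hs] at h
  have hp' : σ.pend = ⟨v - v, by omega⟩ := by
    rw [hp]
    ext
    simp
  rw [← hp'] at h
  exact h

end Programs

namespace Guesser

variable {s g : ℕ} (P : Guesser s g)

/-- The code of a letter of the conjecture. -/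
noncomputable def outCode (n i : ℕ) : ℕ := ((P.out n)[i]?).elim 0 fun a => a.val + 1

theorem primrec_outCode : Primrec₂ P.outCode := by
  have h : Primrec fun p : ℕ × ℕ => (P.out p.1)[p.2]? :=
    Primrec.list_getElem?.comp (P.primrec_out.comp Primrec.fst) Primrec.snd
  exact (Primrec.dom_finite fun a : Option (Fin g) => a.elim 0 fun a => a.val + 1).comp h

/-- The registers between two iterations. -/
def regs (n r : ℕ) : ℕ := if r = 0 then n else 0

/-- The program that updates the state and builds the conjecture. -/
theorem exists_update : ∃ p : Prog, ∀ (n : ℕ) (σ : Store s g), σ.reg = regs n → σ.pend = 0 →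
    σ.build = [] → Exec p σ { σ with
      reg := regs (P.upd n σ.letter), letter := 0, build := P.out (P.upd n σ.letter) } := by
  -- Register `0` holds the code of the state, `1` the fetched symbol, `3` the number of letters
  -- still to be produced, `4` the code of the next letter, `5` its position, `6` the new state.
  -- Register `2` is left to the waiting program, and the registers from `7` on are scratch.
  obtain ⟨p₁, h₁⟩ := exists_adds_two (s := s) (g := g) P.primrec_upd (a := 0) (b := 1) (out := 6)
    (base := 7) (by norm_num) (by norm_num) (by norm_num) (by norm_num) (by norm_num)
  obtain ⟨p₂, h₂⟩ := exists_adds_one (s := s) (g := g) (Primrec.list_length.comp P.primrec_out)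
    (a := 0) (out := 3) (base := 7) (by norm_num) (by norm_num) (by norm_num)
  obtain ⟨p₃, h₃⟩ := exists_adds_two (s := s) (g := g) P.primrec_outCode (a := 0) (b := 5)
    (out := 4) (base := 7) (by norm_num) (by norm_num) (by norm_num) (by norm_num) (by norm_num)
  refine ⟨.seq (.seqFin (s + 1) fun _ => .act (.unload 1)) (.seq p₁ (.seq (.clear 0)
    (.seq (.clear 1) (.seq (.move 6 0) (.seq p₂ (.seq (.loop 3 (.seq p₃ (.seq (.loop 4 (.act .tick))
      (.seq (.act .push) (.act (.inc 5)))))) (.clear 5))))))), ?_⟩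
  intro n σ hreg hpend hbuild
  obtain ⟨c, hc⟩ : ∃ c : ℕ, (σ.letter : ℕ) = c := ⟨_, rfl⟩
  rw [hc]
  set τ : Store s g := { σ with letter := 0 } with hτ
  have e1 := Exec.unload σ 1
  rw [hc, hreg] at e1
  replace e1 : Exec _ σ (τ.setReg (addReg (regs n) 1 c)) := e1
  have e2 := h₁ τ (addReg (regs n) 1 c) (fun r hr => by
    simp only [addReg, Function.update_apply, regs]
    split_ifs <;> omega)
  have hv : P.upd (addReg (regs n) 1 c 0) (addReg (regs n) 1 c 1) = P.upd n c := by
    simp [addReg, regs]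
  rw [hv] at e2
  generalize P.upd n c = m at *
  have e3 := Exec.clear τ (addReg (addReg (regs n) 1 c) 6 m) 0
  have e4 := Exec.clear τ (Function.update (addReg (addReg (regs n) 1 c) 6 m) 0 0) 1
  have e5 := Exec.move τ (Function.update (Function.update
    (addReg (addReg (regs n) 1 c) 6 m) 0 0) 1 0) (a := 6) (b := 0) (by norm_num)
  have hr5 : addReg (Function.update (Function.update (Function.update
      (addReg (addReg (regs n) 1 c) 6 m) 0 0) 1 0) 6 0) 0 ((Function.update (Function.update
      (addReg (addReg (regs n) 1 c) 6 m) 0 0) 1 0) 6) = regs m := by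
    funext r
    simp only [addReg, Function.update_apply, regs]
    split_ifs <;> simp_all
  rw [hr5] at e5
  have e6 := h₂ τ (regs m) (fun r hr => by simp only [regs]; split_ifs <;> omega)
  have hm0 : regs m 0 = m := rfl
  rw [hm0] at e6
  set N := (P.out m).length with hN
  -- With `k` letters to go, the first `N - k` letters of the conjecture have been built. The code
  -- of a letter is its number plus one, because `pend = 0` means that no letter is being formed.
  have e7 := Exec.loop_of (r := 3) (p := .seq p₃ (.seq (.loop 4 (.act .tick))
      (.seq (.act .push) (.act (.inc 5))))) (fun k => ({ τ with
        reg := fun r => if r = 0 then m else if r = 3 then k else if r = 5 then N - k else 0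
        build := (P.out m).take (N - k) } : Store s g)) N (fun k _ => rfl) (fun k hk => by
    obtain ⟨i, hi⟩ : ∃ i, N - (k + 1) = i := ⟨_, rfl⟩
    have hi' : N - k = i + 1 := by omega
    have hiN : i < (P.out m).length := by omega
    simp only [hi, hi']
    set υ : Store s g := { τ with build := (P.out m).take i } with hυ
    set ρ : ℕ → ℕ := fun r => if r = 0 then m else if r = 3 then k else if r = 5 then i else 0
      with hρ
    have f1 := h₃ υ ρ (fun r hr => by
      simp only [hρ]
      split_ifs <;> omega)
    have hcode : P.outCode (ρ 0) (ρ 5) = ((P.out m)[i]).val + 1 := by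
      show P.outCode m i = _
      simp [outCode, List.getElem?_eq_getElem hiN]
    rw [hcode] at f1
    have f2 := Exec.ticks (υ.setReg (addReg ρ 4 (((P.out m)[i]).val + 1))) (r := 4)
      (v := ((P.out m)[i]).val + 1) (by simp [addReg, hρ]) (by omega) hpend
    have f3 := Exec.act (a := .push) (σ := { υ.setReg (addReg ρ 4 (((P.out m)[i]).val + 1)) with
      pend := ⟨((P.out m)[i]).val + 1, by omega⟩
      reg := Function.update (υ.setReg (addReg ρ 4 (((P.out m)[i]).val + 1))).reg 4 0 }) trivial
    have f4 := Exec.act (a := .inc 5) (σ := Store.act 0 { υ.setReg (addReg ρ 4 (((P.out m)[i]).val + 1)) with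
      pend := ⟨((P.out m)[i]).val + 1, by omega⟩
      reg := Function.update (υ.setReg (addReg ρ 4 (((P.out m)[i]).val + 1))).reg 4 0 } .push) trivial
    have f := f1.seq (f2.seq (f3.seq f4))
    convert f using 1
    · simp only [Store.setReg, hυ]
      congr 1
      funext r
      simp only [hρ, Function.update_apply]
      split_ifs <;> first | rfl | omega
    · simp only [Store.act, Store.setReg]
      rw [dif_neg (by simp [Fin.ext_iff])]
      simp only [hυ]
      congr 1
      · funext r
        simp only [hρ, Function.update_apply, addReg]
        split_ifs <;> first | rfl | omega | contradiction
      · rw [List.take_add_one, List.getElem?_eq_getElem hiN]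
        congr 1)
  have e8 := Exec.clear { τ with build := P.out m }
    (fun r => if r = 0 then m else if r = 3 then 0 else if r = 5 then N else 0) 5
  have e6' : addReg (regs m) 3 N = fun r => if r = 0 then m else if r = 3 then N
      else if r = 5 then N - N else 0 := by
    funext r
    simp only [addReg, Function.update_apply, regs]
    split_ifs <;> first | omega | contradiction
  rw [e6'] at e6
  have e78 : Exec (.seq (.loop 3 (.seq p₃ (.seq (.loop 4 (.act .tick))
      (.seq (.act .push) (.act (.inc 5)))))) (.clear 5)) (τ.setReg fun r => if r = 0 then m else if r = 3 then N
      else if r = 5 then N - N else 0) ({ τ with build := P.out m }.setReg (regs m)) := by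
    refine Exec.seq (σ' := { τ with
        reg := fun r => if r = 0 then m else if r = 3 then 0 else if r = 5 then N - 0 else 0
        build := (P.out m).take (N - 0) }) ?_ ?_
    · convert e7 using 1
      simp [Store.setReg, hτ, hbuild]
    · convert e8 using 1
      · simp [Store.setReg, hN]
      · congr 1
        funext r
        simp only [Function.update_apply, regs]
        split_ifs <;> first | rfl | omega
  exact e1.seq (e2.seq (e3.seq (e4.seq (e5.seq (e6.seq e78)))))

theorem primrec_headBound : Primrec headBound := by
  have h : Primrec fun l : ℕ => 2 ^ l := by
    refine (Primrec.nat_rec₁ (f := fun _ IH => IH + IH) 1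
      (Primrec.nat_add.comp Primrec.snd Primrec.snd)).of_eq fun n => ?_
    induction n with
    | zero => rfl
    | succ n ih =>
      rw [pow_succ, mul_two, ← ih]
  exact Primrec.nat_mul.comp h (Primrec.nat_add.comp Primrec.id (Primrec.const 2))

/-- The value is not needed as a number: a register is unary on the base tape, so holding `headBound
l` forces the base tape to be at least that long. -/
theorem exists_wait (s g : ℕ) : ∃ p : Prog, ∀ (n l : ℕ) (σ : Store s g),
    σ.reg = Function.update (regs n) 2 l →
      Exec p σ (σ.setReg (addReg (Function.update (regs n) 2 l) 6 (headBound l))) := by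
  obtain ⟨p, hp⟩ := exists_adds_one (s := s) (g := g) primrec_headBound (a := 2) (out := 6)
    (base := 7) (by norm_num) (by norm_num) (by norm_num)
  refine ⟨p, fun n l σ hσ => ?_⟩
  have h := hp σ σ.reg (fun r hr => by
    rw [hσ, Function.update_apply]
    simp only [regs]
    split_ifs <;> omega)
  rw [Store.setReg_self] at h
  rw [hσ] at h
  simpa using h

end Guesser

end LinLearn


/-! ### One round of the main loop -/

namespace LinLearn

/-- The body of the main loop: the program `p` updates the state and builds the conjecture, the
program `q` waits until the base tape is long enough. -/
def mainBody (p q : Prog) : Prog :=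
  .seq (.act .fetch) (.seq p (.seq (.act .publish) (.seq (.act (.fill 2)) (.seq q
    (.seq (.seq (.clear 6) (.clear 2)) (.act .turn))))))

/-- Makes `Traj.reg_le` applicable to register `6`. -/
theorem le_bound_mainBody (p q : Prog) : 7 ≤ (mainBody p q).bound := by
  simp [mainBody, Prog.bound, Prog.clear]

theorem Store.act_fetch {s g : ℕ} (len : ℕ) (σ : Store s g) : σ.act len .fetch =
    { σ with
      load := σ.load.tail
      letter := σ.load.head?.elim 0 Sym.code
      eaten := σ.eaten ++ σ.load.head?.toList } := by
  obtain ⟨_, _ | ⟨x, l⟩, _, _, _, _, _⟩ := σ <;> simp [Store.act]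

namespace Traj

open Guesser

variable {s g : ℕ} {body : Prog}

theorem At.act {t : Traj s g body} {k X : ℕ} {V : List (Sym s)} {σ : Store s g} {a : Act}
    (ha : a ≠ .turn) {ι : (Prog.act a).Loc → body.Loc} {e : body.Loc} (hc : Ctx body (.act a) ι e)
    (h : t.At k (ι (Prog.entry (.act a))) σ X V) :
    ∃ k' > k, t.At k' e (σ.act (t.A k').len a) X V ∧ t.Pub k k' σ.pub := by
  have hin := hc.instr (Prog.entry (.act a))
  rw [Prog.instr] at hin
  obtain ⟨k', hk', h1, h2⟩ := h.op (by
    rw [hin]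
    rintro ⟨⟩
    exact ha rfl)
  rw [hc.next, hin] at h1
  exact ⟨k', hk', h1, h2⟩

/-- At the beginning of an iteration of the main loop. -/
structure Ready (t : Traj s g body) (k : ℕ) (σ : Store s g) (X : ℕ) (V : List (Sym s))
    (n : ℕ) : Prop where
  at_entry : t.At k body.entry σ X V
  reg : σ.reg = regs n
  pend : σ.pend = 0
  build : σ.build = []
  le : X ≤ headBound (t.A k).len

/-- An iteration of the main loop. -/
theorem Ready.iterate {P : Guesser s g} {p q : Prog}
    (hp : ∀ (n : ℕ) (σ : Store s g), σ.reg = regs n → σ.pend = 0 →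
      σ.build = [] → Exec p σ { σ with
        reg := regs (P.upd n σ.letter), letter := 0, build := P.out (P.upd n σ.letter) })
    (hq : ∀ (n l : ℕ) (σ : Store s g), σ.reg = Function.update (regs n) 2 l →
      Exec q σ (σ.setReg (addReg (Function.update (regs n) 2 l) 6 (headBound l))))
    {t : Traj s g (mainBody p q)} {k : ℕ} {σ : Store s g} {X : ℕ} {V : List (Sym s)} {n : ℕ}
    (h : t.Ready k σ X V n) :
    ∃ k' > k, ∃ σ' X' V' n', n' = P.upd n ((σ.load.head?.elim 0 Sym.code : Fin (s + 2)) : ℕ) ∧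
      t.Ready k' σ' X' V' n' ∧ σ'.pub = P.out n' ∧
      (∃ m, k ≤ m ∧ m ≤ k' ∧ t.Pub k m σ.pub ∧ t.Pub m k' σ'.pub) ∧
      σ'.eaten = σ.eaten ++ σ.load.head?.toList ∧
      ((σ.load.tail ≠ [] ∧ V' = V ∧ σ'.load = σ.load.tail) ∨
        (σ.load.tail = [] ∧ σ'.eaten ++ σ'.load = V ∧ (stream t.x k).length ≤ V'.length)) := by
  have c0 := Ctx.self (mainBody p q)
  have c1 := Ctx.snd c0
  have c2 := Ctx.snd c1
  have c3 := Ctx.snd c2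
  have c4 := Ctx.snd c3
  have c5 := Ctx.snd c4
  obtain ⟨k₁, hk₁, a₁, b₁⟩ := h.at_entry.act (by rintro ⟨⟩) (Ctx.fst c0)
  rw [Store.act_fetch] at a₁
  obtain ⟨n', hn'⟩ : ∃ n', n' = P.upd n ((σ.load.head?.elim 0 Sym.code : Fin (s + 2)) : ℕ) :=
    ⟨_, rfl⟩
  have x₁ := hp n { σ with
      load := σ.load.tail
      letter := σ.load.head?.elim 0 Sym.code
      eaten := σ.eaten ++ σ.load.head?.toList } h.reg h.pend h.build
  simp only at x₁
  rw [← hn'] at x₁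
  obtain ⟨-, k₂, hk₂, a₂, b₂⟩ := At.run x₁ (Ctx.fst c1) a₁
  obtain ⟨k₃, hk₃, a₃, b₃⟩ := a₂.act (by rintro ⟨⟩) (Ctx.fst c2)
  obtain ⟨k₄, hk₄, a₄, b₄⟩ := a₃.act (by rintro ⟨⟩) (Ctx.fst c3)
  simp only [Store.act, Store.setReg] at a₃ a₄ b₃ b₄
  obtain ⟨e₅, k₅, hk₅, a₅, b₅⟩ := At.run (hq n' (t.A k₄).len _ rfl) (Ctx.fst c4) a₄
  -- The waiting is over: the base tape is now longer than the extent `X` of the preceding trip,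
  -- which `h.le` bounds by an earlier value of `headBound`.
  have hlen : headBound (t.A k₄).len ≤ (t.A k₅).len := by
    have h6 := t.reg_le k₅ 6 (le_bound_mainBody p q)
    rw [a₅.store] at h6
    refine le_trans (le_of_eq ?_) h6
    simp [Store.setReg, addReg, regs]
  obtain ⟨e₆, k₆, hk₆, a₆, b₆⟩ := At.run
    ((Exec.clear _ _ 6).seq (Exec.clear _ _ 2)) (Ctx.fst c5) a₅
  obtain ⟨k₇, hk₇, X', V', L, a₇, b₇, hturn⟩ := a₆.turn rfl
    (h.le.trans ((headBound_mono (t.len_mono (by omega))).trans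
      (hlen.trans (t.len_mono (by omega)))))
  have hregs : Function.update (Function.update (addReg (Function.update (regs n') 2
      (t.A k₄).len) 6 (headBound (t.A k₄).len)) 6 0) 2 0 = regs n' := by
    funext r
    simp only [addReg, Function.update_apply, regs]
    split_ifs <;> omega
  simp only [Store.setReg] at a₇ b₅ b₆ b₇ hturn
  rw [hregs] at a₇
  -- The published word changes exactly once during the round, by the `publish` that ends at `k₃`.
  refine ⟨k₇, by omega, _, X', V', n', hn', ⟨a₇, rfl, h.pend, rfl, ?_⟩, rfl,
    ⟨k₃, by omega, by omega, b₁.trans (b₂.trans b₃), b₄.trans (b₅.trans (b₆.trans b₇))⟩, rfl, ?_⟩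
  · rcases hturn with ⟨-, h1, -⟩ | ⟨-, -, -, h1⟩
    · rw [h1]
      exact h.le.trans (headBound_mono (t.len_mono (by omega)))
    · exact h1
  · rcases hturn with ⟨h0, -, h1, h2⟩ | ⟨h0, h1, h2, -⟩
    · exact Or.inl ⟨h0, h1, h2⟩
    · exact Or.inr ⟨h0, h1, ((stream_prefix t.x (by omega)).length_le).trans h2⟩

end Traj

end LinLearn


/-! ### Every symbol is processed, and the published words converge -/

namespace LinLearn

/-- A queue of which a part has been eaten and a part is loaded: when the loaded part is used up, it
is replaced by what has been stored before, up to the position `v`. -/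
theorem exists_le_of_queue {E L v : ℕ → ℕ}
    (h : ∀ i, E (i + 1) = E i + min (L i) 1 ∧
      ((2 ≤ L i ∧ v (i + 1) = v i ∧ L (i + 1) + 1 = L i) ∨
        (L i ≤ 1 ∧ E (i + 1) + L (i + 1) = v i ∧ i ≤ v (i + 1)))) (N : ℕ) : ∃ i, N ≤ E i := by
  have hnext : ∀ i, ∃ j ≥ i, L j ≤ 1 ∧ v j = v i ∧ E j + L j = E i + L i := by
    intro i
    obtain ⟨n, hn⟩ : ∃ n, L i = n := ⟨_, rfl⟩
    induction n generalizing i with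
    | zero => exact ⟨i, le_rfl, by omega, rfl, rfl⟩
    | succ n ih =>
      obtain ⟨h1, ⟨h2, h3, h4⟩ | ⟨h2, -⟩⟩ := h i
      · obtain ⟨j, hj, g1, g2, g3⟩ := ih (i + 1) (by omega)
        exact ⟨j, by omega, g1, by omega, by omega⟩
      · exact ⟨i, le_rfl, h2, rfl, rfl⟩
  -- After the reload at `j₁` at least `N` symbols lie below `v`, at `j₂` these are loaded, and just
  -- after `j₃` they have been eaten.
  obtain ⟨j₁, hj₁, a₁, -, -⟩ := hnext N
  obtain ⟨j₂, hj₂, a₂, b₂, -⟩ := hnext (j₁ + 1)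
  obtain ⟨j₃, hj₃, a₃, -, c₃⟩ := hnext (j₂ + 1)
  obtain ⟨-, ⟨d₁, -⟩ | ⟨-, -, d₁⟩⟩ := h j₁
  · omega
  obtain ⟨-, ⟨d₂, -⟩ | ⟨-, d₂, -⟩⟩ := h j₂
  · omega
  exact ⟨j₃ + 1, by have := (h j₃).1; omega⟩

theorem parse_concat {s : ℕ} (l : List (Sym s)) (a : Sym s) :
    parse (l ++ [a]) = parseStep (parse l) a := by
  simp [parse]

namespace Traj

variable {s g : ℕ}

theorem Right.eaten_load_prefix {body : Prog} {t : Traj s g body} {k X : ℕ} {V : List (Sym s)}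
    (h : t.Right k X V) : (t.A k).store.eaten ++ (t.A k).store.load <+: V := by
  rw [h.data]
  exact List.prefix_append _ _

theorem Right.prefix_stream {body : Prog} {t : Traj s g body} {k X : ℕ} {V : List (Sym s)}
    (h : t.Right k X V) : V <+: stream t.x k := by
  rw [h.all]
  exact List.prefix_append _ _

/-- The machine starts in the mode of moving left on an empty work tape; the first arrival loads
nothing and starts the main loop. -/
theorem exists_ready {body : Prog} (t : Traj s g body) {pub₀ : List (Fin g)}
    (h : t.A 0 = Abs.init body pub₀) :
    ∃ k σ V, t.Ready k σ 0 V 0 ∧ σ.pub = pub₀ ∧ σ.eaten = [] ∧ t.Pub 0 k pub₀ := by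
  have hleft : t.Left 0 0 0 [] := by
    refine ⟨?_, fun i _ => ?_, fun i _ => ?_, fun i _ => ?_, ?_, ?_, ?_, ?_, ?_⟩ <;>
      simp [h, Abs.init, WCell.empty, fm, stream]
  obtain ⟨k, hk, L, V, h1, h2, h3, h4, h5, h6⟩ := hleft.exists_right
  rw [h] at h2 h3 h4 h6
  obtain rfl : L = [] := by simpa [Abs.init] using h4
  refine ⟨k, _, V, ⟨⟨h1, h2, h3⟩, ?_, rfl, rfl, Nat.zero_le _⟩, rfl, rfl, h6⟩
  funext r
  simp [Abs.init, Guesser.regs]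

/-- The sequence of iterations of the main loop. -/
theorem exists_iterations {P : Guesser s g} {p q : Prog}
    (hp : ∀ (n : ℕ) (σ : Store s g), σ.reg = Guesser.regs n → σ.pend = 0 →
      σ.build = [] → Exec p σ { σ with
        reg := Guesser.regs (P.upd n σ.letter), letter := 0, build := P.out (P.upd n σ.letter) })
    (hq : ∀ (n l : ℕ) (σ : Store s g), σ.reg = Function.update (Guesser.regs n) 2 l →
      Exec q σ (σ.setReg (addReg (Function.update (Guesser.regs n) 2 l) 6 (headBound l))))
    (t : Traj s g (mainBody p q)) (h0 : t.A 0 = Abs.init (mainBody p q) (P.out 0)) :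
    ∃ (x : ℕ → Guesser.LState s) (a : ℕ → Option (Sym s)) (k : ℕ → ℕ),
      (∀ i, x (i + 1) = P.step (x i) (a i)) ∧ StrictMono k ∧
      (∀ j < k 0, (t.A j).store.pub = P.conj (x 0)) ∧
      (∀ i j, k i ≤ j → j < k (i + 1) →
        (t.A j).store.pub = P.conj (x i) ∨ (t.A j).store.pub = P.conj (x (i + 1))) ∧
      (∀ i, ∀ y ∈ (x i).2.1, ∃ j, y = t.x j) ∧ ∀ j, ∃ i, t.x j ∈ (x i).2.1 := by
  obtain ⟨k₀, σ₀, V₀, hr₀, hpub₀, heat₀, hbefore⟩ := t.exists_ready h0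
  -- Register `0` codes a state of the learner whose data are the parse of the symbols eaten, and
  -- its conjecture is the published word.
  let Inv : ℕ × Store s g × ℕ × List (Sym s) × Guesser.LState s → Prop := fun z =>
    t.Ready z.1 z.2.1 z.2.2.1 z.2.2.2.1 (Encodable.encode z.2.2.2.2) ∧
      z.2.2.2.2.2 = parse z.2.1.eaten ∧ z.2.1.pub = P.conj z.2.2.2.2
  have hstep : ∀ z : {z // Inv z}, ∃ (z' : {z // Inv z}) (a : Option (Sym s)),
      z'.1.2.2.2.2 = P.step z.1.2.2.2.2 a ∧ z.1.1 < z'.1.1 ∧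
      (∃ m, z.1.1 ≤ m ∧ m ≤ z'.1.1 ∧ t.Pub z.1.1 m z.1.2.1.pub ∧ t.Pub m z'.1.1 z'.1.2.1.pub) ∧
      z'.1.2.1.eaten = z.1.2.1.eaten ++ z.1.2.1.load.head?.toList ∧
      ((z.1.2.1.load.tail ≠ [] ∧ z'.1.2.2.2.1 = z.1.2.2.2.1 ∧
          z'.1.2.1.load = z.1.2.1.load.tail) ∨
        (z.1.2.1.load.tail = [] ∧ z'.1.2.1.eaten ++ z'.1.2.1.load = z.1.2.2.2.1 ∧
          (stream t.x z.1.1).length ≤ z'.1.2.2.2.1.length)) := by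
    rintro ⟨⟨k, σ, X, V, st⟩, hr, hst, hpub⟩
    obtain ⟨k', hk', σ', X', V', n', hn', hr', hpub', hm, he, hld⟩ := hr.iterate hp hq
    have hn'' : n' = Encodable.encode (P.step st σ.load.head?) := by
      rw [hn']
      cases σ.load.head? with
      | none => exact P.upd_encode_zero st
      | some a => exact P.upd_encode st a
    rw [hn''] at hr' hpub'
    rw [P.out_encode] at hpub'
    refine ⟨⟨⟨k', σ', X', V', P.step st σ.load.head?⟩, hr', ?_, hpub'⟩, σ.load.head?, rfl, hk', hm,
      he, hld⟩
    simp only at hst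
    simp only [Guesser.step, he, hst]
    cases σ.load.head? with
    | none => simp
    | some a => simp [parse_concat]
  have hinit : Inv ⟨k₀, σ₀, 0, V₀, 0, [], []⟩ := by
    refine ⟨?_, ?_, ?_⟩
    · simp only [Guesser.encode_init]
      exact hr₀
    · simp only [heat₀]
      rfl
    · simp only [hpub₀]
      rw [← P.out_encode, Guesser.encode_init]
  choose f a hf using hstep
  let z : ℕ → {z // Inv z} := fun i => Nat.rec ⟨_, hinit⟩ (fun _ z => f z) i
  have hz : ∀ i, z (i + 1) = f (z i) := fun i => rfl
  have hk : StrictMono fun i => (z i).1.1 := strictMono_nat_of_lt_succ fun i => by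
    show _ < (z (i + 1)).1.1
    rw [hz]
    exact (hf (z i)).2.1
  have hpre : ∀ i, (z i).1.2.1.eaten <+: stream t.x (z i).1.1 := fun i => by
    have h := (z i).2.1.at_entry
    have h1 := h.right.eaten_load_prefix
    rw [h.store] at h1
    exact ((List.prefix_append _ _).trans h1).trans h.right.prefix_stream
  -- Each cycle adds at least an end marker to the stream, so the stream, and with it `V` after a
  -- reload, grows without bound.
  have hlive : ∀ N, ∃ i, N ≤ (z i).1.2.1.eaten.length := by
    refine exists_le_of_queue (L := fun i => (z i).1.2.1.load.length)
      (v := fun i => (z i).1.2.2.2.1.length) fun i => ?_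
    obtain ⟨-, -, -, he, hld⟩ := hf (z i)
    simp only [hz]
    have h1 : i ≤ (z i).1.1 := hk.le_apply
    have h2 := le_length_stream t.x (z i).1.1
    have ht : (z i).1.2.1.load.tail.length = (z i).1.2.1.load.length - 1 := List.length_tail
    refine ⟨?_, ?_⟩
    · rw [he, List.length_append]
      cases (z i).1.2.1.load <;> simp
    · rcases hld with ⟨g1, g2, g3⟩ | ⟨g1, g2, g3⟩
      · have := List.length_pos_iff.2 g1
        exact Or.inl ⟨by omega, by rw [g2], by rw [g3]; omega⟩
      · rw [g1] at ht
        refine Or.inr ⟨?_, ?_, by omega⟩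
        · simp only [List.length_nil] at ht
          omega
        · rw [← g2, List.length_append]
  refine ⟨fun i => (z i).1.2.2.2.2, fun i => a (z i), fun i => (z i).1.1, fun i => ?_, hk,
    fun j hj => ?_, fun i j h1 h2 => ?_, fun i y hy => ?_, fun j => ?_⟩
  · exact (hf (z i)).1
  · rw [hbefore j (Nat.zero_le j) hj, ← P.out_encode]
    exact congrArg P.out Guesser.encode_init.symm
  · obtain ⟨m, m1, m2, m3, m4⟩ := (hf (z i)).2.2.1
    rcases lt_or_ge j m with hj | hj
    · exact Or.inl ((m3 j h1 hj).trans (z i).2.2.2)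
    · exact Or.inr ((m4 j hj h2).trans (f (z i)).2.2.2)
  · have h1 := parse_prefix (hpre i)
    rw [parse_stream, ← (z i).2.2.1] at h1
    obtain ⟨j, -, hj⟩ := List.mem_map.1 (h1.subset hy)
    exact ⟨j, hj.symm⟩
  · obtain ⟨i, hi⟩ := hlive (stream t.x (j + 1)).length
    refine ⟨i, ?_⟩
    -- Both are prefixes of one stream, so the shorter is a prefix of the longer.
    have h1 : stream t.x (j + 1) <+: (z i).1.2.1.eaten := by
      rcases le_total (j + 1) (z i).1.1 with h2 | h2
      · exact List.prefix_of_prefix_length_le (stream_prefix t.x h2) (hpre i) hi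
      · exact List.prefix_of_prefix_length_le List.prefix_rfl
          ((hpre i).trans (stream_prefix t.x h2)) hi
    have h2 := parse_prefix h1
    rw [parse_stream, ← (z i).2.2.1] at h2
    exact h2.subset (List.mem_map.2 ⟨j, by simp, rfl⟩)

/-- If the data form a text for one of the languages, then all published words are indices, and from
some cycle on the same correct index is published. -/
theorem exists_limit {P : Guesser s g} {p q : Prog}
    (hp : ∀ (n : ℕ) (σ : Store s g), σ.reg = Guesser.regs n → σ.pend = 0 →
      σ.build = [] → Exec p σ { σ with
        reg := Guesser.regs (P.upd n σ.letter), letter := 0, build := P.out (P.upd n σ.letter) })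
    (hq : ∀ (n l : ℕ) (σ : Store s g), σ.reg = Function.update (Guesser.regs n) 2 l →
      Exec q σ (σ.setReg (addReg (Function.update (Guesser.regs n) 2 l) 6 (headBound l))))
    (t : Traj s g (mainBody p q)) (h0 : t.A 0 = Abs.init (mainBody p q) (P.out 0))
    (hdef : P.Index P.default)
    (htell : ∀ e, P.Index e → ∀ d, P.Index d →
      (∀ y, P.Mem y e → y.length ≤ e.length + P.c → P.Mem y d) → (∀ y, P.Mem y d → P.Mem y e) →
        ∀ y, P.Mem y d ↔ P.Mem y e)
    {e : List (Fin g)} (he : P.Index e) (htext : ∀ y, P.Mem y e ↔ ∃ k, t.x k = y) :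
    (∀ k, P.Index (t.A k).store.pub) ∧
      ∃ d, P.Index d ∧ (∀ y, P.Mem y d ↔ P.Mem y e) ∧ ∃ k, ∀ j ≥ k, (t.A j).store.pub = d := by
  obtain ⟨x, a, k, hx, hk, hbefore, hpub, hsub, hall⟩ := exists_iterations hp hq t h0
  -- A published word lags behind by at most one round and never goes back to an earlier state.
  have hlater : ∀ i, ∀ j ≥ k i, ∃ i' ≥ i, (t.A j).store.pub = P.conj (x i') := by
    intro i j hj
    have hlt : j < k (i + (j + 1)) := by
      have : i + (j + 1) ≤ k (i + (j + 1)) := hk.le_apply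
      omega
    generalize j + 1 = n at hlt
    induction n generalizing i with
    | zero => exact absurd hlt (by simpa using hj)
    | succ n ih =>
      rcases lt_or_ge j (k (i + 1)) with h | h
      · rcases hpub i j hj h with h | h
        · exact ⟨i, le_rfl, h⟩
        · exact ⟨i + 1, by omega, h⟩
      · obtain ⟨i', hi', h'⟩ := ih (i + 1) h (by rwa [show i + 1 + n = i + (n + 1) by omega])
        exact ⟨i', by omega, h'⟩
  obtain ⟨i, d, hd, hde, hlim⟩ := P.converges x a hx he htell
    (fun i y hy => (htext y).2 (by obtain ⟨j, rfl⟩ := hsub i y hy; exact ⟨j, rfl⟩))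
    (fun y hy => by
      obtain ⟨j, rfl⟩ := (htext y).1 hy
      exact hall j)
  refine ⟨fun j => ?_, d, hd, hde, k i, fun j hj => ?_⟩
  · rcases lt_or_ge j (k 0) with h | h
    · rw [hbefore j h]
      exact P.index_conj hdef _
    · obtain ⟨i', -, h'⟩ := hlater 0 j h
      rw [h']
      exact P.index_conj hdef _
  · obtain ⟨i', hi', h'⟩ := hlater i j hj
    rw [h', hlim i' hi']

end Traj

end LinLearn


/-! ### Numbered alphabets and the proof of the theorem -/

namespace LinLearn

universe u v

theorem conv_map {A A' B B' : Type*} (f : A → A') (h : B → B') (x : List A) (y : List B) :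
    conv (x.map f) (y.map h) = (conv x y).map (Prod.map (Option.map f) (Option.map h)) := by
  simp [conv]

/-- The data of an effective learner for a learnable automatic family, over numbered alphabets. -/
theorem AutomaticFamily.Learnable.exists_guesser {S : Type u} {G : Type v} {s g : ℕ}
    {F : AutomaticFamily S G} (hF : F.Learnable) (eS : S ≃ Fin s) (eG : G ≃ Fin g) :
    ∃ P : Guesser s g, (∀ e, P.Index e ↔ e.map eG.symm ∈ F.index) ∧
      (∀ e, P.Index e → ∀ x, P.Mem x e ↔ x.map eS.symm ∈ F.lang (e.map eG.symm)) ∧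
      ((∃ e, P.Index e) → P.Index P.default) ∧
      ∀ e, P.Index e → ∀ d, P.Index d →
        (∀ y, P.Mem y e → y.length ≤ e.length + P.c → P.Mem y d) →
        (∀ y, P.Mem y d → P.Mem y e) → ∀ y, P.Mem y d ↔ P.Mem y e := by
  classical
  have := Finite.of_equiv _ eS.symm
  obtain ⟨Q, _, A, hA⟩ := F.graph_regular
  obtain ⟨Q', _, B, hB⟩ := F.index_regular
  obtain ⟨c, hc⟩ := hF.exists_uniform_telltaleBound
  let P : Guesser s g :=
    { nA := Fintype.card Q
      nB := Fintype.card Q'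
      A := (DFA.reindex (Fintype.equivFin Q) A).comap
        (Prod.map (Option.map eG.symm) (Option.map eS.symm))
      B := (DFA.reindex (Fintype.equivFin Q') B).comap eG.symm
      c := c
      -- If there are no indices, nothing is required of the conjectures, so any word will do.
      default := if h : ∃ e, e ∈ F.index then h.choose.map eG else [] }
  have hI : ∀ e, P.Index e ↔ e.map eG.symm ∈ F.index := fun e => by
    rw [Guesser.Index, ← DFA.mem_accepts, DFA.accepts_comap, DFA.accepts_reindex, hB]
    rfl
  have hM : ∀ e, P.Index e → ∀ x, P.Mem x e ↔ x.map eS.symm ∈ F.lang (e.map eG.symm) :=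
    fun e he x => by
      rw [F.mem_lang_iff hA ((hI e).1 he), conv_map, Guesser.Mem, ← DFA.mem_accepts,
        DFA.accepts_comap, DFA.accepts_reindex, ← DFA.mem_accepts]
      rfl
  have hsurj : ∀ x : List S, (x.map eS).map eS.symm = x := fun x => by simp
  refine ⟨P, hI, hM, fun ⟨e, he⟩ => ?_, fun e he d hd h1 h2 y => ?_⟩
  · have h : ∃ e, e ∈ F.index := ⟨_, (hI e).1 he⟩
    rw [hI]
    show (if h : ∃ e, e ∈ F.index then h.choose.map eG else []).map eG.symm ∈ F.index
    rw [dif_pos h]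
    simpa using h.choose_spec
  · have hle : F.lang (d.map eG.symm) ≤ F.lang (e.map eG.symm) := fun x hx => by
      change x ∈ F.lang (e.map eG.symm)
      change x ∈ F.lang (d.map eG.symm) at hx
      rw [← hsurj x] at hx ⊢
      exact (hM e he _).1 (h2 _ ((hM d hd _).2 hx))
    have := hc _ ((hI e).1 he) _ ((hI d).1 hd) (fun x hx hl => by
      rw [← hsurj x] at hx ⊢
      refine (hM d hd _).1 (h1 _ ((hM e he _).2 hx) ?_)
      simpa using hl) hle
    rw [hM e he, hM d hd, this]

end LinLearn

theorem theorem4p2 {S G : Type*} [Finite S] [Finite G] (F : LinLearn.AutomaticFamily S G)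
    (hF : F.Learnable) :
    ∃ (M : LinLearn.Learner S G) (c : ℕ), ∀ w : ℕ → List S,
      ∃ (mem : ℕ → List M.Mem) (work : ℕ → LinLearn.Tape (Option M.Work)) (hyp : ℕ → List G)
        (time : ℕ → ℕ),
        M.IsRun w mem work hyp time ∧
        -- the time in each cycle is linear in `n`
        (∀ k, time k ≤ c * (LinLearn.size w k + 1)) ∧
        -- the length of the base tape is `n` up to an additive constant, throughout each cycle
        (∀ k s, (M.configAt (w k) (mem k) (work k) s).base.head ≤ LinLearn.size w k + c) ∧
        (∀ k, (mem (k + 1)).length ≤ LinLearn.size w k + c ∧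
          (hyp k).length ≤ LinLearn.size w k + c) ∧
        -- the learner learns every language of the family from every text for it
        (∀ e ∈ F.index, LinLearn.IsText w (F.lang e) → F.Identifies hyp (F.lang e)) := by
  obtain ⟨s, ⟨eS⟩⟩ := Finite.exists_equiv_fin S
  obtain ⟨g, ⟨eG⟩⟩ := Finite.exists_equiv_fin G
  obtain ⟨P, hI, hM, hdef, htell⟩ := hF.exists_guesser eS eG
  obtain ⟨p, hp⟩ := P.exists_update
  obtain ⟨q, hq⟩ := LinLearn.Guesser.exists_wait s g
  -- The initial memory publishes the conjecture of the initial state, so that conjectures are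
  -- indices from the first cycle on. The constant covers the time bound `4 * max + 10` with a
  -- memory longer than `n` by at most `(P.out 0).length + 1`.
  refine ⟨(LinLearn.Machine.sweeper eS eG.symm (LinLearn.mainBody p q) (P.out 0)).toLearner,
    4 * (P.out 0).length + 20, fun w => ?_⟩
  obtain ⟨A, ov, mem, work, time, h0, hstep, hov, hlen, hrun, htime, hhead, hmem, hpub, hpow,
    hreg⟩ := LinLearn.Machine.exists_run eS eG.symm (LinLearn.mainBody p q) (P.out 0) w
  have hsize : ∀ k, (w k).length ≤ LinLearn.size w k ∧ (A k).len ≤ (P.out 0).length + 1 + LinLearn.size w k ∧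
      (A (k + 1)).len ≤ (P.out 0).length + 2 + LinLearn.size w k := fun k => by
    have h1 : (w k).length ≤ (Finset.range (k + 1)).sup fun i => (w i).length :=
      Finset.le_sup (f := fun i => (w i).length) (by simp)
    have h2 : ((Finset.range k).sup fun i => (w i).length) ≤
        (Finset.range (k + 1)).sup fun i => (w i).length :=
      Finset.sup_mono (Finset.range_mono (Nat.le_succ k))
    have h3 : Nat.log 2 (k + 1 + 1) ≤ Nat.log 2 (k + 1) + 1 := by
      rw [← Nat.log_mul_base (by norm_num) (by omega)]
      exact Nat.log_mono_right (by omega)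
    have h4 := hlen k
    have h5 := hlen (k + 1)
    unfold LinLearn.size
    omega
  refine ⟨mem, work, _, time, hrun, fun k => ?_, fun k n => ?_, fun k => ⟨?_, ?_⟩,
    fun e he htext => ?_⟩
  · obtain ⟨h1, h2, -⟩ := hsize k
    have h3 := htime k
    have h4 : (4 * (P.out 0).length + 20) * (LinLearn.size w k + 1) =
      4 * (P.out 0).length * LinLearn.size w k + 20 * LinLearn.size w k + 4 * (P.out 0).length + 20 := by ring
    omega
  · obtain ⟨h1, h2, -⟩ := hsize k
    have h3 := hhead k n
    omega
  · obtain ⟨-, -, h1⟩ := hsize k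
    rw [hmem]
    omega
  · obtain ⟨-, -, h1⟩ := hsize k
    have h2 := hpub (k + 1)
    simp only [List.length_map]
    omega
  · have he' : P.Index (e.map eG) := by
      rw [hI]
      simpa using he
    obtain ⟨h1, d, hd, hde, k, hk⟩ := LinLearn.Traj.exists_limit hp hq
      ⟨A, fun k => (w k).map eS, ov, hstep, hov, hreg, hpow, by rw [h0]; rfl⟩ h0
      (hdef ⟨_, he'⟩) htell he' fun y => by
        rw [hM _ he']
        simp only [List.map_map, Equiv.symm_comp_self, List.map_id]
        rw [htext]
        refine exists_congr fun k => ⟨fun h => ?_, fun h => ?_⟩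
        · simp [h]
        · simp [← h]
    replace hk : ∀ j ≥ k, (A j).store.pub = d := hk
    -- The conjecture of cycle `k` is the word published after this cycle, hence the shift by one.
    refine ⟨fun k => (hI _).1 (h1 (k + 1)), k, ?_, fun j hj => ?_⟩
    · simp only [hk (k + 1) (by omega)]
      ext x
      have := hde (x.map eS)
      rw [hM d hd, hM _ he'] at this
      simpa using this
    · simp only [hk (j + 1) (by omega), hk (k + 1) (by omega)]
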